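/- **Setting.** Let $n\ge 2$, $k=n-1$, and let $R(T)=\mathbb{Z}[e^{\pm a_1},\dots,e^{\pm a_n}]/(e^{a_1+\cdots+a_n}-1)$. Put $b_i=1-e^{-a_i}$, with indices taken modulo $n$, and $\Omega(b_i|y)=\prod_{j\ge1}(1-b_iy_j)^{-1}$ for infinitely many variables $y=(y_1,y_2,\dots)$. Permutations of the $a_i$ act on (symmetric) power series in $y$ through the coefficients; $\omega$ denotes $b_i\mapsto b_{i+1}$. *$K$-$k$-Schur functions.* For $i\in\mathbb{Z}/n$ let $T_i=(1-e^{a_i-a_{i+1}})^{-1}(s_i-1)$ and $D_i=T_i+1$, where for $i\ne0$ $s_i$ exchanges $a_i,a_{i+1}$, and $s_0(f)=\frac{\Omega(b_1|y)}{\Omega(b_n|y)}s_\theta(f)$ with $s_\theta$ exchanging $a_1,a_n$. For a $k$-bounded partition $\lambda$ let $s_{i_1}\cdots s_{i_\ell}$ be the reduced word obtained by reading the residues $(\text{column}-\text{row})\bmod n$ of the boxes of $\lambda$, rows from bottom to top, each row from right to left. Put $g^{(k)}_\lambda(y|b)=T_{i_1}\cdots T_{i_\ell}(1)$ and $\tilde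 g^{(k)}_\lambda(y|b)=D_{i_1}\cdots D_{i_\ell}(1)$ (so $\tilde g^{(k)}_\varnothing=1$); $f(y|\omega^m b)$ is $f(y|b)$ with $b_i$ replaced by $b_{i+m}$. *Centralizer family.* Let $A$ be the $n\times n$ matrix with diagonal $e^{-a_1},\dots,e^{-a_n}$, all superdiagonal entries $-1$ and zeros elsewhere, and $P$ the lower unitriangular matrix with entries $e_{i-j}(e^{-a_1},\dots,e^{-a_{i-1}})$, $j\le i$, where $e_m$ denotes the elementary symmetric polynomial. Let $\mathscr{O}(\tilde{\mathscr Z})$ be the $R(T)$-algebra generated by the entries of an upper triangular matrix $Z=(z_{ij})$ and by the $z_{ii}^{-1}$, subject to $AZ=ZA$. Let $\tau_i,\sigma_i$ be the $i$-th leading principal minors of $ZAP$ and $ZP$ ($\tau_0=\sigma_0=1$), let $\sigma$ be the $R(T)$-algebra automorphism $\sigma(Z)=ZA^{-1}$ (so $\sigma(\tau_i)=\sigma_i$), and identify elements of $\mathscr{O}(\tilde{\mathscr Z})$ with symmetric functions by $z_{ij}=e^{a_i+\cdots+a_{j-1}}\,\Omega(b_i|y)\,g^{(k)}_{(j-i)}(y|\omega^ib)$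 for $i\le j$; in particular $z_{ii}=\Omega(b_i|y)$. *Quantum side.* For $0\le m\le i\le n$ let $F^{(i)}_m(z,Q)=\sum_{J\subseteq\{1,\dots,i\},\,|J|=m}\ \prod_{j\in J,\,j+1\notin J}(1-Q_j)\prod_{j\in J}z_j$ with $Q_n=0$. Let $\mathscr{O}(\mathscr Y)$ be the quotient of $R(T)[z_1,\dots,z_n,Q_1,\dots,Q_{n-1}]$ by the ideal generated by $F^{(n)}_i-e_i(e^{-a_1},\dots,e^{-a_n})$, $1\le i\le n$, and $\mathscr{O}(\mathscr Y^\circ)=\mathscr{O}(\mathscr Y)[Q_1^{-1},\dots,Q_{n-1}^{-1}]$. With $\eta_i=1-e^{a_{n-i+1}}$ put $$\psi_i=\sum_{j=0}^{i}(-1)^j(1-\eta_{n-i})^jF^{(i)}_j(z,Q)\quad(1\le i\le n-1),\qquad \mathfrak{G}^Q_{w_\circ}=\prod_{i=1}^{n-1}\psi_i .$$ **Statement.** There is a unique $R(T)$-algebra homomorphism $\Phi_n:\mathscr{O}(\mathscr Y^\circ)\to\mathscr{O}(\tilde{\mathscr Z})[\tau_i^{-1},\sigma_i^{-1}\mid 1\le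 i\le n]$ with $$z_i\mapsto\frac{\tau_i\sigma_{i-1}}{\sigma_i\tau_{i-1}}\ (1\le i\le n),\qquad Q_i\mapsto\frac{\tau_{i-1}\tau_{i+1}}{\tau_i^2}\ (1\le i\le n-1),$$ and $\tilde\Phi_n=\sigma\circ\Phi_n$, with values in symmetric functions through the identification above, satisfies for all $1\le i\le n-1$ $$\tilde\Phi_n(\psi_i)=\frac{\prod_{l=1}^{i}\Omega(b_{i+l+1}|y)}{\sigma_i}\cdot\tilde g^{(k)}_{(n-i-1)^i}(y|\omega^{2i+1}b),$$ where $(n-i-1)^i$ is the rectangular partition with $i$ rows of length $n-i-1$. Consequently $$\tilde\Phi_n(\mathfrak{G}^Q_{w_\circ})=\frac{\prod_{i=1}^{n-1}\prod_{l=1}^{i}\Omega(b_{i+l+1}|y)}{\sigma_1\sigma_2\cdots\sigma_{n-1}}\cdot\prod_{i=1}^{n-2}\tilde g^{(k)}_{(n-i-1)^i}(y|\omega^{2i+1}b).$$ -/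

import Mathlib

noncomputable section

namespace KPeterson

/-! ### The representation ring of the maximal torus of `SL_n` -/

/-- The weight lattice of `SL_n`: `ℤ a_1 ⊕ ⋯ ⊕ ℤ a_n` modulo `a_1 + ⋯ + a_n = 0`.
Indices live in `ℤ/n`, so that `a_0 = a_n`. -/
abbrev Weight (n : ℕ) : Type :=
  (ZMod n → ℤ) ⧸ AddSubgroup.zmultiples (1 : ZMod n → ℤ)

/-- The weight `a_i`. -/
def wt (n : ℕ) (i : ZMod n) : Weight n :=
  QuotientAddGroup.mk (Pi.single i 1)

/-- `R(T) = ℤ[e^{±a_i}] / (e^{a_1 + ⋯ + a_n} - 1)`, as the group ring of the weight lattice. -/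
def RT (n : ℕ) : Type := AddMonoidAlgebra ℤ (Weight n)

instance (n : ℕ) : CommRing (RT n) := inferInstanceAs (CommRing (AddMonoidAlgebra ℤ (Weight n)))

/-- The differences of coordinates separate the points of the weight lattice. -/
def weightDiff (n : ℕ) : Weight n →+ (ZMod n × ZMod n → ℤ) :=
  QuotientAddGroup.lift _
    { toFun := fun v p => v p.1 - v p.2
      map_zero' := by ext p; simp
      map_add' := fun v w => by ext p; simp; ring }
    (by
      rintro _ ⟨k, rfl⟩
      ext p
      simp)

theorem weightDiff_mk (n : ℕ) (v : ZMod n → ℤ) (p : ZMod n × ZMod n) :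
    weightDiff n (QuotientAddGroup.mk v) p = v p.1 - v p.2 := rfl

theorem weightDiff_injective (n : ℕ) : Function.Injective (weightDiff n) := by
  rw [injective_iff_map_eq_zero]
  intro x
  induction x using QuotientAddGroup.induction_on with
  | H v =>
    intro h
    rw [QuotientAddGroup.eq_zero_iff]
    refine ⟨v 0, ?_⟩
    ext i
    have := congrFun h (i, 0)
    rw [weightDiff_mk] at this
    simp at this ⊢
    linarith

instance (n : ℕ) : UniqueSums (Weight n) :=
  UniqueSums.of_injective_addHom (weightDiff n).toAddHom (weightDiff_injective n) inferInstance

instance (n : ℕ) : IsDomain (RT n) := inferInstanceAs (IsDomain (AddMonoidAlgebra ℤ (Weight n)))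

/-- The element `e^μ` of `R(T)`. -/
def expW {n : ℕ} (μ : Weight n) : RT n :=
  (AddMonoidAlgebra.single μ 1 : AddMonoidAlgebra ℤ (Weight n))

/-- The fraction field of `R(T)`. It contains the localization of `R(T)` at the `1 - e^α`. -/
abbrev KT (n : ℕ) : Type := FractionRing (RT n)

/-- `e^μ` in the fraction field of `R(T)`. -/
def expK {n : ℕ} (μ : Weight n) : KT n := algebraMap (RT n) (KT n) (expW μ)

/-! ### Permutations of the equivariant parameters -/

/-- A permutation `s` acts on weights by `a_i ↦ a_{s(i)}`. -/
def permW {n : ℕ} (s : Equiv.Perm (ZMod n)) : Weight n ≃+ Weight n :=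
  QuotientAddGroup.congr _ _ (AddEquiv.arrowCongr s (AddEquiv.refl ℤ)) (by
    rw [AddMonoidHom.map_zmultiples]
    rfl)

/-- A permutation acts on `R(T)` by `e^{a_i} ↦ e^{a_{s(i)}}`. -/
def permR {n : ℕ} (s : Equiv.Perm (ZMod n)) : RT n ≃+* RT n :=
  (AddMonoidAlgebra.domCongr ℤ ℤ (permW s) :
    AddMonoidAlgebra ℤ (Weight n) ≃ₐ[ℤ] AddMonoidAlgebra ℤ (Weight n)).toRingEquiv

theorem permR_expW {n : ℕ} (s : Equiv.Perm (ZMod n)) (μ : Weight n) :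
    permR s (expW μ) = expW (permW s μ) :=
  AddMonoidAlgebra.domCongr_single (R := ℤ) (permW s) μ (1 : ℤ)

/-- The induced action of a permutation on the fraction field of `R(T)`. -/
def permK {n : ℕ} (s : Equiv.Perm (ZMod n)) : KT n ≃+* KT n :=
  IsFractionRing.ringEquivOfRingEquiv (permR s)

theorem permW_wt {n : ℕ} (s : Equiv.Perm (ZMod n)) (i : ZMod n) :
    permW s (wt n i) = wt n (s i) := by
  change QuotientAddGroup.mk _ = QuotientAddGroup.mk _
  congr 1
  ext j
  simp [AddEquiv.arrowCongr, Pi.single_apply, Equiv.symm_apply_eq]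

theorem permK_expK {n : ℕ} (s : Equiv.Perm (ZMod n)) (μ : Weight n) :
    permK s (expK μ) = expK (permW s μ) := by
  rw [permK, expK, IsFractionRing.ringEquivOfRingEquiv_algebraMap, permR_expW]
  rfl

theorem expW_add {n : ℕ} (μ ν : Weight n) : expW (μ + ν) = expW μ * expW ν := by
  have := AddMonoidAlgebra.single_mul_single (R := ℤ) μ ν 1 1
  rw [one_mul] at this
  exact this.symm

theorem expW_zero {n : ℕ} : expW (0 : Weight n) = 1 := rfl

theorem expK_add {n : ℕ} (μ ν : Weight n) : expK (μ + ν) = expK μ * expK ν := by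
  simp [expK, expW_add]

theorem expK_zero {n : ℕ} : expK (0 : Weight n) = 1 := by simp [expK, expW_zero]

theorem expK_injective {n : ℕ} : Function.Injective (expK : Weight n → KT n) := by
  intro μ ν h
  have := IsFractionRing.injective (RT n) (KT n) h
  exact AddMonoidAlgebra.single_left_injective one_ne_zero this

theorem expK_neg_wt_injective {n : ℕ} :
    Function.Injective (fun i : ZMod n => expK (-wt n i)) := by
  intro i j h
  by_contra hij
  have h1 : wt n i = wt n j := neg_injective (expK_injective h)
  have h2 := congrFun (congrArg (weightDiff n) h1) (i, j)
  simp only [wt, weightDiff_mk, Pi.single_eq_same, Pi.single_eq_of_ne hij,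
    Pi.single_eq_of_ne (Ne.symm hij)] at h2
  norm_num at h2

/-! ### Symmetric functions and Demazure operators -/

/-- Formal power series in `y_1, y_2, …` over the fraction field of `R(T)`.
The symmetric power series with coefficients in `R(T)` form a subring of this ring. -/
abbrev Lam (n : ℕ) : Type := MvPowerSeries ℕ (KT n)

/-- The action of a permutation on power series, through the coefficients. -/
def permL {n : ℕ} (s : Equiv.Perm (ZMod n)) : Lam n →+* Lam n :=
  MvPowerSeries.map (permK s : KT n →+* KT n)

/-- `f(y | b) ↦ f(y | ω^m b)`, where `ω` sends `b_i` to `b_{i+1}`. -/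
def shift {n : ℕ} (m : ℕ) : Lam n →+* Lam n :=
  permL (Equiv.addRight (m : ZMod n))

/-- `b_i = 1 - e^{-a_i}`. -/
def bK {n : ℕ} (i : ZMod n) : KT n := 1 - expK (-wt n i)

/-- `Ω(b_i | y) = ∏_j (1 - b_i y_j)⁻¹`. Expanding every factor as a geometric series,
the coefficient of a monomial of total degree `d` is `b_i ^ d`. -/
def Om {n : ℕ} (i : ZMod n) : Lam n := fun d => bK i ^ d.degree

/-- The action of the simple reflection `s_i`, `i ∈ ℤ/n`, of the affine Weyl group:
for `i ≠ 0` it exchanges `a_i` and `a_{i+1}`, and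
`s_0 f = Ω(b_1|y) Ω(b_n|y)⁻¹ s_θ(f)`, where `s_θ` exchanges `a_1` and `a_n = a_0`. -/
def sAct {n : ℕ} (i : ZMod n) (f : Lam n) : Lam n :=
  if i = 0 then Om 1 * (Om 0)⁻¹ * permL (Equiv.swap 0 1) f
  else permL (Equiv.swap i (i + 1)) f

/-- `T_i = (1 - e^{α_i})⁻¹ (s_i - 1)`, where `α_i = a_i - a_{i+1}`
(so that `α_0 = a_n - a_1 = -θ`). -/
def opT {n : ℕ} (i : ZMod n) (f : Lam n) : Lam n :=
  (1 - expK (wt n i - wt n (i + 1)))⁻¹ • (sAct i f - f)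

/-- `D_i = T_i + 1`. -/
def opD {n : ℕ} (i : ZMod n) (f : Lam n) : Lam n := opT i f + f

/-- The standard reduced word of the affine Grassmannian element `x_λ` attached to a
`k`-bounded partition `λ = (λ_1, λ_2, …)`, `k = n - 1`: the `n`-residues `column - row` of the
boxes of `λ`, the rows being read from bottom to top and every row from right to left. -/
def residueWord (n : ℕ) (l : List ℕ) : List (ZMod n) :=
  (l.zipIdx.flatMap fun p => (List.range p.1).map fun c => (c : ZMod n) - (p.2 : ZMod n)).reverse

/-- The `K`-theoretic double `k`-Schur function `g_λ^{(k)}(y|b) = T_{x_λ}(1)`. -/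
def gOpen (n : ℕ) (l : List ℕ) : Lam n := (residueWord n l).foldr opT 1

/-- The closed `K`-theoretic double `k`-Schur function `g̃_λ^{(k)}(y|b) = D_{x_λ}(1)`. -/
def gClosed (n : ℕ) (l : List ℕ) : Lam n := (residueWord n l).foldr opD 1

/-! ### Divided differences of `Ω`, used to show that the map `β` below is well defined -/

theorem permK_bK {n : ℕ} (s : Equiv.Perm (ZMod n)) (i : ZMod n) :
    permK s (bK i) = bK (s i) := by
  simp [bK, permK_expK, permW_wt]

theorem permL_smul {n : ℕ} (s : Equiv.Perm (ZMod n)) (c : KT n) (f : Lam n) :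
    permL s (c • f) = permK s c • permL s f := by
  ext d
  simp [permL]

theorem permL_Om {n : ℕ} (s : Equiv.Perm (ZMod n)) (i : ZMod n) :
    permL s (Om i) = Om (s i) := by
  ext d
  change permK s (bK i ^ d.degree) = bK (s i) ^ d.degree
  rw [map_pow, permK_bK]

theorem constantCoeff_Om {n : ℕ} (i : ZMod n) :
    MvPowerSeries.constantCoeff (Om i) = 1 := by
  change bK i ^ (0 : ℕ →₀ ℕ).degree = 1
  simp

theorem Om_mul_inv {n : ℕ} (i : ZMod n) : (Om i : Lam n) * (Om i)⁻¹ = 1 :=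
  MvPowerSeries.mul_inv_cancel _ (by rw [constantCoeff_Om]; exact one_ne_zero)

theorem permL_Om_inv {n : ℕ} (s : Equiv.Perm (ZMod n)) (i : ZMod n) :
    permL s (Om i)⁻¹ = (Om (s i))⁻¹ := by
  have h := congrArg (permL s) (Om_mul_inv i)
  rw [map_mul, map_one, permL_Om] at h
  calc permL s (Om i)⁻¹ = (Om (s i) * (Om (s i))⁻¹) * permL s (Om i)⁻¹ := by
        rw [Om_mul_inv, one_mul]
    _ = (Om (s i))⁻¹ * (Om (s i) * permL s (Om i)⁻¹) := by ring
    _ = _ := by rw [h, mul_one]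

theorem bK_injective {n : ℕ} : Function.Injective (bK : ZMod n → KT n) := by
  intro i j h
  exact expK_neg_wt_injective (by simpa [bK] using h)

/-- The divided difference of `b ↦ Ω(b | y)` at the points `b_k`, `k ∈ S`. -/
def divDiff {n : ℕ} (S : Finset (ZMod n)) : Lam n :=
  ∑ k ∈ S, (∏ m ∈ S.erase k, (bK k - bK m))⁻¹ • Om k

theorem permL_divDiff {n : ℕ} (s : Equiv.Perm (ZMod n)) (S : Finset (ZMod n)) :
    permL s (divDiff S) = divDiff (S.map s.toEmbedding) := by
  simp only [divDiff, map_sum, Finset.sum_map, permL_smul, permL_Om, map_inv₀, map_prod,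
    map_sub, permK_bK, Equiv.coe_toEmbedding]
  refine Finset.sum_congr rfl fun k _ => ?_
  congr 2
  have : (S.map s.toEmbedding).erase (s k) = (S.erase k).map s.toEmbedding := by
    rw [Finset.map_erase]; rfl
  rw [this, Finset.prod_map]
  rfl

theorem divDiff_sub {n : ℕ} (A : Finset (ZMod n)) {u v : ZMod n} (huv : u ≠ v)
    (hu : u ∉ A) (hv : v ∉ A) :
    divDiff (insert u A) - divDiff (insert v A) =
      (bK u - bK v) • divDiff (insert u (insert v A)) := by
  have hu' : u ∉ insert v A := by simp [huv, hu]
  have hne : bK u - bK v ≠ 0 := sub_ne_zero.2 fun h => huv (bK_injective h)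
  have hne' : bK v - bK u ≠ 0 := sub_ne_zero.2 fun h => huv (bK_injective h).symm
  have e1 : (insert u (insert v A)).erase u = insert v A := Finset.erase_insert hu'
  have e2 : (insert u (insert v A)).erase v = insert u A := by
    rw [Finset.insert_comm, Finset.erase_insert (by simp [huv.symm, hv])]
  simp only [divDiff]
  rw [Finset.sum_insert hu, Finset.sum_insert hv, Finset.sum_insert hu', Finset.sum_insert hv,
    e1, e2, Finset.erase_insert hu, Finset.erase_insert hv, Finset.prod_insert hv,
    Finset.prod_insert hu, smul_add, smul_add, smul_smul, smul_smul, Finset.smul_sum]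
  have h1 : (bK u - bK v) * ((bK u - bK v) * ∏ x ∈ A, (bK u - bK x))⁻¹
      = (∏ x ∈ A, (bK u - bK x))⁻¹ := by
    rw [mul_inv, ← mul_assoc, mul_inv_cancel₀ hne, one_mul]
  have h2 : (bK u - bK v) * ((bK v - bK u) * ∏ x ∈ A, (bK v - bK x))⁻¹
      = - (∏ x ∈ A, (bK v - bK x))⁻¹ := by
    rw [mul_inv, ← mul_assoc, ← neg_sub (bK v) (bK u), neg_mul, mul_inv_cancel₀ hne']
    ring
  rw [h1, h2, neg_smul]
  have h3 : ∑ x ∈ A, (∏ m ∈ (insert u A).erase x, (bK x - bK m))⁻¹ • Om x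
      - ∑ x ∈ A, (∏ m ∈ (insert v A).erase x, (bK x - bK m))⁻¹ • Om x
      = ∑ x ∈ A, (bK u - bK v) • ((∏ m ∈ (insert u (insert v A)).erase x, (bK x - bK m))⁻¹ •
          (Om x : Lam n)) := by
    rw [← Finset.sum_sub_distrib]
    refine Finset.sum_congr rfl fun k hk => ?_
    have hku : u ≠ k := fun h => hu (h ▸ hk)
    have hkv : v ≠ k := fun h => hv (h ▸ hk)
    have a1 : bK k - bK u ≠ 0 := sub_ne_zero.2 fun h => hku (bK_injective h).symm
    have a2 : bK k - bK v ≠ 0 := sub_ne_zero.2 fun h => hkv (bK_injective h).symm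
    have hue : u ∉ A.erase k := fun h => hu (Finset.mem_of_mem_erase h)
    have hve : v ∉ A.erase k := fun h => hv (Finset.mem_of_mem_erase h)
    rw [Finset.erase_insert_of_ne hku, Finset.erase_insert_of_ne hkv,
      Finset.erase_insert_of_ne hku, Finset.erase_insert_of_ne hkv,
      Finset.prod_insert hue, Finset.prod_insert hve,
      Finset.prod_insert (show u ∉ insert v (A.erase k) by
        rw [Finset.mem_insert]; exact fun h => h.elim huv hue),
      Finset.prod_insert hve, smul_smul, ← sub_smul]
    congr 1
    simp only [mul_inv]
    field_simp
    ring
  rw [← h3]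
  abel

/-- The points `i, i + 1, …, i + l` of `ℤ/n`. -/
def seg {n : ℕ} (i : ZMod n) (l : ℕ) : Finset (ZMod n) :=
  (Finset.range (l + 1)).image fun t : ℕ => i + (t : ZMod n)

theorem natCast_ne {n s t : ℕ} (h : s < t) (ht : t < n) : (s : ZMod n) ≠ t := by
  intro e
  rw [ZMod.natCast_eq_natCast_iff'] at e
  rw [Nat.mod_eq_of_lt (h.trans ht), Nat.mod_eq_of_lt ht] at e
  omega

theorem gOpen_succ (n l : ℕ) : gOpen n [l + 1] = opT (l : ZMod n) (gOpen n [l]) := by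
  simp [gOpen, residueWord, List.range_succ]

theorem gOpen_zero (n : ℕ) : gOpen n [0] = 1 := by
  simp [gOpen, residueWord]


theorem seg_succ {n : ℕ} (i : ZMod n) (l : ℕ) :
    seg i (l + 1) = insert (i + ((l + 1 : ℕ) : ZMod n)) (seg i l) := by
  rw [seg, Finset.range_add_one, Finset.image_insert, seg]

theorem seg_zero {n : ℕ} (i : ZMod n) : seg i 0 = insert i ∅ := by
  simp [seg]

theorem divDiff_singleton {n : ℕ} (i : ZMod n) : divDiff (insert i ∅) = Om i := by
  simp [divDiff]

theorem bK_succ_sub {n : ℕ} {i j : ZMod n} (h : i ≠ j) :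
    (1 - expK (wt n i - wt n j))⁻¹ * (bK j - bK i) = expK (-wt n i) := by
  have e : bK j - bK i = expK (-wt n i) * (1 - expK (wt n i - wt n j)) := by
    rw [mul_sub, mul_one, ← expK_add, bK, bK]
    have : -wt n i + (wt n i - wt n j) = -wt n j := by abel
    rw [this]; ring
  have hne : bK j - bK i ≠ 0 := sub_ne_zero.2 fun h' => h (bK_injective h').symm
  have hne' : (1 - expK (wt n i - wt n j)) ≠ 0 := by
    intro h'
    rw [h', mul_zero] at e
    exact hne e
  rw [e]
  field_simp

theorem gOpen_row (n l : ℕ) (hl : l < n) :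
    gOpen n [l] = expK (-∑ t ∈ Finset.range l, wt n (t : ZMod n)) •
      ((Om 0)⁻¹ * divDiff (seg 0 l)) := by
  induction l with
  | zero =>
    rw [gOpen_zero, seg_zero, divDiff_singleton, mul_comm, Om_mul_inv]
    simp [expK_zero]
  | succ l ih =>
    have hcast : ((l + 1 : ℕ) : ZMod n) = (l : ZMod n) + 1 := by push_cast; ring
    have hne : (l : ZMod n) ≠ (l : ZMod n) + 1 := by
      rw [← hcast]; exact natCast_ne (Nat.lt_succ_self l) hl
    rw [gOpen_succ, opT]
    have key : sAct (l : ZMod n) (gOpen n [l]) - gOpen n [l] =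
        expK (-∑ t ∈ Finset.range l, wt n (t : ZMod n)) • ((Om 0)⁻¹ *
          ((bK ((l : ZMod n) + 1) - bK (l : ZMod n)) • divDiff (seg 0 (l + 1)))) := by
      rcases Nat.eq_zero_or_pos l with rfl | hpos
      · rw [gOpen_zero, seg_succ, seg_zero, sAct, if_pos (by simp)]
        simp only [zero_add, Nat.cast_one, Nat.cast_zero, Finset.range_zero, Finset.sum_empty,
          neg_zero, expK_zero, one_smul, map_one, mul_one]
        have h01 : (1 : ZMod n) ≠ 0 := by
          have := natCast_ne (n := n) Nat.zero_lt_one hl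
          simpa using this.symm
        rw [← divDiff_sub ∅ h01 (by simp) (by simp), divDiff_singleton, divDiff_singleton,
          mul_sub, mul_comm (Om 0)⁻¹ (Om 0), Om_mul_inv, mul_comm]
      · obtain ⟨m, rfl⟩ : ∃ m, l = m + 1 := ⟨l - 1, by omega⟩
        have h0 : ((m + 1 : ℕ) : ZMod n) ≠ 0 := by
          have := natCast_ne (n := n) (Nat.succ_pos m) (by omega)
          simpa using this.symm
        have hfix : ∀ t : ℕ, t < m + 1 →
            Equiv.swap ((m + 1 : ℕ) : ZMod n) (((m + 1 : ℕ) : ZMod n) + 1) (t : ZMod n) = t := by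
          intro t ht
          refine Equiv.swap_apply_of_ne_of_ne (natCast_ne ht (by omega)) ?_
          rw [← hcast]
          exact natCast_ne (by omega) hl
        have hfix0 : Equiv.swap ((m + 1 : ℕ) : ZMod n) (((m + 1 : ℕ) : ZMod n) + 1) 0 = 0 := by
          simpa using hfix 0 (by omega)
        have hc : permK (Equiv.swap ((m + 1 : ℕ) : ZMod n) (((m + 1 : ℕ) : ZMod n) + 1))
            (expK (-∑ t ∈ Finset.range (m + 1), wt n (t : ZMod n))) =
            expK (-∑ t ∈ Finset.range (m + 1), wt n (t : ZMod n)) := by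
          rw [permK_expK, map_neg, map_sum]
          congr 2
          refine Finset.sum_congr rfl fun t ht => ?_
          rw [permW_wt, hfix t (Finset.mem_range.1 ht)]
        have hnot : ∀ t : ℕ, m < t → t < n → (t : ZMod n) ∉ seg (0 : ZMod n) m := by
          intro t ht htn hmem
          simp only [seg, Finset.mem_image, Finset.mem_range, zero_add] at hmem
          obtain ⟨r, hr, hrt⟩ := hmem
          exact natCast_ne (by omega) htn hrt
        have hseg : (seg (0 : ZMod n) m).map
            (Equiv.swap ((m + 1 : ℕ) : ZMod n) (((m + 1 : ℕ) : ZMod n) + 1)).toEmbedding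
            = seg 0 m := by
          ext x
          simp only [Finset.mem_map_equiv, Equiv.symm_swap]
          constructor
          · intro hx
            simp only [seg, Finset.mem_image, Finset.mem_range, zero_add] at hx ⊢
            obtain ⟨r, hr, hrt⟩ := hx
            refine ⟨r, hr, ?_⟩
            have := congrArg (Equiv.swap ((m + 1 : ℕ) : ZMod n) (((m + 1 : ℕ) : ZMod n) + 1)) hrt
            rwa [hfix r hr, Equiv.swap_apply_self] at this
          · intro hx
            simp only [seg, Finset.mem_image, Finset.mem_range, zero_add] at hx ⊢
            obtain ⟨r, hr, rfl⟩ := hx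
            exact ⟨r, hr, (hfix r hr).symm⟩
        rw [ih (by omega), sAct, if_neg h0, permL_smul, hc, map_mul, permL_Om_inv, hfix0,
          permL_divDiff, seg_succ 0 m, Finset.map_insert, hseg, seg_succ 0 (m + 1), seg_succ 0 m,
          ← smul_sub, ← mul_sub]
        simp only [zero_add, Equiv.coe_toEmbedding, Equiv.swap_apply_left]
        rw [hcast]
        have := divDiff_sub (seg (0 : ZMod n) m) hne.symm
          (by rw [← hcast]; exact hnot _ (by omega) hl) (hnot _ (by omega) (by omega))
        rw [this]
    rw [key, smul_comm, mul_smul_comm, smul_smul (1 - _)⁻¹, bK_succ_sub hne, smul_smul, ← expK_add,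
      Finset.sum_range_succ]
    congr 2
    abel

/-! ### The centralizer family -/

/-- The index `i + 1 ∈ ℤ/n` of the `i`-th row, rows being numbered from `0`. -/
def ix {n : ℕ} (i : Fin n) : ZMod n := ((i.val + 1 : ℕ) : ZMod n)

/-- The matrix `A`: diagonal `e^{-a_1}, …, e^{-a_n}`, superdiagonal `-1`. -/
def matA (n : ℕ) : Matrix (Fin n) (Fin n) (RT n) :=
  Matrix.of fun i j =>
    if i = j then expW (-wt n (ix i)) else if i.val + 1 = j.val then -1 else 0

/-- `e_k(e^{-a_1}, …, e^{-a_m})`. -/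
def elemSym (n m k : ℕ) : RT n :=
  ((Multiset.range m).map fun t => expW (-wt n ((t + 1 : ℕ) : ZMod n))).esymm k

/-- The lower unitriangular matrix `P`, with entries `e_{i-j}(e^{-a_1}, …, e^{-a_{i-1}})`,
`1 ≤ j ≤ i ≤ n`. -/
def matP (n : ℕ) : Matrix (Fin n) (Fin n) (RT n) :=
  Matrix.of fun i j => if j ≤ i then elemSym n i.val (i.val - j.val) else 0

/-- The `i`-th leading principal minor of an `n × n` matrix. -/
def leadingMinor {n : ℕ} {R : Type*} [CommRing R] (M : Matrix (Fin n) (Fin n) R) (i : ℕ) : R :=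
  (M.submatrix (Subtype.val : {r : Fin n // r.val < i} → Fin n) Subtype.val).det

/-- Polynomial ring in the entries `z_{ij}` (`Sum.inl (i, j)`) of an `n × n` matrix and in
additional variables `Sum.inr i`, which become the inverses of the `z_{ii}`. -/
abbrev PolyZ (n : ℕ) : Type := MvPolynomial (Fin n × Fin n ⊕ Fin n) (RT n)

/-- The generic matrix. -/
def genZ (n : ℕ) : Matrix (Fin n) (Fin n) (PolyZ n) :=
  Matrix.of fun i j => MvPolynomial.X (Sum.inl (i, j))

/-- The matrix `A` over the polynomial ring. -/
def polyA (n : ℕ) : Matrix (Fin n) (Fin n) (PolyZ n) :=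
  (matA n).map (algebraMap (RT n) (PolyZ n))

/-- The equations of the centralizer family: `Z` is upper triangular, `[A, Z] = 0`,
and the diagonal entries are invertible. -/
def relZ (n : ℕ) : Set (PolyZ n) :=
  {f | (∃ i j : Fin n, j < i ∧ f = genZ n i j) ∨
    (∃ i j : Fin n, f = (polyA n * genZ n - genZ n * polyA n) i j) ∨
    (∃ i : Fin n, f = genZ n i i * MvPolynomial.X (Sum.inr i) - 1)}

/-- The coordinate ring `𝒪(𝒵̃)` of the centralizer family. -/
def OZ (n : ℕ) : Type := PolyZ n ⧸ Ideal.span (relZ n)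

instance (n : ℕ) : CommRing (OZ n) :=
  inferInstanceAs (CommRing (PolyZ n ⧸ Ideal.span (relZ n)))

instance (n : ℕ) : Algebra (RT n) (OZ n) :=
  inferInstanceAs (Algebra (RT n) (PolyZ n ⧸ Ideal.span (relZ n)))

/-- The quotient map onto `𝒪(𝒵̃)`. -/
def mkZ (n : ℕ) : PolyZ n →ₐ[RT n] OZ n := Ideal.Quotient.mkₐ (RT n) (Ideal.span (relZ n))

/-- The matrix `Z = (z_{ij})` of coordinate functions. -/
def matZ (n : ℕ) : Matrix (Fin n) (Fin n) (OZ n) :=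
  (genZ n).map (mkZ n)

/-- `z_{ii}⁻¹`. -/
def zInv {n : ℕ} (i : Fin n) : OZ n := mkZ n (MvPolynomial.X (Sum.inr i))

/-- An algebra homomorphism out of `𝒪(𝒵̃)`, given by an upper triangular matrix with invertible
diagonal that commutes with `A`. -/
def liftOZ {n : ℕ} {S : Type*} [CommRing S] [Algebra (RT n) S]
    (M : Matrix (Fin n) (Fin n) S) (w : Fin n → S)
    (h1 : ∀ i j : Fin n, j < i → M i j = 0)
    (h2 : (matA n).map (algebraMap (RT n) S) * M = M * (matA n).map (algebraMap (RT n) S))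
    (h3 : ∀ i, M i i * w i = 1) : OZ n →ₐ[RT n] S :=
  Ideal.Quotient.liftₐ (Ideal.span (relZ n))
    (MvPolynomial.aeval (Sum.elim (fun p : Fin n × Fin n => M p.1 p.2) w)) (by
      intro f hf
      refine Submodule.span_induction (p := fun f _ => MvPolynomial.aeval
        (Sum.elim (fun p : Fin n × Fin n => M p.1 p.2) w) f = 0) ?_ (map_zero _)
        (fun x y _ _ hx hy => by rw [map_add, hx, hy, add_zero])
        (fun a x _ hx => by rw [smul_eq_mul, map_mul, hx, mul_zero]) hf
      rintro g (⟨i, j, hij, rfl⟩ | ⟨i, j, rfl⟩ | ⟨i, rfl⟩)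
      · simp [genZ, h1 i j hij]
      · have := congrFun (congrFun h2 i) j
        simp only [Matrix.mul_apply, Matrix.map_apply] at this
        rw [Matrix.sub_apply, map_sub, Matrix.mul_apply, Matrix.mul_apply, map_sum, map_sum]
        simp only [map_mul, polyA, genZ, Matrix.map_apply, Matrix.of_apply, AlgHom.commutes,
          MvPolynomial.aeval_X, Sum.elim_inl]
        rw [this, sub_self]
      · simp [genZ, h3 i])

theorem liftOZ_mkZ {n : ℕ} {S : Type*} [CommRing S] [Algebra (RT n) S]
    (M : Matrix (Fin n) (Fin n) S) (w : Fin n → S) (h1) (h2) (h3) (f : PolyZ n) :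
    liftOZ M w h1 h2 h3 (mkZ n f) =
      MvPolynomial.aeval (Sum.elim (fun p : Fin n × Fin n => M p.1 p.2) w) f := rfl

theorem liftOZ_matZ {n : ℕ} {S : Type*} [CommRing S] [Algebra (RT n) S]
    (M : Matrix (Fin n) (Fin n) S) (w : Fin n → S) (h1) (h2) (h3) :
    (matZ n).map (liftOZ M w h1 h2 h3) = M := by
  ext i j
  rw [Matrix.map_apply, matZ, Matrix.map_apply, liftOZ_mkZ]
  simp [genZ]

theorem mk_relZ {n : ℕ} {f : PolyZ n} (h : f ∈ relZ n) : mkZ n f = 0 :=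
  Ideal.Quotient.eq_zero_iff_mem.2 (Ideal.subset_span h)

theorem matZ_lower {n : ℕ} {i j : Fin n} (h : j < i) : matZ n i j = 0 :=
  mk_relZ (Or.inl ⟨i, j, h, rfl⟩)

theorem matZ_diag {n : ℕ} (i : Fin n) : matZ n i i * zInv i = 1 := by
  have := mk_relZ (n := n) (Or.inr (Or.inr ⟨i, rfl⟩))
  rw [map_sub, map_mul, map_one, sub_eq_zero] at this
  exact this

/-- The matrix `A` over `𝒪(𝒵̃)`. -/
def matAZ (n : ℕ) : Matrix (Fin n) (Fin n) (OZ n) := (matA n).map (algebraMap (RT n) (OZ n))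

/-- The matrix `P` over `𝒪(𝒵̃)`. -/
def matPZ (n : ℕ) : Matrix (Fin n) (Fin n) (OZ n) := (matP n).map (algebraMap (RT n) (OZ n))

theorem matZ_comm (n : ℕ) : matAZ n * matZ n = matZ n * matAZ n := by
  ext i j
  have := mk_relZ (n := n) (Or.inr (Or.inl ⟨i, j, rfl⟩))
  rw [Matrix.sub_apply, map_sub, sub_eq_zero, Matrix.mul_apply, Matrix.mul_apply, map_sum,
    map_sum] at this
  simp only [map_mul, polyA, Matrix.map_apply, AlgHom.commutes] at this
  rw [Matrix.mul_apply, Matrix.mul_apply]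
  exact this

/-- The function `τ_i = det (Z A P)^{[1,i]}_{[1,i]}`. -/
def tau (n i : ℕ) : OZ n := leadingMinor (matZ n * matAZ n * matPZ n) i

/-- The function `σ_i = det (Z P)^{[1,i]}_{[1,i]}`. -/
def sig (n i : ℕ) : OZ n := leadingMinor (matZ n * matPZ n) i

/-! ### The automorphism `σ` -/

theorem matA_upper (n : ℕ) : (matA n).BlockTriangular id := by
  intro i j h
  have h' : j.val < i.val := h
  have : i ≠ j := by rintro rfl; exact lt_irrefl _ h'
  simp only [matA, Matrix.of_apply, if_neg this]
  rw [if_neg (by omega)]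

theorem matAZ_upper (n : ℕ) : (matAZ n).BlockTriangular id := by
  intro i j h
  simp [matAZ, matA_upper n h]

theorem expW_mul_neg {n : ℕ} (μ : Weight n) : expW μ * expW (-μ) = 1 := by
  rw [← expW_add, add_neg_cancel, expW_zero]

theorem isUnit_det_matA (n : ℕ) : IsUnit (matA n).det := by
  rw [Matrix.det_of_isUpperTriangular (matA_upper n)]
  refine IsUnit.prod_univ_iff.2 fun i => ?_
  simp only [matA, Matrix.of_apply, if_true]
  exact IsUnit.of_mul_eq_one _ (by rw [mul_comm]; exact expW_mul_neg _)

theorem isUnit_det_matAZ (n : ℕ) : IsUnit (matAZ n).det := by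
  have := (isUnit_det_matA n).map (algebraMap (RT n) (OZ n))
  rwa [RingHom.map_det] at this

theorem matZA_upper (n : ℕ) : (matZ n * (matAZ n)⁻¹).BlockTriangular id := by
  have hZ : (matZ n).BlockTriangular id := fun i j h => matZ_lower h
  have := Matrix.invertibleOfIsUnitDet _ (isUnit_det_matAZ n)
  exact hZ.mul (Matrix.blockTriangular_inv_of_blockTriangular (matAZ_upper n))

/-- The `R(T)`-algebra endomorphism `σ` of `𝒪(𝒵̃)` given by `σ(Z) = Z A⁻¹`. -/
def sigmaHom (n : ℕ) : OZ n →ₐ[RT n] OZ n :=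
  liftOZ (matZ n * (matAZ n)⁻¹)
    (fun i => zInv i * algebraMap (RT n) (OZ n) (expW (-wt n (ix i))))
    (fun i j h => matZA_upper n h)
    (by
      change matAZ n * _ = _ * matAZ n
      rw [← Matrix.mul_assoc, matZ_comm, Matrix.mul_assoc, Matrix.mul_assoc,
        Matrix.mul_nonsing_inv _ (isUnit_det_matAZ n),
        Matrix.nonsing_inv_mul _ (isUnit_det_matAZ n)])
    (by
      intro i
      have h : (matZ n * (matAZ n)⁻¹ * matAZ n) i i = matZ n i i := by
        rw [Matrix.mul_assoc, Matrix.nonsing_inv_mul _ (isUnit_det_matAZ n), Matrix.mul_one]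
      rw [Matrix.mul_apply, Finset.sum_eq_single i] at h
      · have hA : matAZ n i i = algebraMap (RT n) (OZ n) (expW (-wt n (ix i))) := by
          simp [matAZ, matA]
        rw [hA] at h
        calc _ = ((matZ n * (matAZ n)⁻¹) i i * algebraMap (RT n) (OZ n) (expW (-wt n (ix i))))
              * zInv i := by ring
          _ = 1 := by rw [h, matZ_diag]
      · intro j _ hj
        rcases lt_or_gt_of_ne hj with hlt | hlt
        · rw [matZA_upper n hlt, zero_mul]
        · rw [matAZ_upper n hlt, mul_zero]
      · simp)

theorem sigmaHom_matZ (n : ℕ) : (matZ n).map (sigmaHom n) = matZ n * (matAZ n)⁻¹ :=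
  liftOZ_matZ _ _ _ _ _

/-! ### The map `β` to symmetric functions -/

/-- The image of `z_{ij}` (here `i`, `j` are numbered from `0`):
`e^{a_i + ⋯ + a_{j-1}} Ω(b_i|y) g_{ρ_{j-i}}(y | ω^i b)` for `i ≤ j`, where `ρ_l = s_{l-1} ⋯ s_1 s_0`
corresponds to the one-row partition `(l)`. -/
def betaZ (n : ℕ) : Matrix (Fin n) (Fin n) (Lam n) :=
  Matrix.of fun i j =>
    if i ≤ j then
      expK (∑ t ∈ Finset.Ico i.val j.val, wt n ((t + 1 : ℕ) : ZMod n)) •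
        (Om (ix i) * shift (i.val + 1) (gOpen n [j.val - i.val]))
    else 0

theorem permL_seg {n : ℕ} (m : ℕ) (l : ℕ) :
    (seg (0 : ZMod n) l).map (Equiv.addRight (m : ZMod n)).toEmbedding = seg (m : ZMod n) l := by
  rw [seg, seg, Finset.map_eq_image, Finset.image_image]
  refine Finset.image_congr fun t _ => ?_
  simp [add_comm]

theorem betaZ_eq {n : ℕ} {i j : Fin n} (h : i ≤ j) :
    betaZ n i j = divDiff (seg (ix i) (j.val - i.val)) := by
  have hval : i.val ≤ j.val := h
  rw [betaZ, Matrix.of_apply, if_pos h, gOpen_row _ _ (by omega), shift, permL_smul, map_mul,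
    permL_Om_inv, permL_divDiff, permL_seg, permK_expK, mul_smul_comm, smul_smul, ← expK_add]
  have h0 : (Equiv.addRight ((i.val + 1 : ℕ) : ZMod n)) 0 = ix i := by
    simp [ix]
  rw [h0, ← mul_assoc, Om_mul_inv, one_mul]
  have : ∑ t ∈ Finset.Ico i.val j.val, wt n ((t + 1 : ℕ) : ZMod n) +
      permW (Equiv.addRight ((i.val + 1 : ℕ) : ZMod n))
        (-∑ t ∈ Finset.range (j.val - i.val), wt n (t : ZMod n)) = 0 := by
    rw [map_neg, map_sum, Finset.sum_Ico_eq_sum_range, ← sub_eq_add_neg, sub_eq_zero]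
    refine Finset.sum_congr rfl fun t _ => ?_
    rw [permW_wt]
    congr 1
    simp only [Equiv.coe_addRight]
    push_cast
    ring
  rw [this, expK_zero, one_smul]
  rfl


/-- Interior points `i + 1, …, i + l` of the segment `i, …, i + l + 1`. -/
def segInt {n : ℕ} (i : ZMod n) (l : ℕ) : Finset (ZMod n) :=
  (Finset.Ico 1 (l + 1)).image fun t : ℕ => i + (t : ZMod n)

theorem seg_left {n : ℕ} (i : ZMod n) (l : ℕ) : seg i l = insert i (segInt i l) := by
  have : Finset.range (l + 1) = insert 0 (Finset.Ico 1 (l + 1)) := by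
    ext x; simp only [Finset.mem_range, Finset.mem_insert, Finset.mem_Ico]; omega
  rw [seg, this, Finset.image_insert, segInt]
  simp

theorem seg_right {n : ℕ} (i : ZMod n) (l : ℕ) :
    seg (i + 1) l = insert (i + ((l + 1 : ℕ) : ZMod n)) (segInt i l) := by
  have : insert (l + 1) (Finset.Ico 1 (l + 1)) = (Finset.range (l + 1)).image (· + 1) := by
    ext x
    simp only [Finset.mem_range, Finset.mem_insert, Finset.mem_Ico, Finset.mem_image]
    constructor
    · intro h
      exact ⟨x - 1, by omega, by omega⟩
    · rintro ⟨a, ha, rfl⟩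
      omega
  rw [segInt, ← Finset.image_insert (fun t : ℕ => i + (t : ZMod n)), this, Finset.image_image, seg]
  refine Finset.image_congr fun t _ => ?_
  simp only [Function.comp]
  push_cast
  ring

theorem betaZ_rel {n : ℕ} {i j : Fin n} (h : i < j) :
    (bK (ix i) - bK (ix j)) • betaZ n i j =
      betaZ n i ⟨j.val - 1, by omega⟩ - betaZ n ⟨i.val + 1, by omega⟩ j := by
  have hv : i.val < j.val := h
  obtain ⟨l, hl⟩ : ∃ l, j.val = i.val + l + 1 := ⟨j.val - i.val - 1, by omega⟩
  have hix : ix j = ix i + ((l + 1 : ℕ) : ZMod n) := by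
    rw [ix, ix, hl]; push_cast; ring
  have hix' : ix (⟨i.val + 1, by omega⟩ : Fin n) = ix i + 1 := by
    simp only [ix]; push_cast; ring
  have hne : ix i ≠ ix j := by
    rw [hix]
    intro e
    exact natCast_ne (n := n) (Nat.succ_pos l) (by omega) (by symm; simpa using e)
  rw [betaZ_eq h.le, betaZ_eq (show i ≤ (⟨j.val - 1, by omega⟩ : Fin n) from
      Fin.mk_le_mk.2 (by omega)), betaZ_eq (show (⟨i.val + 1, by omega⟩ : Fin n) ≤ j from
      Fin.mk_le_mk.2 (by omega)), hix']
  have e1 : j.val - i.val = l + 1 := by omega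
  have e2 : j.val - 1 - i.val = l := by omega
  have e3 : j.val - (i.val + 1) = l := by omega
  simp only [e1, e2, e3]
  rw [seg_succ, seg_left, seg_right, Finset.insert_comm, ← hix]
  refine (divDiff_sub (segInt (ix i) l) hne ?_ ?_).symm
  · intro hm
    simp only [segInt, Finset.mem_image, Finset.mem_Ico] at hm
    obtain ⟨t, ht, hte⟩ := hm
    exact natCast_ne (n := n) (show 0 < t by omega) (by omega) (by symm; simpa using hte)
  · intro hm
    rw [hix] at hm
    simp only [segInt, Finset.mem_image, Finset.mem_Ico] at hm
    obtain ⟨t, ht, hte⟩ := hm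
    exact natCast_ne (n := n) (show t < l + 1 by omega) (by omega) (add_left_cancel hte)

theorem sum_matA_left {n : ℕ} {S : Type*} [CommRing S] [Algebra (RT n) S] (f : Fin n → S)
    (i : Fin n) :
    ∑ k, algebraMap (RT n) S (matA n i k) * f k =
      algebraMap (RT n) S (expW (-wt n (ix i))) * f i -
        (if h : i.val + 1 < n then f ⟨i.val + 1, h⟩ else 0) := by
  have hs : ∀ k, algebraMap (RT n) S (matA n i k) * f k =
      (if k = i then algebraMap (RT n) S (expW (-wt n (ix i))) * f i else 0) -
        (if i.val + 1 = k.val then f k else 0) := by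
    intro k
    by_cases hk : k = i
    · subst hk
      simp [matA]
    · have hk' : i ≠ k := fun e => hk e.symm
      by_cases h : i.val + 1 = k.val <;> simp [matA, hk, hk', h]
  rw [Finset.sum_congr rfl fun k _ => hs k, Finset.sum_sub_distrib, Finset.sum_ite_eq' _ i]
  simp only [Finset.mem_univ, if_true]
  congr 1
  split_ifs with h
  · rw [Finset.sum_eq_single ⟨i.val + 1, h⟩]
    · simp
    · intro b _ hb
      rw [if_neg]
      intro e
      exact hb (Fin.ext e.symm)
    · simp
  · refine Finset.sum_eq_zero fun b _ => if_neg ?_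
    have := b.2
    omega

theorem sum_matA_right {n : ℕ} {S : Type*} [CommRing S] [Algebra (RT n) S] (f : Fin n → S)
    (j : Fin n) :
    ∑ k, f k * algebraMap (RT n) S (matA n k j) =
      f j * algebraMap (RT n) S (expW (-wt n (ix j))) -
        (if 0 < j.val then f ⟨j.val - 1, by omega⟩ else 0) := by
  have hs : ∀ k, f k * algebraMap (RT n) S (matA n k j) =
      (if k = j then f j * algebraMap (RT n) S (expW (-wt n (ix j))) else 0) -
        (if k.val + 1 = j.val then f k else 0) := by
    intro k
    by_cases hk : k = j
    · subst hk
      simp [matA]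
    · by_cases h : k.val + 1 = j.val <;> simp [matA, hk, h]
  rw [Finset.sum_congr rfl fun k _ => hs k, Finset.sum_sub_distrib, Finset.sum_ite_eq' _ j]
  simp only [Finset.mem_univ, if_true]
  congr 1
  split_ifs with h
  · rw [Finset.sum_eq_single ⟨j.val - 1, by omega⟩]
    · rw [if_pos]
      simp only
      omega
    · intro b _ hb
      rw [if_neg]
      intro e
      exact hb (Fin.ext (by simp only; omega))
    · simp
  · exact Finset.sum_eq_zero fun b _ => if_neg (by omega)

theorem betaZ_lower {n : ℕ} {i j : Fin n} (h : j < i) : betaZ n i j = 0 := by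
  rw [betaZ, Matrix.of_apply, if_neg (not_le.2 h)]

theorem algebraMap_Lam {n : ℕ} (c : RT n) (f : Lam n) :
    algebraMap (RT n) (Lam n) c * f = algebraMap (RT n) (KT n) c • f := by
  rw [← Algebra.smul_def, algebraMap_smul]

theorem betaZ_comm (n : ℕ) :
    (matA n).map (algebraMap (RT n) (Lam n)) * betaZ n =
      betaZ n * (matA n).map (algebraMap (RT n) (Lam n)) := by
  ext1 i j
  simp only [Matrix.mul_apply, Matrix.map_apply]
  rw [sum_matA_left (fun k => betaZ n k j), sum_matA_right (fun k => betaZ n i k)]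
  rcases lt_trichotomy i j with h | h | h
  · have hv : i.val < j.val := h
    have hr := betaZ_rel h
    rw [dif_pos (by omega), if_pos (by omega), mul_comm (betaZ n i j), algebraMap_Lam,
      algebraMap_Lam]
    have hb : bK (ix i) - bK (ix j) = expK (-wt n (ix j)) - expK (-wt n (ix i)) := by
      simp [bK]
    rw [hb, sub_smul] at hr
    change expK (-wt n (ix i)) • betaZ n i j - _ = expK (-wt n (ix j)) • betaZ n i j - _
    linear_combination -hr
  · subst h
    have e1 : (if h : i.val + 1 < n then betaZ n ⟨i.val + 1, h⟩ i else 0) = 0 := by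
      split_ifs with h
      · exact betaZ_lower (Fin.mk_lt_mk.2 (Nat.lt_succ_self _))
      · rfl
    have e2 : (if 0 < i.val then betaZ n i ⟨i.val - 1, by omega⟩ else 0) = 0 := by
      split_ifs with h
      · exact betaZ_lower (Fin.mk_lt_mk.2 (by omega))
      · rfl
    rw [e1, e2, mul_comm]
  · have hv : j.val < i.val := h
    have e1 : (if h : i.val + 1 < n then betaZ n ⟨i.val + 1, h⟩ j else 0) = 0 := by
      split_ifs with h
      · exact betaZ_lower (Fin.mk_lt_mk.2 (by omega))
      · rfl
    have e2 : (if 0 < j.val then betaZ n i ⟨j.val - 1, by omega⟩ else 0) = 0 := by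
      split_ifs with h
      · exact betaZ_lower (Fin.mk_lt_mk.2 (by omega))
      · rfl
    rw [e1, e2, betaZ_lower h]
    simp

theorem betaZ_diag {n : ℕ} (i : Fin n) : betaZ n i i = Om (ix i) := by
  rw [betaZ_eq le_rfl, Nat.sub_self, seg_zero, divDiff_singleton]

/-- The `R(T)`-algebra homomorphism `β` from `𝒪(𝒵̃)` to symmetric functions. -/
def beta (n : ℕ) : OZ n →ₐ[RT n] Lam n :=
  liftOZ (betaZ n) (fun i => (Om (ix i))⁻¹)
    (fun i j h => by rw [betaZ, Matrix.of_apply, if_neg (not_le.2 h)])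
    (betaZ_comm n)
    (fun i => by rw [betaZ_diag, Om_mul_inv])

theorem beta_matZ (n : ℕ) : (matZ n).map (beta n) = betaZ n := liftOZ_matZ _ _ _ _ _

/-! ### The `τ`-functions are invertible after applying `β ∘ σ` -/

theorem map_leadingMinor {n : ℕ} {R S : Type*} [CommRing R] [CommRing S] (f : R →+* S)
    (M : Matrix (Fin n) (Fin n) R) (i : ℕ) :
    f (leadingMinor M i) = leadingMinor (M.map f) i := by
  rw [leadingMinor, RingHom.map_det]
  rfl


theorem map_matAZ {n : ℕ} {S : Type*} [CommRing S] [Algebra (RT n) S] (f : OZ n →ₐ[RT n] S) :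
    (matAZ n).map f = (matA n).map (algebraMap (RT n) S) := by
  ext i j
  simp [matAZ]

theorem map_matPZ {n : ℕ} {S : Type*} [CommRing S] [Algebra (RT n) S] (f : OZ n →ₐ[RT n] S) :
    (matPZ n).map f = (matP n).map (algebraMap (RT n) S) := by
  ext i j
  simp [matPZ]

theorem sigmaHom_tau (n i : ℕ) : sigmaHom n (tau n i) = sig n i := by
  have h := map_leadingMinor (sigmaHom n : OZ n →+* OZ n) (matZ n * matAZ n * matPZ n) i
  rw [Matrix.map_mul, Matrix.map_mul] at h
  change sigmaHom n (tau n i) = leadingMinor ((matZ n).map (sigmaHom n) *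
    (matAZ n).map (sigmaHom n) * (matPZ n).map (sigmaHom n)) i at h
  rw [sigmaHom_matZ, map_matAZ, map_matPZ] at h
  change sigmaHom n (tau n i) = leadingMinor (matZ n * (matAZ n)⁻¹ * matAZ n * matPZ n) i at h
  rwa [Matrix.mul_assoc (matZ n), Matrix.nonsing_inv_mul _ (isUnit_det_matAZ n),
    Matrix.mul_one] at h

/-- The value at `y = 0`. -/
def evalZero (n : ℕ) : OZ n →ₐ[RT n] KT n :=
  { (MvPowerSeries.constantCoeff (R := KT n) (σ := ℕ)).comp (beta n : OZ n →+* Lam n) with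
    commutes' := by
      intro c
      change MvPowerSeries.constantCoeff (beta n (algebraMap (RT n) (OZ n) c)) = _
      rw [AlgHom.commutes]
      rfl }

theorem isUnit_beta_iff {n : ℕ} (x : OZ n) : IsUnit (beta n x) ↔ evalZero n x ≠ 0 := by
  rw [MvPowerSeries.isUnit_iff_constantCoeff, isUnit_iff_ne_zero]
  rfl

theorem constantCoeff_permL {n : ℕ} (s : Equiv.Perm (ZMod n)) (f : Lam n) :
    MvPowerSeries.constantCoeff (permL s f) = permK s (MvPowerSeries.constantCoeff f) := by
  simp [permL]

theorem constantCoeff_opT {n : ℕ} (i : ZMod n) (f : Lam n) (c : ℤ)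
    (h : MvPowerSeries.constantCoeff f = c) : MvPowerSeries.constantCoeff (opT i f) = 0 := by
  have hs : MvPowerSeries.constantCoeff (sAct i f) = c := by
    rw [sAct]
    split_ifs
    · rw [map_mul, map_mul, constantCoeff_permL, h, constantCoeff_Om,
        MvPowerSeries.constantCoeff_inv, constantCoeff_Om]
      simp
    · rw [constantCoeff_permL, h]
      simp
  rw [opT, MvPowerSeries.constantCoeff_smul, map_sub, hs, h]
  simp

theorem constantCoeff_gOpen (n l : ℕ) :
    MvPowerSeries.constantCoeff (gOpen n [l]) = if l = 0 then 1 else 0 := by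
  induction l with
  | zero => simp [gOpen_zero]
  | succ l ih =>
    rw [gOpen_succ, constantCoeff_opT _ _ (if l = 0 then 1 else 0)]
    · simp
    · rw [ih]; split_ifs <;> simp

theorem evalZero_matZ (n : ℕ) : (matZ n).map (evalZero n) = 1 := by
  ext i j
  change MvPowerSeries.constantCoeff ((matZ n).map (beta n) i j) = _
  rw [beta_matZ]
  rcases lt_trichotomy i j with h | h | h
  · have hv : i.val < j.val := h
    rw [betaZ, Matrix.of_apply, if_pos h.le, MvPowerSeries.constantCoeff_smul, map_mul, shift,
      constantCoeff_permL, constantCoeff_gOpen, if_neg (by omega), Matrix.one_apply_ne h.ne]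
    simp
  · subst h
    rw [betaZ_diag, constantCoeff_Om, Matrix.one_apply_eq]
  · rw [betaZ_lower h, map_zero, Matrix.one_apply_ne h.ne']

/-- The matrix `A` over the fraction field. -/
def matAK (n : ℕ) : Matrix (Fin n) (Fin n) (KT n) := (matA n).map (algebraMap (RT n) (KT n))

/-- The matrix `P` over the fraction field. -/
def matPK (n : ℕ) : Matrix (Fin n) (Fin n) (KT n) := (matP n).map (algebraMap (RT n) (KT n))

theorem elemSym_zero (n m : ℕ) : elemSym n m 0 = 1 := by
  simp [elemSym, Multiset.esymm]

theorem elemSym_succ (n m k : ℕ) : elemSym n (m + 1) (k + 1) =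
    elemSym n m (k + 1) + expW (-wt n ((m + 1 : ℕ) : ZMod n)) * elemSym n m k := by
  simp only [elemSym, Multiset.esymm, Multiset.range_succ, Multiset.map_cons,
    Multiset.powersetCard_cons, Multiset.map_add, Multiset.sum_add, Multiset.map_map,
    Function.comp_def, Multiset.prod_cons, Multiset.sum_map_mul_left]

/-- The augmentation `e^μ ↦ 1`. -/
def augm (n : ℕ) : RT n →+* ℤ :=
  ((AddMonoidAlgebra.lift ℤ ℤ (Weight n) 1 : AddMonoidAlgebra ℤ (Weight n) →ₐ[ℤ] ℤ) :
    AddMonoidAlgebra ℤ (Weight n) →+* ℤ)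

theorem augm_expW {n : ℕ} (μ : Weight n) : augm n (expW μ) = 1 := by
  change AddMonoidAlgebra.lift ℤ ℤ (Weight n) 1 (AddMonoidAlgebra.single μ 1) = 1
  rw [AddMonoidAlgebra.lift_single]
  simp

theorem augm_elemSym (n m k : ℕ) : augm n (elemSym n m k) = m.choose k := by
  induction m generalizing k with
  | zero =>
    cases k with
    | zero => simp [elemSym_zero]
    | succ k => simp [elemSym, Multiset.esymm, Multiset.powersetCard_zero_right]
  | succ m ih =>
    cases k with
    | zero => simp [elemSym_zero]
    | succ k =>
      rw [elemSym_succ, map_add, map_mul, augm_expW, ih, ih, Nat.choose_succ_succ]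
      push_cast
      ring

theorem elemSym_ne_zero {n m k : ℕ} (h : k ≤ m) : elemSym n m k ≠ 0 := by
  intro e
  have := augm_elemSym n m k
  rw [e, map_zero] at this
  have hp := Nat.choose_pos h
  omega

theorem matP_lower {n : ℕ} {i j : Fin n} (h : i < j) : matPK n i j = 0 := by
  simp [matPK, matP, not_le.2 h]

theorem matP_diag {n : ℕ} (i : Fin n) : matPK n i i = 1 := by
  simp [matPK, matP, elemSym_zero]

theorem leadingMinor_matPK (n i : ℕ) : leadingMinor (matPK n) i = 1 := by
  rw [leadingMinor, Matrix.det_of_isLowerTriangular]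
  · simp [matP_diag]
  · intro a b h
    exact matP_lower h

theorem isUnit_beta_sig (n i : ℕ) : IsUnit (beta n (sig n i)) := by
  rw [isUnit_beta_iff]
  have h := map_leadingMinor (evalZero n : OZ n →+* KT n) (matZ n * matPZ n) i
  rw [Matrix.map_mul] at h
  change evalZero n (sig n i) = leadingMinor ((matZ n).map (evalZero n) *
    (matPZ n).map (evalZero n)) i at h
  rw [evalZero_matZ, map_matPZ, Matrix.one_mul] at h
  rw [h]
  change leadingMinor (matPK n) i ≠ 0
  rw [leadingMinor_matPK]
  exact one_ne_zero

theorem leadingMinor_invA_P (n i : ℕ) : leadingMinor ((matAK n)⁻¹ * matPK n) i ≠ 0 := by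
  intro hdet
  obtain ⟨v, hv, hv0⟩ := Matrix.exists_mulVec_eq_zero_iff.2 hdet
  apply hv
  let V : Fin n → KT n := fun r => if h : r.val < i then v ⟨r, h⟩ else 0
  have hVv : ∀ r : {r : Fin n // r.val < i}, V r.1 = v r := fun r => dif_pos r.2
  have hVout : ∀ r : Fin n, ¬ r.val < i → V r = 0 := fun r h => dif_neg h
  suffices hV : ∀ r, V r = 0 by
    funext r
    rw [← hVv r, hV]
    rfl
  let W : Fin n → KT n := ((matAK n)⁻¹ * matPK n).mulVec V
  have hW : ∀ r : Fin n, r.val < i → W r = 0 := by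
    intro r hr
    have h := congrFun hv0 ⟨r, hr⟩
    simp only [Matrix.mulVec, dotProduct, Matrix.submatrix_apply, Pi.zero_apply] at h
    change ∑ c, ((matAK n)⁻¹ * matPK n) r c * V c = 0
    rw [← h, ← Finset.sum_subset (Finset.subset_univ
      (Finset.univ.filter fun c : Fin n => c.val < i))]
    · rw [← Finset.sum_subtype_eq_sum_filter]
      refine Finset.sum_congr (by ext; simp) fun c _ => ?_
      rw [hVv]
    · intro c _ hc
      rw [hVout c (by simpa using hc), mul_zero]
  have hAW : (matAK n).mulVec W = (matPK n).mulVec V := by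
    have hA : IsUnit (matAK n).det := by
      have := (isUnit_det_matA n).map (algebraMap (RT n) (KT n))
      rwa [RingHom.map_det] at this
    change (matAK n).mulVec (((matAK n)⁻¹ * matPK n).mulVec V) = _
    rw [Matrix.mulVec_mulVec, ← Matrix.mul_assoc, Matrix.mul_nonsing_inv _ hA, Matrix.one_mul]
  let We : ℕ → KT n := fun r => if h : r < n then W ⟨r, h⟩ else 0
  have hrow : ∀ r : Fin n, expK (-wt n (ix r)) * W r - We (r.val + 1) =
      ∑ c, matPK n r c * V c := by
    intro r
    have h := congrFun hAW r
    have h' := sum_matA_left W r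
    rw [← expK] at h'
    exact h'.symm.trans h
  have hV1 : ∀ r : ℕ, ∀ h : r < n, r + 1 < i → V ⟨r, h⟩ = 0 := by
    intro r
    induction r using Nat.strong_induction_on with
    | _ r ih =>
      intro h hr
      have hrow' := hrow ⟨r, h⟩
      have hWe : We (r + 1) = 0 := by
        simp only [We]
        split_ifs with h1
        · exact hW _ hr
        · rfl
      rw [hW ⟨r, h⟩ (by simp only; omega), hWe, Finset.sum_eq_single ⟨r, h⟩, matP_diag] at hrow'
      · simpa using hrow'.symm
      · intro c _ hc
        rcases lt_or_gt_of_ne hc with hlt | hlt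
        · have hlt' : c.val < r := hlt
          rw [ih c.val hlt' c.2 (by omega), mul_zero]
        · rw [matP_lower hlt, zero_mul]
      · simp
  rcases Nat.eq_zero_or_pos i with rfl | hi
  · exact fun r => hVout r (by omega)
  obtain ⟨p, rfl⟩ : ∃ p, i = p + 1 := ⟨i - 1, by omega⟩
  by_cases hp : p < n
  · have hVne : ∀ r : Fin n, r ≠ ⟨p, hp⟩ → V r = 0 := by
      intro r hr
      have hne : r.val ≠ p := fun e => hr (Fin.ext e)
      by_cases h : r.val < p
      · exact hV1 r.val r.2 (by omega)
      · exact hVout r (by omega)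
    have hrow2 : ∀ r : Fin n, expK (-wt n (ix r)) * W r - We (r.val + 1) =
        matPK n r ⟨p, hp⟩ * V ⟨p, hp⟩ := by
      intro r
      rw [hrow, Finset.sum_eq_single ⟨p, hp⟩]
      · intro c _ hc
        rw [hVne c hc, mul_zero]
      · simp
    have hrec : ∀ t : ℕ, p + 1 + t ≤ n → We (p + 1 + t) =
        -(algebraMap (RT n) (KT n) (elemSym n (p + 1 + t) t) * V ⟨p, hp⟩) := by
      intro t
      induction t with
      | zero =>
        intro _
        have h := hrow2 ⟨p, hp⟩
        rw [hW ⟨p, hp⟩ (Nat.lt_succ_self p), matP_diag] at h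
        rw [elemSym_zero, map_one]
        linear_combination -h
      | succ t ih =>
        intro ht
        have hlt : p + 1 + t < n := by omega
        have h := hrow2 ⟨p + 1 + t, hlt⟩
        have hWr : W ⟨p + 1 + t, hlt⟩ = We (p + 1 + t) := by
          simp only [We]; rw [dif_pos hlt]
        have hP : matPK n ⟨p + 1 + t, hlt⟩ ⟨p, hp⟩ =
            algebraMap (RT n) (KT n) (elemSym n (p + 1 + t) (t + 1)) := by
          simp only [matPK, matP, Matrix.map_apply, Matrix.of_apply]
          rw [if_pos (Fin.mk_le_mk.2 (by omega)), show p + 1 + t - p = t + 1 by omega]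
        rw [hWr, ih (by omega), hP] at h
        change We (p + 1 + t + 1) = -(algebraMap (RT n) (KT n)
          (elemSym n (p + 1 + t + 1) (t + 1)) * _)
        rw [elemSym_succ, map_add, map_mul]
        change expK (-wt n ((p + 1 + t + 1 : ℕ) : ZMod n)) * _ - We (p + 1 + t + 1) = _ at h
        rw [expK] at h
        linear_combination -h
    have hfin := hrec (n - (p + 1)) (by omega)
    have hz : We (p + 1 + (n - (p + 1))) = 0 := dif_neg (by omega)
    rw [hz] at hfin
    have hne : algebraMap (RT n) (KT n) (elemSym n (p + 1 + (n - (p + 1))) (n - (p + 1))) ≠ 0 := by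
      rw [Ne, FaithfulSMul.algebraMap_eq_zero_iff]
      exact elemSym_ne_zero (by omega)
    have hVp : V ⟨p, hp⟩ = 0 := by
      rcases mul_eq_zero.1 (neg_eq_zero.1 hfin.symm) with h | h
      · exact absurd h hne
      · exact h
    intro r
    by_cases h : r = ⟨p, hp⟩
    · rw [h, hVp]
    · exact hVne r h
  · intro r
    have := r.2
    exact hV1 r.val r.2 (by omega)

theorem isUnit_beta_sigma_sig (n i : ℕ) : IsUnit (beta n (sigmaHom n (sig n i))) := by
  rw [isUnit_beta_iff]
  have h := map_leadingMinor ((evalZero n).comp (sigmaHom n) : OZ n →+* KT n)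
    (matZ n * matPZ n) i
  rw [Matrix.map_mul] at h
  change evalZero n (sigmaHom n (sig n i)) =
    leadingMinor (((matZ n).map (sigmaHom n)).map (evalZero n) *
    (matPZ n).map ((evalZero n).comp (sigmaHom n))) i at h
  rw [map_matPZ, sigmaHom_matZ] at h
  have hinv : (matZ n * (matAZ n)⁻¹).map (evalZero n) = (matAK n)⁻¹ := by
    have e : (matZ n * (matAZ n)⁻¹ * matAZ n).map (evalZero n) = 1 := by
      rw [Matrix.mul_assoc, Matrix.nonsing_inv_mul _ (isUnit_det_matAZ n), Matrix.mul_one,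
        evalZero_matZ]
    have e' : (matZ n * (matAZ n)⁻¹).map (evalZero n) * matAK n = 1 := by
      rw [← e, matAK, ← map_matAZ (evalZero n)]
      exact (Matrix.map_mul (f := (evalZero n : OZ n →+* KT n))).symm
    exact (Matrix.inv_eq_left_inv e').symm
  rw [h, hinv]
  exact leadingMinor_invA_P n i

/-! ### The `K`-Peterson maps: target -/

/-- The multiplicative set generated by the `τ_i` and `σ_i`. Here `τ_0 = σ_0 = 1`, and for `i > n`
the elements `tau n i`, `sig n i` coincide with `τ_n`, `σ_n`. -/
def tauSet (n : ℕ) : Submonoid (OZ n) :=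
  Submonoid.closure (Set.range (tau n) ∪ Set.range (sig n))

theorem tau_mem (n i : ℕ) : tau n i ∈ tauSet n :=
  Submonoid.subset_closure (Or.inl ⟨i, rfl⟩)

theorem sig_mem (n i : ℕ) : sig n i ∈ tauSet n :=
  Submonoid.subset_closure (Or.inr ⟨i, rfl⟩)

/-- `𝒪(𝒵̃°) = 𝒪(𝒵̃)[τ_i⁻¹, σ_i⁻¹]`. -/
abbrev OZo (n : ℕ) : Type := Localization (tauSet n)

/-- The automorphism `σ`, followed by the identification `β` with symmetric functions. -/
def betaSigma (n : ℕ) : OZ n →ₐ[RT n] Lam n := (beta n).comp (sigmaHom n)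

theorem isUnit_betaSigma (n : ℕ) (x : tauSet n) : IsUnit (betaSigma n x) := by
  have hle : tauSet n ≤ (IsUnit.submonoid (Lam n)).comap (betaSigma n : OZ n →* Lam n) := by
    rw [tauSet, Submonoid.closure_le]
    rintro _ (⟨i, rfl⟩ | ⟨i, rfl⟩)
    · change IsUnit (beta n (sigmaHom n (tau n i)))
      rw [sigmaHom_tau]
      exact isUnit_beta_sig n i
    · exact isUnit_beta_sigma_sig n i
  exact hle x.2

/-- `σ` on `𝒪(𝒵̃)[τ_i⁻¹, σ_i⁻¹]`, with values in symmetric functions (through `β`). -/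
def betaSigmaLoc (n : ℕ) : OZo n →+* Lam n :=
  IsLocalization.lift (M := tauSet n) (g := (betaSigma n : OZ n →+* Lam n))
    (fun y => isUnit_betaSigma n y)

/-! ### The relativistic Toda side -/

/-- The polynomial ring `R(T)[z_1, …, z_n, Q_1, …, Q_{n-1}]`. -/
abbrev PolyY (n : ℕ) : Type := MvPolynomial (Fin n ⊕ Fin (n - 1)) (RT n)

/-- The variable `z_j`, `1 ≤ j ≤ n`. -/
def polyz (n j : ℕ) : PolyY n :=
  if h : 1 ≤ j ∧ j ≤ n then MvPolynomial.X (Sum.inl ⟨j - 1, by omega⟩) else 0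

/-- The variable `Q_j`, `1 ≤ j ≤ n - 1`; by convention `Q_n = 0`. -/
def polyQ (n j : ℕ) : PolyY n :=
  if h : 1 ≤ j ∧ j ≤ n - 1 then MvPolynomial.X (Sum.inr ⟨j - 1, by omega⟩) else 0

/-- `F_m^{(i)} = ∑_{J ⊆ [i], |J| = m} ∏_{j ∈ J, j + 1 ∉ J} (1 - Q_j) ∏_{j ∈ J} z_j`. -/
def polyF (n i m : ℕ) : PolyY n :=
  ∑ J ∈ (Finset.Icc 1 i).powersetCard m,
    (∏ j ∈ J.filter (fun j => j + 1 ∉ J), (1 - polyQ n j)) * ∏ j ∈ J, polyz n j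

/-- The ideal generated by `F_i(z, Q) - e_i(e^{-a_1}, …, e^{-a_n})`, `1 ≤ i ≤ n`. -/
def idealY (n : ℕ) : Ideal (PolyY n) :=
  Ideal.span {f | ∃ i, 1 ≤ i ∧ i ≤ n ∧ f = polyF n n i - MvPolynomial.C (elemSym n n i)}

/-- `𝒪(𝒴) = QK_T^{pol}(SL_n/B)`. -/
def OY (n : ℕ) : Type := PolyY n ⧸ idealY n

instance (n : ℕ) : CommRing (OY n) := inferInstanceAs (CommRing (PolyY n ⧸ idealY n))

instance (n : ℕ) : Algebra (RT n) (OY n) :=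
  inferInstanceAs (Algebra (RT n) (PolyY n ⧸ idealY n))

/-- The quotient map onto `𝒪(𝒴)`. -/
def mkY (n : ℕ) : PolyY n →ₐ[RT n] OY n := Ideal.Quotient.mkₐ (RT n) (idealY n)

/-- `𝒪(𝒴°) = 𝒪(𝒴)[Q_1⁻¹, …, Q_{n-1}⁻¹]`. -/
abbrev OYo (n : ℕ) : Type :=
  Localization (Submonoid.closure {q : OY n | ∃ j, 1 ≤ j ∧ j ≤ n - 1 ∧ q = mkY n (polyQ n j)})

/-- The class in `𝒪(𝒴°)` of a polynomial in `R(T)[z, Q]`. -/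
def clsY {n : ℕ} (f : PolyY n) : OYo n := algebraMap (OY n) (OYo n) (mkY n f)

/-- `η_i = 1 - e^{a_{n-i+1}}`, `1 ≤ i ≤ n`. -/
def eta (n i : ℕ) : RT n := 1 - expW (wt n ((n - i + 1 : ℕ) : ZMod n))

/-- `ψ_i = ∑_{j=0}^{i} (-1)^j (1 - η_{n-i})^j F_j^{(i)}(z, Q)`. -/
def psi (n i : ℕ) : PolyY n :=
  ∑ j ∈ Finset.range (i + 1),
    (-1) ^ j * MvPolynomial.C ((1 - eta n (n - i)) ^ j) * polyF n i j

/-- The quantum double Grothendieck polynomial of the longest element,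
`𝔊^Q_{w_∘} = ψ_1 ψ_2 ⋯ ψ_{n-1}`. -/
def grothLongest (n : ℕ) : PolyY n := ∏ i ∈ Finset.Icc 1 (n - 1), psi n i

/-! ### The `K`-Peterson maps -/

/-- The element `x / y` of `𝒪(𝒵̃°)`, for `y` in the multiplicative set generated by the
`τ_i` and `σ_i`. -/
def fracZ {n : ℕ} (x y : OZ n) (hy : y ∈ tauSet n) : OZo n := Localization.mk x ⟨y, hy⟩

/-- `Φ` is the `R(T)`-algebra homomorphism `Φ_n`: it sends
`z_i` to `τ_i σ_{i-1} / (σ_i τ_{i-1})` for `1 ≤ i ≤ n` and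
`Q_i` to `τ_{i-1} τ_{i+1} / τ_i²` for `1 ≤ i ≤ n - 1`. -/
def IsPhi {n : ℕ} (Φ : OYo n →ₐ[RT n] OZo n) : Prop :=
  (∀ i, 1 ≤ i → i ≤ n → Φ (clsY (polyz n i)) =
    fracZ (tau n i * sig n (i - 1)) (sig n i * tau n (i - 1))
      (mul_mem (sig_mem n i) (tau_mem n (i - 1)))) ∧
  (∀ i, 1 ≤ i → i ≤ n - 1 → Φ (clsY (polyQ n i)) =
    fracZ (tau n (i - 1) * tau n (i + 1)) (tau n i ^ 2) (pow_mem (tau_mem n i) 2))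

/-- `Φ̃ = σ ∘ Φ`, with values in symmetric functions. -/
def PhiTilde {n : ℕ} (Φ : OYo n →ₐ[RT n] OZo n) (f : OYo n) : Lam n := betaSigmaLoc n (Φ f)

end KPeterson

end

open KPeterson

/-!
The minors `σ_i`, `τ_i` are leading principal minors of `ZP` and `ZAP`. The matrix `P⁻¹` has as rows
the Krylov vectors `e_1 A^j`; because `Z` commutes with `A`, passing to the Krylov basis turns these
minors into Toeplitz determinants of a single sequence, in which going from `σ` to `τ` shifts the
index by one. The
Desnanot–Jacobi identity then gives the discrete Toda relations among the `σ_i` and `τ_i`: the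
`F^{(n)}_m`, evaluated at the prescribed `z_i` and `Q_i`, are the coefficients of the
characteristic polynomial of `A`, which makes `Φ_n` well defined, and the truncated Hamiltonians in
`ψ_i` assemble to the `i`-th leading minor of `Z(1 - e^{a_{i+1}} A)P` divided by `σ_i`.

To identify that minor, diagonalize `A`. Its eigenvalues are `e^{-a_k}`, those of the image of `Z`
are the `Ω(b_k|y)`, and the minor becomes a bialternant: an alternant in the pairs
`(-e^{-a_k}, Ω(b_k|y))` divided by a Vandermonde determinant, from which the index `i + 1` drops
out. Up to the factors `Ω`, every `D_j` in the word of the rectangle acts as an isobaric divided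
difference, and one row of the rectangle performs a Lagrange interpolation that replaces a
bialternant of order `r` by the one of order `r + 1`.
-/

noncomputable section

namespace KPeterson

open Matrix

/-! ### The Desnanot–Jacobi identity -/

section DesnanotJacobi

variable {R : Type*} [CommRing R]

theorem det_mul_det_adjugate_submatrix {m k n : Type*} [Fintype m] [Fintype k] [Fintype n]
    [DecidableEq m] [DecidableEq k] [DecidableEq n] (e : m ⊕ k ≃ n) (M : Matrix n n R) :
    M.det * (M.adjugate.submatrix (e ∘ Sum.inr) (e ∘ Sum.inr)).det =
      (M.submatrix (e ∘ Sum.inl) (e ∘ Sum.inl)).det * M.det ^ Fintype.card k := by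
  set M' := M.submatrix e e
  have hM : M'.det = M.det := det_submatrix_equiv_self e M
  have hadj : M'.adjugate = M.adjugate.submatrix e e := adjugate_submatrix_equiv_self e M
  have hmul : M' * fromBlocks 1 M'.adjugate.toBlocks₁₂ 0 M'.adjugate.toBlocks₂₂ =
      fromBlocks M'.toBlocks₁₁ 0 M'.toBlocks₂₁ (M'.det • 1) := by
    have h := mul_adjugate M'
    rw [← fromBlocks_toBlocks M', ← fromBlocks_toBlocks (adjugate _), fromBlocks_multiply,
      ← fromBlocks_one, fromBlocks_smul, fromBlocks_inj, smul_zero] at h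
    conv_lhs => enter [1]; rw [← fromBlocks_toBlocks M']
    rw [fromBlocks_multiply]
    simp only [fromBlocks_toBlocks] at h ⊢
    rw [h.2.1, h.2.2.2]
    simp
  have hdet := congrArg det hmul
  rw [det_mul, det_fromBlocks_zero₂₁, det_one, one_mul, det_fromBlocks_zero₁₂, det_smul, det_one,
    mul_one, hM, hadj] at hdet
  exact hdet

theorem det_mul_det_interior_of_isLeftRegular {m : ℕ} (M : Matrix (Fin (m + 2)) (Fin (m + 2)) R)
    (hM : IsLeftRegular M.det) :
    M.det * (M.submatrix (Fin.succ ∘ Fin.castSucc) (Fin.succ ∘ Fin.castSucc)).det =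
      (M.submatrix Fin.succ Fin.succ).det * (M.submatrix Fin.castSucc Fin.castSucc).det -
        (M.submatrix Fin.succ Fin.castSucc).det * (M.submatrix Fin.castSucc Fin.succ).det := by
  let f : Fin m ⊕ Fin 2 → Fin (m + 2) := Sum.elim (Fin.succ ∘ Fin.castSucc) ![0, Fin.last (m + 1)]
  have hf : Function.Bijective f := by
    refine (Fintype.bijective_iff_injective_and_card f).2 ⟨?_, by simp⟩
    rintro (a | a) (b | b) <;> (try fin_cases a) <;> (try fin_cases b) <;>
      simp [f, Fin.ext_iff] <;> omega
  have hinterior := det_mul_det_adjugate_submatrix (Equiv.ofBijective f hf) M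
  rw [det_fin_two, Fintype.card_fin, pow_two, mul_left_comm] at hinterior
  replace hinterior := hM hinterior
  have hsign : ((-1 : R) ^ (m + 1)) * (-1) ^ (m + 1) = 1 := by rw [← mul_pow]; simp
  simp only [submatrix_apply, Function.comp_apply, Equiv.ofBijective_apply, f, Sum.elim_inr,
    cons_val_zero, cons_val_one, adjugate_fin_succ_eq_det_submatrix, Fin.succAbove_zero,
    Fin.succAbove_last, Fin.val_zero, Fin.val_last, zero_add, add_zero, pow_zero, one_mul,
    pow_add _ (m + 1), hsign] at hinterior
  rw [mul_comm M.det]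
  refine hinterior.symm.trans ?_
  linear_combination (-(M.submatrix Fin.castSucc Fin.succ).det *
    (M.submatrix Fin.succ Fin.castSucc).det) * hsign

theorem det_mul_det_interior {m : ℕ} (M : Matrix (Fin (m + 2)) (Fin (m + 2)) R) :
    M.det * (M.submatrix (Fin.succ ∘ Fin.castSucc) (Fin.succ ∘ Fin.castSucc)).det =
      (M.submatrix Fin.succ Fin.succ).det * (M.submatrix Fin.castSucc Fin.castSucc).det -
        (M.submatrix Fin.succ Fin.castSucc).det * (M.submatrix Fin.castSucc Fin.succ).det := by
  have hgeneric := congrArg (MvPolynomial.aeval fun p : Fin (m + 2) × Fin (m + 2) => M p.1 p.2)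
    (det_mul_det_interior_of_isLeftRegular (mvPolynomialX (Fin (m + 2)) (Fin (m + 2)) ℤ)
      (IsRegular.of_ne_zero (det_mvPolynomialX_ne_zero _ ℤ)).left)
  have hX := mvPolynomialX_mapMatrix_aeval ℤ M
  simp only [map_mul, map_sub, AlgHom.map_det, AlgHom.mapMatrix_apply] at hgeneric hX
  simpa only [← submatrix_map, hX] using hgeneric

end DesnanotJacobi

/-! ### Toeplitz determinants -/

section Toeplitz

variable {R : Type*} [CommRing R]

/-- The Toeplitz determinant `det (h_{a-b+k})`, `0 ≤ a, b < i`. The offset `k` lets the determinants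
of a sequence and of its shifts be handled together. -/
def toeplitzDet (h : ℤ → R) (k : ℤ) (i : ℕ) : R :=
  (of fun a b : Fin i => h (a - b + k)).det

/-- The sequence `h_m + s h_{m+1}`. -/
def geomStep (h : ℤ → R) (s : R) (m : ℤ) : R := h m + s * h (m + 1)

theorem toeplitzDet_zero_size (h : ℤ → R) (k : ℤ) : toeplitzDet h k 0 = 1 := det_fin_zero

theorem det_eq_toeplitzDet {h : ℤ → R} {k : ℤ} {i : ℕ} {M : Matrix (Fin i) (Fin i) R}
    (hM : ∀ a b, M a b = h (a - b + k)) : M.det = toeplitzDet h k i :=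
  congrArg det (Matrix.ext hM)

theorem det_eq_mul_toeplitzDet_of_first_row {h : ℤ → R} {k : ℤ} {s c : R} {i : ℕ}
    {M : Matrix (Fin (i + 1)) (Fin (i + 1)) R} (hfirst : ∀ b, M 0 b = c * (-s) ^ (b : ℕ))
    (hM : ∀ a b, M (Fin.succ a) b = h (a - b + k + 1)) :
    M.det = c * toeplitzDet (geomStep h s) k i := by
  let B : Matrix (Fin (i + 1)) (Fin (i + 1)) R := of fun a =>
    Fin.cons (M a 0) fun b => M a b.succ + s * M a b.castSucc
  have hdet : M.det = B.det := det_eq_of_forall_col_eq_smul_add_pred (fun _ => -s)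
    (fun a => rfl) fun a b => by simp [B]
  have hzero : ∀ b : Fin i, B 0 b.succ = 0 := fun b => by
    simp only [B, of_apply, Fin.cons_succ, hfirst, Fin.val_succ, Fin.val_castSucc]
    ring
  rw [hdet, det_succ_row_zero, Fin.sum_univ_succ]
  simp only [hzero, mul_zero, zero_mul, Finset.sum_const_zero, add_zero, Fin.succAbove_zero]
  rw [det_eq_toeplitzDet (h := geomStep h s) (k := k)]
  · simp [B, hfirst]
  · intro a b
    simp only [B, submatrix_apply, of_apply, Fin.cons_succ, hM, geomStep, Fin.val_succ,
      Fin.val_castSucc]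
    congr 2
    push_cast
    ring

theorem det_eq_mul_toeplitzDet_of_last_row {h : ℤ → R} {k : ℤ} {s c : R} {i : ℕ}
    {M : Matrix (Fin (i + 1)) (Fin (i + 1)) R}
    (hlast : ∀ b, M (Fin.last i) b = c * (-s) ^ (b : ℕ))
    (hM : ∀ a b, M (Fin.castSucc a) b = h (a - b + k + 1)) :
    M.det = (-1) ^ i * c * toeplitzDet (geomStep h s) k i := by
  have hperm := det_permute (finRotate (i + 1)).symm M
  rw [det_eq_mul_toeplitzDet_of_first_row (h := h) (k := k) (s := s) (c := c), Equiv.Perm.sign_symm,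
    sign_finRotate] at hperm
  · push_cast at hperm
    rw [mul_assoc, hperm, ← mul_assoc, ← mul_pow]
    simp
  · intro b
    have hzero : (finRotate (i + 1)).symm 0 = Fin.last i :=
      (Equiv.symm_apply_eq _).2 finRotate_last.symm
    rw [submatrix_apply, hzero, id_eq, hlast]
  · intro a b
    have hsucc : (finRotate (i + 1)).symm a.succ = a.castSucc :=
      (Equiv.symm_apply_eq _).2 (by simp)
    rw [submatrix_apply, hsucc, id_eq, hM]

theorem toeplitzDet_sq (h : ℤ → R) (k : ℤ) (i : ℕ) :
    toeplitzDet h k (i + 1) ^ 2 = toeplitzDet h k i * toeplitzDet h k (i + 2) +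
      toeplitzDet h (k + 1) (i + 1) * toeplitzDet h (k - 1) (i + 1) := by
  let M : Matrix (Fin (i + 2)) (Fin (i + 2)) R := of fun a b => h (a - b + k)
  have hM : M.det = toeplitzDet h k (i + 2) := rfl
  have hinterior : (M.submatrix (Fin.succ ∘ Fin.castSucc) (Fin.succ ∘ Fin.castSucc)).det =
      toeplitzDet h k i := det_eq_toeplitzDet fun a b => congrArg h (by simp)
  have hss : (M.submatrix Fin.succ Fin.succ).det = toeplitzDet h k (i + 1) :=
    det_eq_toeplitzDet fun a b => congrArg h (by simp)
  have hcc : (M.submatrix Fin.castSucc Fin.castSucc).det = toeplitzDet h k (i + 1) := rfl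
  have hsc : (M.submatrix Fin.succ Fin.castSucc).det = toeplitzDet h (k + 1) (i + 1) :=
    det_eq_toeplitzDet fun a b => congrArg h (by simp; ring)
  have hcs : (M.submatrix Fin.castSucc Fin.succ).det = toeplitzDet h (k - 1) (i + 1) :=
    det_eq_toeplitzDet fun a b => congrArg h (by simp; ring)
  have hDJ := det_mul_det_interior M
  rw [hM, hinterior, hss, hcc, hsc, hcs] at hDJ
  linear_combination -hDJ

theorem toeplitzDet_geomStep_succ_mul_left (h : ℤ → R) (s : R) (k : ℤ) (i : ℕ) :
    toeplitzDet (geomStep h s) k (i + 1) * toeplitzDet h (k + 1) i =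
      toeplitzDet (geomStep h s) (k + 1) i * toeplitzDet h k (i + 1) +
        s * toeplitzDet h (k + 1) (i + 1) * toeplitzDet (geomStep h s) k i := by
  let N : Matrix (Fin (i + 2)) (Fin (i + 2)) R := of (Fin.snoc (α := fun _ => Fin (i + 2) → R)
    (fun a b => h (a - b + k + 1)) fun b => (-s) ^ (b : ℕ))
  have hlast : ∀ b, N (Fin.last (i + 1)) b = (-s) ^ (b : ℕ) := fun b => by
    simp only [N, of_apply, Fin.snoc_last]
  have hrow : ∀ (a : Fin (i + 1)) b, N a.castSucc b = h (a - b + k + 1) := fun a b => by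
    simp only [N, of_apply, Fin.snoc_castSucc]
  have hN : N.det = (-1) ^ (i + 1) * 1 * toeplitzDet (geomStep h s) k (i + 1) :=
    det_eq_mul_toeplitzDet_of_last_row (fun b => by simp [hlast]) hrow
  have hinterior : (N.submatrix (Fin.succ ∘ Fin.castSucc) (Fin.succ ∘ Fin.castSucc)).det =
      toeplitzDet h (k + 1) i :=
    det_eq_toeplitzDet fun a b => (hrow a.succ _).trans (congrArg h (by simp; ring))
  have hss : (N.submatrix Fin.succ Fin.succ).det =
      (-1) ^ i * (-s) * toeplitzDet (geomStep h s) k i :=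
    det_eq_mul_toeplitzDet_of_last_row (fun b => by simp [hlast, pow_succ'])
      fun a b => (hrow a.succ _).trans (congrArg h (by simp))
  have hcc : (N.submatrix Fin.castSucc Fin.castSucc).det = toeplitzDet h (k + 1) (i + 1) :=
    det_eq_toeplitzDet fun a b => (hrow a _).trans (congrArg h (by simp; ring))
  have hsc : (N.submatrix Fin.succ Fin.castSucc).det =
      (-1) ^ i * 1 * toeplitzDet (geomStep h s) (k + 1) i :=
    det_eq_mul_toeplitzDet_of_last_row (fun b => by simp [hlast])
      fun a b => (hrow a.succ _).trans (congrArg h (by simp; ring))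
  have hcs : (N.submatrix Fin.castSucc Fin.succ).det = toeplitzDet h k (i + 1) :=
    det_eq_toeplitzDet fun a b => (hrow a _).trans (congrArg h (by simp; ring))
  have hDJ := det_mul_det_interior N
  rw [hN, hinterior, hss, hcc, hsc, hcs] at hDJ
  refine (isUnit_one.neg.pow (i + 1)).mul_left_cancel ?_
  linear_combination hDJ

theorem toeplitzDet_geomStep_succ_mul_right (h : ℤ → R) (s : R) (k : ℤ) (i : ℕ) :
    toeplitzDet (geomStep h s) (k + 1) (i + 1) * toeplitzDet h (k + 1) i =
      toeplitzDet (geomStep h s) (k + 1) i * toeplitzDet h (k + 1) (i + 1) +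
        s * toeplitzDet h (k + 2) (i + 1) * toeplitzDet (geomStep h s) k i := by
  let N : Matrix (Fin (i + 2)) (Fin (i + 2)) R :=
    of (Fin.cons (fun b => (-s) ^ (b : ℕ)) fun a b => h (a - b + k + 2))
  have hN : N.det = 1 * toeplitzDet (geomStep h s) (k + 1) (i + 1) :=
    det_eq_mul_toeplitzDet_of_first_row (fun b => by simp [N])
      fun a b => congrArg h (by ring)
  have hinterior : (N.submatrix (Fin.succ ∘ Fin.castSucc) (Fin.succ ∘ Fin.castSucc)).det =
      toeplitzDet h (k + 1) i := det_eq_toeplitzDet fun a b => congrArg h (by simp; ring)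
  have hss : (N.submatrix Fin.succ Fin.succ).det = toeplitzDet h (k + 1) (i + 1) :=
    det_eq_toeplitzDet fun a b => congrArg h (by simp; ring)
  have hcc : (N.submatrix Fin.castSucc Fin.castSucc).det =
      1 * toeplitzDet (geomStep h s) (k + 1) i :=
    det_eq_mul_toeplitzDet_of_first_row (fun b => by simp [N])
      fun a b => congrArg h (by simp; ring)
  have hsc : (N.submatrix Fin.succ Fin.castSucc).det = toeplitzDet h (k + 2) (i + 1) :=
    det_eq_toeplitzDet fun a b => congrArg h (by simp; ring)
  have hcs : (N.submatrix Fin.castSucc Fin.succ).det = -s * toeplitzDet (geomStep h s) k i :=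
    det_eq_mul_toeplitzDet_of_first_row (fun b => by simp [N, pow_succ'])
      fun a b => congrArg h (by simp; ring)
  have hDJ := det_mul_det_interior N
  rw [hN, hinterior, hss, hcc, hsc, hcs] at hDJ
  linear_combination hDJ

theorem toeplitzDet_geomStep_succ_mul_of_isUnit (h : ℤ → R) (s : R) (k : ℤ) (i : ℕ)
    (hu : IsUnit (toeplitzDet h (k + 1) i)) :
    toeplitzDet (geomStep h s) k (i + 1) * toeplitzDet h (k + 1) (i + 1) =
      toeplitzDet (geomStep h s) (k + 1) (i + 1) * toeplitzDet h k (i + 1) +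
        s * toeplitzDet h (k + 1) (i + 2) * toeplitzDet (geomStep h s) k i := by
  have hsq := toeplitzDet_sq h (k + 1) i
  rw [add_assoc, one_add_one_eq_two, add_sub_cancel_right] at hsq
  apply hu.mul_left_cancel
  linear_combination
    toeplitzDet h (k + 1) (i + 1) * toeplitzDet_geomStep_succ_mul_left h s k i -
    toeplitzDet h k (i + 1) * toeplitzDet_geomStep_succ_mul_right h s k i +
    s * toeplitzDet (geomStep h s) k i * hsq

end Toeplitz

/-! ### Hamiltonians of the relativistic Toda lattice -/

section Toda

variable {R : Type*} [CommRing R]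

/-- The Hamiltonian `F_m^{(i)}(z, Q)` of the relativistic Toda lattice, over any commutative ring.
Unlike in the definition of `𝒪(𝒴)`, the boundary condition `Q_n = 0` is not built in. -/
def todaHamiltonian (z Q : ℕ → R) (i m : ℕ) : R :=
  ∑ J ∈ (Finset.Icc 1 i).powersetCard m,
    (∏ j ∈ J.filter (fun j => j + 1 ∉ J), (1 - Q j)) * ∏ j ∈ J, z j

/-- The generating function `∑_m t^m F_m^{(i)}(z, Q)` of the Toda Hamiltonians. -/
def todaGen (z Q : ℕ → R) (t : R) (i : ℕ) : R :=
  ∑ m ∈ Finset.range (i + 1), t ^ m * todaHamiltonian z Q i m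

theorem map_todaHamiltonian {S : Type*} [CommRing S] (f : R →+* S) (z Q : ℕ → R) (i m : ℕ) :
    f (todaHamiltonian z Q i m) = todaHamiltonian (fun j => f (z j)) (fun j => f (Q j)) i m := by
  simp [todaHamiltonian, map_sum, map_mul, map_prod]

theorem todaHamiltonian_congr_right (z : ℕ → R) {Q Q' : ℕ → R} {i : ℕ}
    (hQ : ∀ j ∈ Finset.Icc 1 i, Q j = Q' j) (m : ℕ) :
    todaHamiltonian z Q i m = todaHamiltonian z Q' i m := by
  refine Finset.sum_congr rfl fun J hJ => congrArg (· * _) (Finset.prod_congr rfl fun j hj => ?_)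
  rw [hQ j ((Finset.mem_powersetCard.1 hJ).1 (Finset.mem_filter.1 hj).1)]

variable (z Q : ℕ → R) (t : R)

theorem todaGen_eq_sum_powerset (i : ℕ) :
    todaGen z Q t i = ∑ J ∈ (Finset.Icc 1 i).powerset,
      t ^ J.card * ((∏ j ∈ J.filter (fun j => j + 1 ∉ J), (1 - Q j)) * ∏ j ∈ J, z j) := by
  rw [Finset.sum_powerset, Nat.card_Icc, Nat.add_sub_cancel]
  refine Finset.sum_congr rfl fun m _ => ?_
  rw [todaHamiltonian, Finset.mul_sum]
  exact Finset.sum_congr rfl fun J hJ => by rw [(Finset.mem_powersetCard.1 hJ).2]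

theorem todaGen_zero : todaGen z Q t 0 = 1 := by simp [todaGen_eq_sum_powerset]

theorem todaGen_congr_right {Q Q' : ℕ → R} {i : ℕ} (hQ : ∀ j ∈ Finset.Icc 1 i, Q j = Q' j) :
    todaGen z Q t i = todaGen z Q' t i :=
  Finset.sum_congr rfl fun m _ => by rw [todaHamiltonian_congr_right z hQ m]

theorem todaGen_succ (i : ℕ) :
    todaGen z Q t (i + 1) = todaGen z Q t i +
      (1 - Q (i + 1)) * t * z (i + 1) * todaGen z (Function.update Q i 0) t i := by
  have hIcc : Finset.Icc 1 (i + 1) = insert (i + 1) (Finset.Icc 1 i) := by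
    ext
    simp
    omega
  simp only [todaGen_eq_sum_powerset]
  rw [hIcc, Finset.sum_powerset_insert (by simp), Finset.mul_sum]
  congr 1
  refine Finset.sum_congr rfl fun J hJ => ?_
  have hle : ∀ j ∈ J, j ≤ i := fun j hj =>
    (Finset.mem_Icc.1 (Finset.mem_powerset.1 hJ hj)).2
  have hi : i + 1 ∉ J := fun h => by have := hle _ h; omega
  have hi' : i + 2 ∉ J := fun h => by have := hle _ h; omega
  have hfilter : ∏ j ∈ J.filter (fun j => j + 1 ∉ insert (i + 1) J), (1 - Q j) =
      ∏ j ∈ J.filter (fun j => j + 1 ∉ J), (1 - Function.update Q i 0 j) := by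
    rw [Finset.prod_filter, Finset.prod_filter]
    refine Finset.prod_congr rfl fun j _ => ?_
    by_cases hj : j = i <;> simp [hj]
  rw [Finset.card_insert_of_notMem hi, Finset.prod_insert hi, Finset.filter_insert,
    if_pos (by simp [hi']), Finset.prod_insert (by simp [hi]), hfilter]
  ring

theorem todaGen_update_succ (i : ℕ) :
    todaGen z (Function.update Q (i + 1) 0) t (i + 1) = todaGen z Q t i +
      t * z (i + 1) * todaGen z (Function.update Q i 0) t i := by
  have hle : ∀ j ∈ Finset.Icc 1 i, j ≠ i + 1 := fun j hj => by
    have := (Finset.mem_Icc.1 hj).2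
    omega
  rw [todaGen_succ, Function.update_self, sub_zero, one_mul]
  congr 1
  · exact todaGen_congr_right z t fun j hj => Function.update_of_ne (hle j hj) _ _
  · congr 1
    refine todaGen_congr_right z t fun j hj => ?_
    by_cases hji : j = i <;> simp [hji, hle j hj]

theorem todaGen_succ_eq_update_succ_sub (i : ℕ) :
    todaGen z Q t (i + 1) = todaGen z (Function.update Q (i + 1) 0) t (i + 1) -
      Q (i + 1) * t * z (i + 1) * todaGen z (Function.update Q i 0) t i := by
  rw [todaGen_succ, todaGen_update_succ]
  ring

variable {z Q t} in
/-- Read `σ_i` for the Toeplitz determinant of offset `0` and `(-1)^i τ_i` for that of offset `1`: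
then `hz` and `hQ` say `z_i = τ_i σ_{i-1} / (σ_i τ_{i-1})` and `Q_i = τ_{i-1} τ_{i+1} / τ_i²`. -/
theorem todaGen_mul_toeplitzDet {n : ℕ} {h : ℤ → R} (s : R)
    (hσ : ∀ i ≤ n, IsUnit (toeplitzDet h 0 i)) (hτ : ∀ i ≤ n, IsUnit (toeplitzDet h 1 i))
    (hz : ∀ i < n, z (i + 1) * (toeplitzDet h 0 (i + 1) * toeplitzDet h 1 i) =
      -(toeplitzDet h 1 (i + 1) * toeplitzDet h 0 i))
    (hQ : ∀ i, i + 1 < n →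
      Q (i + 1) * toeplitzDet h 1 (i + 1) ^ 2 = toeplitzDet h 1 i * toeplitzDet h 1 (i + 2))
    {i : ℕ} (hi : i ≤ n) :
    todaGen z (Function.update Q i 0) (-s) i * toeplitzDet h 0 i =
        toeplitzDet (geomStep h s) 0 i ∧
      (i < n → todaGen z Q (-s) i * toeplitzDet h 1 i = toeplitzDet (geomStep h s) 1 i) := by
  induction i with
  | zero => simp [todaGen_zero, toeplitzDet_zero_size]
  | succ i ih =>
    obtain ⟨ihK, ihF⟩ := ih (by omega)
    have ihF := ihF (by omega)
    have hz := hz i (by omega)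
    have hK : todaGen z (Function.update Q (i + 1) 0) (-s) (i + 1) * toeplitzDet h 0 (i + 1) =
        toeplitzDet (geomStep h s) 0 (i + 1) := by
      apply (hτ i (by omega)).mul_right_cancel
      have hborder := toeplitzDet_geomStep_succ_mul_left h s 0 i
      rw [zero_add] at hborder
      rw [todaGen_update_succ, hborder]
      linear_combination toeplitzDet h 0 (i + 1) * ihF -
        s * todaGen z (Function.update Q i 0) (-s) i * hz + s * toeplitzDet h 1 (i + 1) * ihK
    refine ⟨hK, fun hi' => ?_⟩
    have hQ := hQ i hi'
    have hborder := toeplitzDet_geomStep_succ_mul_of_isUnit h s 0 i (by simpa using hτ i (by omega))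
    rw [zero_add] at hborder
    apply (((hσ (i + 1) hi).mul (hτ i (by omega))).mul (hτ (i + 1) hi)).mul_right_cancel
    rw [todaGen_succ_eq_update_succ_sub]
    linear_combination
      (toeplitzDet h 1 (i + 1) * toeplitzDet h 1 i * toeplitzDet h 1 (i + 1)) * hK +
      s * todaGen z (Function.update Q i 0) (-s) i * z (i + 1) * toeplitzDet h 0 (i + 1) *
        toeplitzDet h 1 i * hQ +
      s * toeplitzDet h 1 i * toeplitzDet h 1 (i + 2) *
        todaGen z (Function.update Q i 0) (-s) i * hz -
      s * toeplitzDet h 1 i * toeplitzDet h 1 (i + 1) * toeplitzDet h 1 (i + 2) * ihK +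
      toeplitzDet h 1 i * toeplitzDet h 1 (i + 1) * hborder

end Toda

/-! ### Leading principal minors -/

section LeadingMinor

variable {n : ℕ} {R : Type*} [CommRing R]

theorem leadingMinor_transpose (M : Matrix (Fin n) (Fin n) R) (i : ℕ) :
    leadingMinor Mᵀ i = leadingMinor M i := by
  rw [leadingMinor, leadingMinor, ← det_transpose]
  rfl

theorem leadingMinor_mul_of_lower {L : Matrix (Fin n) (Fin n) R} (hL : L.IsLowerTriangular)
    (M : Matrix (Fin n) (Fin n) R) (i : ℕ) :
    leadingMinor (L * M) i = leadingMinor L i * leadingMinor M i := by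
  rw [leadingMinor, leadingMinor, leadingMinor, ← det_mul]
  congr 1
  ext a b
  simp only [submatrix_apply, mul_apply]
  rw [← Finset.sum_subset (Finset.subset_univ (Finset.univ.filter fun c : Fin n => c.val < i))]
  · rw [← Finset.sum_subtype_eq_sum_filter]
    exact Finset.sum_congr (by ext; simp) fun c _ => rfl
  · intro c _ hc
    rw [hL (show a.1 < c from a.2.trans_le (by simpa using hc)), zero_mul]

theorem leadingMinor_mul_of_upper {U : Matrix (Fin n) (Fin n) R} (hU : U.IsUpperTriangular)
    (M : Matrix (Fin n) (Fin n) R) (i : ℕ) :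
    leadingMinor (M * U) i = leadingMinor M i * leadingMinor U i := by
  rw [← leadingMinor_transpose, transpose_mul, leadingMinor_mul_of_lower hU.transpose,
    leadingMinor_transpose, leadingMinor_transpose, mul_comm]

theorem leadingMinor_of_lower_unitriangular {L : Matrix (Fin n) (Fin n) R}
    (hL : L.IsLowerTriangular) (hdiag : ∀ a, L a a = 1) (i : ℕ) : leadingMinor L i = 1 := by
  rw [leadingMinor,
    det_of_isLowerTriangular (L.submatrix Subtype.val Subtype.val) fun _ _ h => hL h]
  simp [hdiag]

theorem leadingMinor_of_upper_unitriangular {U : Matrix (Fin n) (Fin n) R}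
    (hU : U.IsUpperTriangular) (hdiag : ∀ a, U a a = 1) (i : ℕ) : leadingMinor U i = 1 := by
  rw [← leadingMinor_transpose]
  exact leadingMinor_of_lower_unitriangular hU.transpose hdiag i

theorem leadingMinor_self (M : Matrix (Fin n) (Fin n) R) : leadingMinor M n = M.det :=
  det_submatrix_equiv_self (Equiv.subtypeUnivEquiv fun r : Fin n => r.2) M

theorem leadingMinor_eq_det_fin (M : Matrix (Fin n) (Fin n) R) {i : ℕ} (hi : i ≤ n) :
    leadingMinor M i = (M.submatrix (Fin.castLE hi) (Fin.castLE hi)).det := by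
  let e : {r : Fin n // r.val < i} ≃ Fin i :=
    { toFun := fun r => ⟨r.1.1, r.2⟩
      invFun := fun r => ⟨Fin.castLE hi r, r.2⟩
      left_inv := fun r => rfl
      right_inv := fun r => rfl }
  rw [leadingMinor, ← det_submatrix_equiv_self e]
  rfl

theorem leadingMinor_eq_toeplitzDet {h : ℤ → R} {k : ℤ} {M : Matrix (Fin n) (Fin n) R}
    (hM : ∀ a b : Fin n, M a b = h (a - b + k)) {i : ℕ} (hi : i ≤ n) :
    leadingMinor M i = toeplitzDet h k i := by
  rw [leadingMinor_eq_det_fin _ hi]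
  exact det_eq_toeplitzDet fun a b => hM _ _

end LeadingMinor

/-! ### Elementary symmetric polynomials in `e^{-a_1}, …, e^{-a_m}` -/

theorem elemSym_eq_sum (n m k : ℕ) : elemSym n m k =
    ∑ J ∈ (Finset.range m).powersetCard k, ∏ t ∈ J, expW (-wt n ((t + 1 : ℕ) : ZMod n)) := by
  rw [elemSym, ← Finset.range_val, Finset.esymm_map_val]

theorem elemSym_eq_zero {n m k : ℕ} (h : m < k) : elemSym n m k = 0 := by
  rw [elemSym_eq_sum, Finset.powersetCard_eq_empty.2 (by simpa using h), Finset.sum_empty]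

theorem elemSym_self_eq_prod (n m : ℕ) :
    elemSym n m m = ∏ t ∈ Finset.range m, expW (-wt n ((t + 1 : ℕ) : ZMod n)) := by
  have h := Finset.powersetCard_self (Finset.range m)
  rw [Finset.card_range] at h
  rw [elemSym_eq_sum, h, Finset.sum_singleton]

theorem expW_sum {n : ℕ} {ι : Type*} (s : Finset ι) (μ : ι → Weight n) :
    expW (∑ i ∈ s, μ i) = ∏ i ∈ s, expW (μ i) := by
  classical
  induction s using Finset.induction_on with
  | empty => exact expW_zero
  | insert i s hi ih => rw [Finset.sum_insert hi, Finset.prod_insert hi, expW_add, ih]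

theorem sum_range_natCast_succ_zmod {M : Type*} [AddCommMonoid M] (n : ℕ) [NeZero n]
    (f : ZMod n → M) : ∑ t ∈ Finset.range n, f ((t + 1 : ℕ) : ZMod n) = ∑ i, f i := by
  refine Finset.sum_bij (fun t _ => ((t + 1 : ℕ) : ZMod n)) (fun _ _ => Finset.mem_univ _) ?_ ?_
    (fun _ _ => rfl)
  · intro s hs t ht hst
    rw [Nat.cast_succ, Nat.cast_succ, add_left_inj, ZMod.natCast_eq_natCast_iff'] at hst
    rwa [Nat.mod_eq_of_lt (Finset.mem_range.1 hs), Nat.mod_eq_of_lt (Finset.mem_range.1 ht)] at hst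
  · intro i _
    refine ⟨(i - 1).val, Finset.mem_range.2 (ZMod.val_lt _), ?_⟩
    rw [Nat.cast_succ, ZMod.natCast_zmod_val, sub_add_cancel]

theorem sum_wt (n : ℕ) [NeZero n] : ∑ i, wt n i = 0 := by
  change ∑ i : ZMod n, QuotientAddGroup.mk' (AddSubgroup.zmultiples (1 : ZMod n → ℤ))
    (Pi.single i 1) = 0
  rw [← map_sum, QuotientAddGroup.mk'_apply, QuotientAddGroup.eq_zero_iff]
  exact ⟨1, (one_zsmul _).trans (Finset.univ_sum_single 1).symm⟩

theorem elemSym_self (n : ℕ) [NeZero n] : elemSym n n n = 1 := by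
  rw [elemSym_self_eq_prod, ← expW_sum, Finset.sum_neg_distrib, sum_range_natCast_succ_zmod,
    sum_wt, neg_zero, expW_zero]

theorem prod_one_add_mul_eq_sum_elemSym {n : ℕ} {S : Type*} [CommRing S] [Algebra (RT n) S]
    (t : S) (m : ℕ) :
    ∏ k ∈ Finset.range m, (1 + t * algebraMap (RT n) S (expW (-wt n ((k + 1 : ℕ) : ZMod n)))) =
      ∑ j ∈ Finset.range (m + 1), t ^ j * algebraMap (RT n) S (elemSym n m j) := by
  rw [Finset.prod_one_add, Finset.sum_powerset, Finset.card_range]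
  refine Finset.sum_congr rfl fun j _ => ?_
  rw [elemSym_eq_sum, map_sum, Finset.mul_sum]
  refine Finset.sum_congr rfl fun J hJ => ?_
  rw [Finset.prod_mul_distrib, Finset.prod_const, (Finset.mem_powersetCard.1 hJ).2, map_prod]

/-! ### The matrices `A` and `P` -/

section MatAP

/-- The matrix `A` over an `R(T)`-algebra. -/
def matAS (n : ℕ) (S : Type*) [CommRing S] [Algebra (RT n) S] : Matrix (Fin n) (Fin n) S :=
  (matA n).map (algebraMap (RT n) S)

/-- The matrix `P` over an `R(T)`-algebra. -/
def matPS (n : ℕ) (S : Type*) [CommRing S] [Algebra (RT n) S] : Matrix (Fin n) (Fin n) S :=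
  (matP n).map (algebraMap (RT n) S)

variable {n : ℕ} {S : Type*} [CommRing S] [Algebra (RT n) S]

theorem matPS_apply_self (a : Fin n) : matPS n S a a = 1 := by
  simp [matPS, matP, elemSym_zero]

theorem matAS_mul_apply (M : Matrix (Fin n) (Fin n) S) (a b : Fin n) :
    (matAS n S * M) a b = algebraMap (RT n) S (expW (-wt n (ix a))) * M a b -
      (if h : a.val + 1 < n then M ⟨a.val + 1, h⟩ b else 0) := by
  rw [mul_apply]
  exact sum_matA_left (fun j => M j b) a

theorem mul_matAS_apply (M : Matrix (Fin n) (Fin n) S) (a b : Fin n) :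
    (M * matAS n S) a b = M a b * algebraMap (RT n) S (expW (-wt n (ix b))) -
      (if 0 < b.val then M a ⟨b.val - 1, by omega⟩ else 0) := by
  rw [mul_apply]
  exact sum_matA_right (M a) b

theorem matPS_apply_pascal (a b : Fin n) (ha : a.val + 1 < n) (hb : 0 < b.val) :
    matPS n S ⟨a.val + 1, ha⟩ b = matPS n S a ⟨b.val - 1, by omega⟩ +
      algebraMap (RT n) S (expW (-wt n (ix a))) * matPS n S a b := by
  simp only [matPS, map_apply, matP, of_apply, Fin.le_def, ix]
  rcases lt_trichotomy b.val (a.val + 1) with hab | hab | hab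
  · rw [if_pos (by omega), if_pos (by omega), if_pos (by omega),
      show a.val + 1 - b.val = a.val - b.val + 1 by omega,
      show a.val - (b.val - 1) = a.val - b.val + 1 by omega, elemSym_succ, map_add, map_mul]
  · simp [hab, elemSym_zero]
  · rw [if_neg (by omega), if_neg (by omega), if_neg (by omega)]
    simp

theorem matPS_apply_zero_succ (a : Fin n) (ha : a.val + 1 < n) :
    matPS n S ⟨a.val + 1, ha⟩ ⟨0, by omega⟩ =
      algebraMap (RT n) S (expW (-wt n (ix a))) * matPS n S a ⟨0, by omega⟩ := by
  simp only [matPS, map_apply, matP, of_apply, Fin.le_def, ix, zero_le, if_true, Nat.sub_zero]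
  rw [elemSym_succ, elemSym_eq_zero (Nat.lt_succ_self _), zero_add, map_mul]

theorem neg_matAS_mul_matPS_apply (a b : Fin n) (ha : a.val + 1 < n) :
    (-matAS n S * matPS n S) a b =
      if 0 < b.val then matPS n S a ⟨b.val - 1, by omega⟩ else 0 := by
  rw [neg_mul, Matrix.neg_apply, matAS_mul_apply, dif_pos ha]
  split_ifs with hb
  · rw [matPS_apply_pascal a b ha hb]
    ring
  · have hb0 : b = ⟨0, by omega⟩ := Fin.ext (by simpa using hb)
    rw [hb0, matPS_apply_zero_succ, sub_self, neg_zero]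

theorem isUnit_neg_matAS : IsUnit (-matAS n S) := by
  rw [IsUnit.neg_iff, isUnit_iff_isUnit_det]
  have hdet := (isUnit_det_matA n).map (algebraMap (RT n) S)
  rwa [RingHom.map_det] at hdet

theorem matAS_isUpperTriangular : (matAS n S).IsUpperTriangular := fun a b hab => by
  rw [matAS, map_apply, matA_upper n hab, map_zero]

theorem det_one_add_smul_matAS (t : S) :
    (1 + t • matAS n S).det =
      ∑ j ∈ Finset.range (n + 1), t ^ j * algebraMap (RT n) S (elemSym n n j) := by
  rw [det_of_isUpperTriangular, ← prod_one_add_mul_eq_sum_elemSym, Finset.prod_range]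
  · exact Finset.prod_congr rfl fun k _ => by simp [matAS, matA, ix]
  · exact blockTriangular_one.add fun a b hab => by
      rw [Matrix.smul_apply, matAS_isUpperTriangular hab, smul_zero]

end MatAP

/-! ### The Krylov factorization of `P` -/

section Krylov

variable {n : ℕ} [NeZero n] {S : Type*} [CommRing S] [Algebra (RT n) S]

theorem matAS_mul_matPS_apply_zero (a : Fin n) :
    (matAS n S * matPS n S) a 0 = (1 : Matrix (Fin n) (Fin n) S) a (Fin.rev 0) := by
  have hn := NeZero.pos n
  by_cases ha : a.val + 1 < n
  · have hne : a ≠ Fin.rev 0 := fun h => by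
      rw [h, Fin.val_rev, Fin.val_zero] at ha
      omega
    have h := neg_matAS_mul_matPS_apply (S := S) a 0 ha
    rw [if_neg (by simp), neg_mul, Matrix.neg_apply, neg_eq_zero] at h
    rw [h, one_apply_ne hne]
  · have hlast : a = Fin.rev 0 := Fin.ext (by rw [Fin.val_rev, Fin.val_zero]; omega)
    have hself := elemSym_succ n a.val a.val
    rw [elemSym_eq_zero (Nat.lt_succ_self _), zero_add, show a.val + 1 = n by omega,
      elemSym_self] at hself
    rw [← hlast, one_apply_eq, matAS_mul_apply, dif_neg ha, sub_zero, matPS, map_apply, matP,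
      of_apply, if_pos (Fin.zero_le _), ← map_mul, Fin.val_zero, Nat.sub_zero, ix,
      show a.val + 1 = n by omega, ← hself, map_one]

theorem neg_matAS_pow_succ_apply (a : ℕ) (j : Fin n) :
    ((-matAS n S) ^ (a + 1)) 0 j =
      (if 0 < j.val then ((-matAS n S) ^ a) 0 ⟨j.val - 1, by omega⟩ else 0) -
        ((-matAS n S) ^ a) 0 j * algebraMap (RT n) S (expW (-wt n (ix j))) := by
  rw [pow_succ, mul_neg, Matrix.neg_apply, mul_matAS_apply, neg_sub]

theorem neg_matAS_pow_apply_eq_zero {a : ℕ} {j : Fin n} (h : a < j.val) :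
    ((-matAS n S) ^ a) 0 j = 0 := by
  induction a generalizing j with
  | zero => rw [pow_zero, one_apply_ne (Fin.ne_of_val_ne (by simpa using h.ne))]
  | succ a ih =>
    rw [neg_matAS_pow_succ_apply, if_pos (by omega), ih (by simp only; omega), ih (by omega),
      zero_mul, sub_zero]

theorem neg_matAS_pow_apply_self (j : Fin n) : ((-matAS n S) ^ j.val) 0 j = 1 := by
  obtain ⟨a, ha⟩ := j
  induction a with
  | zero => simp
  | succ a ih =>
    rw [neg_matAS_pow_succ_apply, if_pos (Nat.succ_pos a),
      neg_matAS_pow_apply_eq_zero (j := ⟨a + 1, ha⟩) (Nat.lt_succ_self a), zero_mul, sub_zero]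
    exact ih (by omega)

theorem neg_matAS_pow_mul_matPS_apply {a : ℕ} (ha : a < n) (b : Fin n) :
    ((-matAS n S) ^ a * matPS n S) 0 b = if a = b.val then 1 else 0 := by
  induction a generalizing b with
  | zero =>
    rw [pow_zero, Matrix.one_mul, matPS, map_apply, matP, of_apply]
    by_cases hb : b = 0
    · simp [hb, elemSym_zero]
    · rw [if_neg (by simpa using hb), map_zero, if_neg fun h => hb (Fin.ext (by simp [← h]))]
  | succ a ih =>
    have hshift : ((-matAS n S) ^ (a + 1) * matPS n S) 0 b =
        ∑ k, ((-matAS n S) ^ a) 0 k *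
          if 0 < b.val then matPS n S k ⟨b.val - 1, by omega⟩ else 0 := by
      rw [pow_succ, Matrix.mul_assoc, mul_apply]
      refine Finset.sum_congr rfl fun k _ => ?_
      rcases lt_or_ge a k.val with hk | hk
      · rw [neg_matAS_pow_apply_eq_zero hk, zero_mul, zero_mul]
      · rw [neg_matAS_mul_matPS_apply _ _ (by omega)]
    rw [hshift]
    by_cases hb : 0 < b.val
    · simp only [if_pos hb]
      rw [← mul_apply, ih (by omega)]
      exact if_congr (by simp only; omega) rfl rfl
    · simp only [if_neg hb, mul_zero, Finset.sum_const_zero]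
      rw [if_neg (by omega)]

variable (n S) in
/-- The Krylov matrix of `-A` and the first coordinate form: its `a`-th row is the first row of
`(-A)^a`. It is the inverse of `P`. -/
def krylovRows : Matrix (Fin n) (Fin n) S := of fun a j => ((-matAS n S) ^ a.val) 0 j

theorem krylovRows_mul_matPS : krylovRows n S * matPS n S = 1 := by
  ext a b
  refine (neg_matAS_pow_mul_matPS_apply a.2 b).trans ?_
  simp [one_apply, Fin.ext_iff]

theorem matPS_mul_krylovRows : matPS n S * krylovRows n S = 1 :=
  mul_eq_one_comm.1 krylovRows_mul_matPS

theorem krylovRows_isLowerTriangular : (krylovRows n S).IsLowerTriangular :=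
  fun _ _ h => neg_matAS_pow_apply_eq_zero h

theorem leadingMinor_krylovRows_mul (M : Matrix (Fin n) (Fin n) S) (i : ℕ) :
    leadingMinor (krylovRows n S * M) i = leadingMinor M i := by
  rw [leadingMinor_mul_of_lower krylovRows_isLowerTriangular, leadingMinor_of_lower_unitriangular
    krylovRows_isLowerTriangular neg_matAS_pow_apply_self, one_mul]

variable (n S) in
/-- `-A` as a unit of the matrix ring, so that it has powers with integer exponents. -/
def negA : (Matrix (Fin n) (Fin n) S)ˣ := (isUnit_neg_matAS (n := n) (S := S)).unit

omit [NeZero n] in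
theorem coe_negA : (negA n S : Matrix (Fin n) (Fin n) S) = -matAS n S := rfl

/-- The sequence of upper right corners `((-A)^m A⁻¹ W)_{1n}`, `m ∈ ℤ`. -/
def cornerSeq (W : Matrix (Fin n) (Fin n) S) (m : ℤ) : S :=
  -(((negA n S ^ (m - 1) : (Matrix (Fin n) (Fin n) S)ˣ) : Matrix (Fin n) (Fin n) S) * W) 0
    (Fin.rev 0)

theorem cornerSeq_add (W W' : Matrix (Fin n) (Fin n) S) (m : ℤ) :
    cornerSeq (W + W') m = cornerSeq W m + cornerSeq W' m := by
  rw [cornerSeq, Matrix.mul_add, Matrix.add_apply, neg_add, cornerSeq, cornerSeq]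

theorem cornerSeq_smul (c : S) (W : Matrix (Fin n) (Fin n) S) (m : ℤ) :
    cornerSeq (c • W) m = c * cornerSeq W m := by
  simp [cornerSeq]

theorem cornerSeq_mul_matAS {W : Matrix (Fin n) (Fin n) S} (hW : Commute W (matAS n S)) (m : ℤ) :
    cornerSeq (W * matAS n S) m = -cornerSeq W (m + 1) := by
  have hpow : ((negA n S ^ (m + 1 - 1) : (Matrix (Fin n) (Fin n) S)ˣ) : Matrix (Fin n) (Fin n) S) =
      ((negA n S ^ (m - 1) : (Matrix (Fin n) (Fin n) S)ˣ) : Matrix (Fin n) (Fin n) S) *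
        -matAS n S := by
    rw [← coe_negA, ← Units.val_mul, ← _root_.zpow_add_one, sub_add_cancel, add_sub_cancel_right]
  rw [cornerSeq, cornerSeq, hpow, hW.eq, Matrix.mul_assoc, neg_mul, mul_neg, Matrix.neg_apply,
    neg_neg]

theorem cornerSeq_mul_one_add_smul {W : Matrix (Fin n) (Fin n) S} (hW : Commute W (matAS n S))
    (t : S) : cornerSeq (W * (1 + t • matAS n S)) = geomStep (cornerSeq W) (-t) := by
  funext m
  rw [Matrix.mul_add, Matrix.mul_one, mul_smul_comm, cornerSeq_add, cornerSeq_smul,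
    cornerSeq_mul_matAS hW, geomStep]
  ring

theorem cornerSeq_one_of_pos {m : ℕ} (hm : 0 < m) (hmn : m < n) :
    cornerSeq (1 : Matrix (Fin n) (Fin n) S) m = 0 := by
  obtain ⟨d, rfl⟩ := Nat.exists_eq_succ_of_ne_zero hm.ne'
  rw [cornerSeq, Matrix.mul_one, Nat.cast_succ, add_sub_cancel_right, zpow_natCast,
    Units.val_pow_eq_pow_val, coe_negA, neg_matAS_pow_apply_eq_zero, neg_zero]
  rw [Fin.val_rev, Fin.val_zero]
  omega

theorem cornerSeq_one_zero : cornerSeq (1 : Matrix (Fin n) (Fin n) S) 0 = 1 := by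
  have hcancel : -((negA n S)⁻¹ : (Matrix (Fin n) (Fin n) S)ˣ) * (matAS n S * matPS n S) =
      matPS n S := by
    rw [← Matrix.mul_assoc, neg_mul_comm, ← coe_negA, Units.inv_mul, Matrix.one_mul]
  have hcol : (matAS n S * matPS n S).col 0 = (1 : Matrix (Fin n) (Fin n) S).col (Fin.rev 0) :=
    funext matAS_mul_matPS_apply_zero
  calc cornerSeq (1 : Matrix (Fin n) (Fin n) S) 0
      = (-((negA n S)⁻¹ : (Matrix (Fin n) (Fin n) S)ˣ) *
          (1 : Matrix (Fin n) (Fin n) S)) 0 (Fin.rev 0) := by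
        rw [cornerSeq, zero_sub, _root_.zpow_neg_one, neg_mul, Matrix.neg_apply]
    _ = (-((negA n S)⁻¹ : (Matrix (Fin n) (Fin n) S)ˣ) * (matAS n S * matPS n S)) 0 0 := by
        rw [mul_apply, mul_apply]
        exact Finset.sum_congr rfl fun k _ => congrArg _ (congrFun hcol k).symm
    _ = 1 := by rw [hcancel, matPS_apply_self]

variable (n S) in
/-- The Krylov matrix of `(-A)⁻¹` and the last basis vector: its `b`-th column is the last column of
`-(-A)^{-b-1}`. -/
def krylovCols : Matrix (Fin n) (Fin n) S :=
  of fun j b => -((negA n S ^ (-(b.val : ℤ) - 1) : (Matrix (Fin n) (Fin n) S)ˣ) :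
    Matrix (Fin n) (Fin n) S) j (Fin.rev 0)

theorem krylovRows_mul_mul_krylovCols_apply {W : Matrix (Fin n) (Fin n) S}
    (hW : Commute W (matAS n S)) (a b : Fin n) :
    (krylovRows n S * W * krylovCols n S) a b = cornerSeq W ((a : ℤ) - (b : ℤ)) := by
  set V := ((negA n S ^ (-(b.val : ℤ) - 1) : (Matrix (Fin n) (Fin n) S)ˣ) :
    Matrix (Fin n) (Fin n) S) with hV
  have hWA : Commute W (negA n S : Matrix (Fin n) (Fin n) S) := hW.neg_right
  have hWV : Commute W V := hWA.units_zpow_right _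
  have hrow : (krylovRows n S * W * krylovCols n S) a b =
      ((-matAS n S) ^ a.val * W * -V) 0 (Fin.rev 0) := by
    rw [mul_apply, mul_apply]
    rfl
  rw [hrow, cornerSeq, mul_neg, Matrix.mul_assoc, hWV.eq, ← Matrix.mul_assoc, ← coe_negA, hV,
    ← Units.val_pow_eq_pow_val, ← Units.val_mul, ← zpow_natCast, ← _root_.zpow_add,
    Matrix.neg_apply, add_sub, ← sub_eq_add_neg]

theorem krylovRows_mul_krylovCols_apply (a b : Fin n) :
    (krylovRows n S * krylovCols n S) a b =
      cornerSeq (1 : Matrix (Fin n) (Fin n) S) ((a : ℤ) - (b : ℤ)) := by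
  rw [← krylovRows_mul_mul_krylovCols_apply (Commute.one_left _), Matrix.mul_one]

theorem krylovRows_mul_krylovCols_isUpperTriangular :
    (krylovRows n S * krylovCols n S).IsUpperTriangular := fun a b (hab : b.val < a.val) => by
  rw [krylovRows_mul_krylovCols_apply, ← Nat.cast_sub hab.le]
  exact cornerSeq_one_of_pos (Nat.sub_pos_of_lt hab) (by omega)

/-- The `i`-th leading principal minor of `W P`. At the universal point `Z` it is `σ_i`, and `τ_i`
is its value at `Z A`. -/
def sigAt (W : Matrix (Fin n) (Fin n) S) (i : ℕ) : S := leadingMinor (W * matPS n S) i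

theorem sigAt_eq_toeplitzDet {W : Matrix (Fin n) (Fin n) S} (hW : Commute W (matAS n S))
    {i : ℕ} (hi : i ≤ n) : sigAt W i = toeplitzDet (cornerSeq W) 0 i := by
  have hdiag (a : Fin n) : (krylovRows n S * krylovCols n S) a a = 1 := by
    rw [krylovRows_mul_krylovCols_apply, sub_self, cornerSeq_one_zero]
  calc sigAt W i
      = leadingMinor (krylovRows n S * (W * matPS n S) * (krylovRows n S * krylovCols n S)) i := by
        rw [leadingMinor_mul_of_upper krylovRows_mul_krylovCols_isUpperTriangular,
          leadingMinor_of_upper_unitriangular krylovRows_mul_krylovCols_isUpperTriangular hdiag,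
          mul_one, leadingMinor_krylovRows_mul, sigAt]
    _ = leadingMinor (krylovRows n S * W * krylovCols n S) i := by
        rw [← Matrix.mul_assoc _ W, Matrix.mul_assoc _ (matPS n S), ← Matrix.mul_assoc (matPS n S),
          matPS_mul_krylovRows, Matrix.one_mul]
    _ = toeplitzDet (cornerSeq W) 0 i := leadingMinor_eq_toeplitzDet
        (fun a b => by rw [krylovRows_mul_mul_krylovCols_apply hW, add_zero]) hi

theorem sigAt_mul_matAS_eq_toeplitzDet {W : Matrix (Fin n) (Fin n) S}
    (hW : Commute W (matAS n S)) {i : ℕ} (hi : i ≤ n) :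
    sigAt (W * matAS n S) i = (-1) ^ i * toeplitzDet (cornerSeq W) 1 i := by
  rw [sigAt_eq_toeplitzDet (hW.mul_left (Commute.refl _)) hi, toeplitzDet, toeplitzDet]
  have hneg : (of fun a b : Fin i => cornerSeq (W * matAS n S) ((a : ℤ) - b + 0)) =
      -of fun a b : Fin i => cornerSeq W ((a : ℤ) - b + 1) := by
    ext a b
    rw [of_apply, add_zero, cornerSeq_mul_matAS hW, Matrix.neg_apply, of_apply]
  rw [hneg, det_neg, Fintype.card_fin]

end Krylov

/-! ### Toda points -/

section TodaPoint

variable {n : ℕ} [NeZero n] {S T : Type*} [CommRing S] [CommRing T] [Algebra (RT n) S]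
  [Algebra (RT n) T]

omit [NeZero n] in
theorem map_matAS (f : S →ₐ[RT n] T) : (matAS n S).map f = matAS n T := by
  ext
  simp [matAS]

omit [NeZero n] in
theorem map_matPS (f : S →ₐ[RT n] T) : (matPS n S).map f = matPS n T := by
  ext
  simp [matPS]

omit [NeZero n] in
theorem map_sigAt (f : S →ₐ[RT n] T) (W : Matrix (Fin n) (Fin n) S) (i : ℕ) :
    f (sigAt W i) = sigAt (W.map f) i := by
  rw [sigAt, sigAt, ← map_matPS f, ← Matrix.map_mul]
  exact map_leadingMinor (f : S →+* T) _ i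

/-- `(z, Q)` is the image of the point `Z` of the centralizer of `A` under the map of spaces
underlying `Φ`: `z_i = τ_i σ_{i-1} / (σ_i τ_{i-1})` and `Q_i = τ_{i-1} τ_{i+1} / τ_i²`, with the
denominators cleared and required to be units. -/
structure IsTodaPoint (Z : Matrix (Fin n) (Fin n) S) (z Q : ℕ → S) : Prop where
  commute : Commute Z (matAS n S)
  isUnit_sig : ∀ i ≤ n, IsUnit (sigAt Z i)
  isUnit_tau : ∀ i ≤ n, IsUnit (sigAt (Z * matAS n S) i)
  z_mul : ∀ i < n, z (i + 1) * (sigAt Z (i + 1) * sigAt (Z * matAS n S) i) =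
    sigAt (Z * matAS n S) (i + 1) * sigAt Z i
  Q_mul : ∀ i, i + 1 < n → Q (i + 1) * sigAt (Z * matAS n S) (i + 1) ^ 2 =
    sigAt (Z * matAS n S) i * sigAt (Z * matAS n S) (i + 2)

namespace IsTodaPoint

variable {Z : Matrix (Fin n) (Fin n) S} {z Q : ℕ → S}

omit [NeZero n] in
theorem map (h : IsTodaPoint Z z Q) (f : S →ₐ[RT n] T) :
    IsTodaPoint (Z.map f) (fun i => f (z i)) (fun i => f (Q i)) := by
  have hZA : Z.map f * matAS n T = (Z * matAS n S).map f := by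
    rw [Matrix.map_mul, map_matAS]
  refine ⟨?_, fun i hi => ?_, fun i hi => ?_, fun i hi => ?_, fun i hi => ?_⟩
  · rw [Commute, SemiconjBy, hZA, h.commute.eq, Matrix.map_mul, map_matAS]
  · exact map_sigAt f Z i ▸ (h.isUnit_sig i hi).map f
  · exact hZA ▸ map_sigAt f _ i ▸ (h.isUnit_tau i hi).map f
  · simp only [hZA, ← map_sigAt, ← map_mul, h.z_mul i hi]
  · simp only [hZA, ← map_sigAt, ← map_mul, ← map_pow, h.Q_mul i hi]

theorem todaGen_mul_toeplitzDet_cornerSeq (h : IsTodaPoint Z z Q) (t : S) {i : ℕ} (hi : i ≤ n) :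
    todaGen z (Function.update Q i 0) t i * toeplitzDet (cornerSeq Z) 0 i =
        toeplitzDet (geomStep (cornerSeq Z) (-t)) 0 i ∧
      (i < n → todaGen z Q t i * toeplitzDet (cornerSeq Z) 1 i =
        toeplitzDet (geomStep (cornerSeq Z) (-t)) 1 i) := by
  have hσ {i : ℕ} (hi : i ≤ n) := sigAt_eq_toeplitzDet h.commute hi
  have hτ {i : ℕ} (hi : i ≤ n) := sigAt_mul_matAS_eq_toeplitzDet h.commute hi
  have hsign (i : ℕ) : (-1 : S) ^ i * (-1) ^ i = 1 := by
    rw [← mul_pow, neg_one_mul, neg_neg, one_pow]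
  obtain ⟨s, rfl⟩ : ∃ s, t = -s := ⟨-t, (neg_neg t).symm⟩
  rw [neg_neg]
  refine todaGen_mul_toeplitzDet s (fun i hi => hσ hi ▸ h.isUnit_sig i hi)
    (fun i hi => ?_) (fun i hi => ?_) (fun i hi => ?_) hi
  · have hunit := h.isUnit_tau i hi
    rw [hτ hi] at hunit
    exact isUnit_of_mul_isUnit_right hunit
  · have hz := h.z_mul i hi
    rw [hσ hi, hσ hi.le, hτ hi, hτ hi.le, pow_succ] at hz
    linear_combination (-1) ^ i * hz - (z (i + 1) * (toeplitzDet (cornerSeq Z) 0 (i + 1) *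
      toeplitzDet (cornerSeq Z) 1 i) + toeplitzDet (cornerSeq Z) 1 (i + 1) *
        toeplitzDet (cornerSeq Z) 0 i) * hsign i
  · have hQ := h.Q_mul i hi
    rw [hτ (by omega), hτ (by omega), hτ (by omega), pow_succ, pow_succ] at hQ
    linear_combination hQ - (Q (i + 1) * toeplitzDet (cornerSeq Z) 1 (i + 1) ^ 2 -
      toeplitzDet (cornerSeq Z) 1 i * toeplitzDet (cornerSeq Z) 1 (i + 2)) * hsign i

theorem todaGen_update_mul_sigAt (h : IsTodaPoint Z z Q) (t : S) {i : ℕ} (hi : i ≤ n) :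
    todaGen z (Function.update Q i 0) t i * sigAt Z i = sigAt (Z * (1 + t • matAS n S)) i := by
  have hcomm : Commute (Z * (1 + t • matAS n S)) (matAS n S) :=
    h.commute.mul_left ((Commute.one_left _).add_left ((Commute.refl _).smul_left t))
  rw [sigAt_eq_toeplitzDet h.commute hi, sigAt_eq_toeplitzDet hcomm hi,
    cornerSeq_mul_one_add_smul h.commute]
  exact (h.todaGen_mul_toeplitzDet_cornerSeq t hi).1

theorem todaGen_mul_sigAt (h : IsTodaPoint Z z Q) (t : S) {i : ℕ} (hi : i < n) :
    todaGen z Q t i * sigAt (Z * matAS n S) i =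
      sigAt (Z * matAS n S * (1 + t • matAS n S)) i := by
  have hA : Commute (1 + t • matAS n S) (matAS n S) :=
    (Commute.one_left _).add_left ((Commute.refl _).smul_left t)
  rw [Matrix.mul_assoc, ← hA.eq, ← Matrix.mul_assoc, sigAt_mul_matAS_eq_toeplitzDet h.commute hi.le,
    sigAt_mul_matAS_eq_toeplitzDet (h.commute.mul_left hA) hi.le,
    cornerSeq_mul_one_add_smul h.commute, mul_left_comm,
    (h.todaGen_mul_toeplitzDet_cornerSeq t hi.le).2 hi]

theorem todaGen_last (h : IsTodaPoint Z z Q) (hQn : Q n = 0) (t : S) :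
    todaGen z Q t n = ∑ j ∈ Finset.range (n + 1), t ^ j * algebraMap (RT n) S (elemSym n n j) := by
  refine (h.isUnit_sig n le_rfl).mul_right_cancel ?_
  have hupdate := h.todaGen_update_mul_sigAt t le_rfl
  rw [← hQn, Function.update_eq_self] at hupdate
  rw [hupdate, ← det_one_add_smul_matAS, sigAt, sigAt, leadingMinor_self, leadingMinor_self,
    det_mul, det_mul, det_mul]
  ring

theorem todaHamiltonian_last (h : IsTodaPoint Z z Q) (hQn : Q n = 0) {m : ℕ} (hm : m ≤ n) :
    todaHamiltonian z Q n m = algebraMap (RT n) S (elemSym n n m) := by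
  have hcoeff (c : ℕ → S) : (∑ j ∈ Finset.range (n + 1),
      (Polynomial.X : Polynomial S) ^ j * Polynomial.C (c j)).coeff m = c m := by
    simp_rw [Polynomial.finsetSum_coeff, Polynomial.X_pow_mul_C, Polynomial.coeff_C_mul_X_pow]
    rw [Finset.sum_ite_eq, if_pos (Finset.mem_range_succ_iff.2 hm)]
  have hX := (h.map (Polynomial.CAlgHom (R := RT n))).todaGen_last (by rw [hQn, map_zero])
    Polynomial.X
  have hC (j : ℕ) : todaHamiltonian (fun i => Polynomial.CAlgHom (R := RT n) (z i))
      (fun i => Polynomial.CAlgHom (R := RT n) (Q i)) n j =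
        Polynomial.C (todaHamiltonian z Q n j) := (map_todaHamiltonian Polynomial.C z Q n j).symm
  simp only [todaGen, hC, Polynomial.algebraMap_apply] at hX
  rw [← hcoeff fun j => todaHamiltonian z Q n j, hX]
  exact hcoeff fun j => algebraMap (RT n) S (elemSym n n j)

end IsTodaPoint

end TodaPoint

/-! ### The homomorphism `Φ` -/

section Phi

variable {n : ℕ}

theorem fracZ_mul (x y : OZ n) (hy : y ∈ tauSet n) :
    fracZ x y hy * algebraMap (OZ n) (OZo n) y = algebraMap (OZ n) (OZo n) x := by
  rw [fracZ, Localization.mk_eq_mk']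
  exact IsLocalization.mk'_spec (OZo n) x ⟨y, hy⟩

theorem isUnit_algebraMap_OZo {y : OZ n} (hy : y ∈ tauSet n) :
    IsUnit (algebraMap (OZ n) (OZo n) y) :=
  IsLocalization.map_units (M := tauSet n) (OZo n) ⟨y, hy⟩

theorem matAZ_eq : matAZ n = matAS n (OZ n) := rfl

theorem sig_eq_sigAt (i : ℕ) : sig n i = sigAt (matZ n) i := rfl

theorem tau_eq_sigAt (i : ℕ) : tau n i = sigAt (matZ n * matAS n (OZ n)) i := rfl

variable (n) in
/-- The localization map `𝒪(𝒵̃) → 𝒪(𝒵̃)[τ_i⁻¹, σ_i⁻¹]` as a homomorphism of `R(T)`-algebras. -/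
def toOZo : OZ n →ₐ[RT n] OZo n := IsScalarTower.toAlgHom (RT n) (OZ n) (OZo n)

theorem toOZo_sig (i : ℕ) :
    toOZo n (sig n i) = sigAt ((matZ n).map (toOZo n)) i := map_sigAt _ _ i

theorem toOZo_tau (i : ℕ) :
    toOZo n (tau n i) = sigAt ((matZ n).map (toOZo n) * matAS n (OZo n)) i := by
  rw [tau_eq_sigAt, map_sigAt, Matrix.map_mul, map_matAS]

variable (n) in
/-- The image `τ_i σ_{i-1} / (σ_i τ_{i-1})` of `z_i` under `Φ`. -/
def zImg (i : ℕ) : OZo n :=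
  fracZ (tau n i * sig n (i - 1)) (sig n i * tau n (i - 1))
    (mul_mem (sig_mem n i) (tau_mem n (i - 1)))

variable (n) in
/-- The image `τ_{i-1} τ_{i+1} / τ_i²` of `Q_i` under `Φ`. -/
def QImg (i : ℕ) : OZo n :=
  fracZ (tau n (i - 1) * tau n (i + 1)) (tau n i ^ 2) (pow_mem (tau_mem n i) 2)

theorem QImg_succ_mul (i : ℕ) : QImg n (i + 1) * toOZo n (tau n (i + 1)) ^ 2 =
    toOZo n (tau n i) * toOZo n (tau n (i + 2)) := by
  rw [← map_mul, ← map_pow]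
  exact fracZ_mul _ _ _

theorem isTodaPoint_matZ {z Q : ℕ → OZo n} (hz : ∀ i, 1 ≤ i → i ≤ n → z i = zImg n i)
    (hQ : ∀ i, 1 ≤ i → i ≤ n - 1 → Q i = QImg n i) :
    IsTodaPoint ((matZ n).map (toOZo n)) z Q where
  commute := by
    have hcomm := congrArg (Matrix.map · (toOZo n)) (matZ_comm n)
    simp only [Matrix.map_mul, matAZ_eq, map_matAS] at hcomm
    exact hcomm.symm
  isUnit_sig i _ := toOZo_sig (n := n) i ▸ isUnit_algebraMap_OZo (sig_mem n i)
  isUnit_tau i _ := toOZo_tau (n := n) i ▸ isUnit_algebraMap_OZo (tau_mem n i)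
  z_mul i hi := by
    rw [← toOZo_sig, ← toOZo_sig, ← toOZo_tau, ← toOZo_tau, ← map_mul, ← map_mul,
      hz _ i.succ_pos hi]
    exact fracZ_mul _ _ _
  Q_mul i hi := by
    rw [← toOZo_tau, ← toOZo_tau, ← toOZo_tau, hQ _ i.succ_pos (by omega), QImg_succ_mul]

variable (n) in
/-- The homomorphism `R(T)[z, Q] → 𝒪(𝒵̃)[τ_i⁻¹, σ_i⁻¹]` from which `Φ` descends. -/
def evalY : PolyY n →ₐ[RT n] OZo n :=
  MvPolynomial.aeval (Sum.elim (fun k => zImg n (k + 1)) (fun k => QImg n (k + 1)))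

theorem evalY_polyz {i : ℕ} (h1 : 1 ≤ i) (h2 : i ≤ n) : evalY n (polyz n i) = zImg n i := by
  rw [polyz, dif_pos ⟨h1, h2⟩, evalY, MvPolynomial.aeval_X, Sum.elim_inl, Nat.sub_add_cancel h1]

theorem evalY_polyQ {i : ℕ} (h1 : 1 ≤ i) (h2 : i ≤ n - 1) : evalY n (polyQ n i) = QImg n i := by
  rw [polyQ, dif_pos ⟨h1, h2⟩, evalY, MvPolynomial.aeval_X, Sum.elim_inr, Nat.sub_add_cancel h1]

theorem polyQ_self : polyQ n n = 0 := dif_neg (by omega)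

theorem map_polyF {S : Type*} [CommRing S] [Algebra (RT n) S] (e : PolyY n →ₐ[RT n] S)
    (i m : ℕ) : e (polyF n i m) =
      todaHamiltonian (fun j => e (polyz n j)) (fun j => e (polyQ n j)) i m :=
  map_todaHamiltonian (e : PolyY n →+* S) (polyz n) (polyQ n) i m

theorem one_sub_eta {i : ℕ} (hi : i ≤ n) :
    1 - eta n (n - i) = expW (wt n ((i + 1 : ℕ) : ZMod n)) := by
  rw [eta, sub_sub_cancel, Nat.sub_sub_self hi]

theorem map_psi {S : Type*} [CommRing S] [Algebra (RT n) S] (e : PolyY n →ₐ[RT n] S)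
    {i : ℕ} (hi : i ≤ n) : e (psi n i) =
      todaGen (fun j => e (polyz n j)) (fun j => e (polyQ n j))
        (algebraMap (RT n) S (-expW (wt n ((i + 1 : ℕ) : ZMod n)))) i := by
  rw [psi, map_sum, todaGen]
  refine Finset.sum_congr rfl fun j _ => ?_
  rw [map_mul, map_polyF, one_sub_eta hi, map_mul, map_pow, map_neg, map_one,
    ← MvPolynomial.algebraMap_eq, AlgHom.commutes, map_pow, ← mul_pow, neg_one_mul, map_neg]

theorem evalY_eq_zero_of_mem_idealY [NeZero n] {f : PolyY n} (hf : f ∈ idealY n) :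
    evalY n f = 0 := by
  have hle : idealY n ≤ RingHom.ker (evalY n) := by
    rw [idealY, Ideal.span_le]
    rintro _ ⟨i, -, hi, rfl⟩
    have hpoint := isTodaPoint_matZ (fun _ => evalY_polyz) (fun _ => evalY_polyQ (n := n))
    rw [SetLike.mem_coe, RingHom.mem_ker, map_sub, map_polyF,
      hpoint.todaHamiltonian_last (by rw [polyQ_self, map_zero]) hi, sub_eq_zero]
    exact ((evalY n).commutes _).symm
  exact hle hf

theorem isUnit_QImg_succ (i : ℕ) : IsUnit (QImg n (i + 1)) := by
  refine isUnit_of_mul_isUnit_left (y := toOZo n (tau n (i + 1)) ^ 2) ?_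
  rw [QImg_succ_mul]
  exact (isUnit_algebraMap_OZo (tau_mem n _)).mul (isUnit_algebraMap_OZo (tau_mem n _))

variable (n) in
/-- The homomorphism `𝒪(𝒴) → 𝒪(𝒵̃)[τ_i⁻¹, σ_i⁻¹]` induced by `evalY`. -/
def evalOY [NeZero n] : OY n →ₐ[RT n] OZo n :=
  Ideal.Quotient.liftₐ (idealY n) (evalY n) fun _ => evalY_eq_zero_of_mem_idealY

theorem isUnit_evalOY [NeZero n] (y : Submonoid.closure {q : OY n | ∃ j, 1 ≤ j ∧ j ≤ n - 1 ∧
    q = mkY n (polyQ n j)}) : IsUnit (evalOY n y) := by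
  suffices hle : Submonoid.closure {q : OY n | ∃ j, 1 ≤ j ∧ j ≤ n - 1 ∧ q = mkY n (polyQ n j)} ≤
      (IsUnit.submonoid (OZo n)).comap (evalOY n : OY n →* OZo n) from hle y.2
  rw [Submonoid.closure_le]
  rintro _ ⟨j, h1, h2, rfl⟩
  obtain ⟨i, rfl⟩ := Nat.exists_eq_add_of_le' h1
  change IsUnit (evalY n (polyQ n (i + 1)))
  rw [evalY_polyQ h1 h2]
  exact isUnit_QImg_succ i

theorem exists_isPhi (n : ℕ) [NeZero n] : ∃ Φ : OYo n →ₐ[RT n] OZo n, IsPhi Φ := by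
  let Φ : OYo n →ₐ[RT n] OZo n := IsLocalization.liftAlgHom isUnit_evalOY
  have hΦ (f : PolyY n) : Φ (clsY f) = evalY n f := IsLocalization.lift_eq isUnit_evalOY _
  exact ⟨Φ, fun i h1 h2 => (hΦ _).trans (evalY_polyz h1 h2),
    fun i h1 h2 => (hΦ _).trans (evalY_polyQ h1 h2)⟩

variable (n) in
/-- The composite `R(T)[z, Q] → 𝒪(𝒴) → 𝒪(𝒴°)` as a homomorphism of `R(T)`-algebras. -/
def clsHom : PolyY n →ₐ[RT n] OYo n := (IsScalarTower.toAlgHom (RT n) (OY n) (OYo n)).comp (mkY n)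

theorem IsPhi.unique {Φ Φ' : OYo n →ₐ[RT n] OZo n} (h : IsPhi Φ) (h' : IsPhi Φ') : Φ' = Φ := by
  have hpoly : Φ'.comp (clsHom n) = Φ.comp (clsHom n) := by
    refine MvPolynomial.algHom_ext ?_
    rintro (k | k)
    · have hk : (MvPolynomial.X (Sum.inl k) : PolyY n) = polyz n (k.val + 1) := by
        rw [polyz, dif_pos ⟨by omega, k.2⟩]
        rfl
      rw [hk]
      exact (h'.1 _ (by omega) k.2).trans (h.1 _ (by omega) k.2).symm
    · have hk : (MvPolynomial.X (Sum.inr k) : PolyY n) = polyQ n (k.val + 1) := by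
        rw [polyQ, dif_pos ⟨by omega, k.2⟩]
        rfl
      rw [hk]
      exact (h'.2 _ (by omega) k.2).trans (h.2 _ (by omega) k.2).symm
  refine IsLocalization.algHom_ext (Submonoid.closure {q : OY n | ∃ j, 1 ≤ j ∧ j ≤ n - 1 ∧
      q = mkY n (polyQ n j)}) ?_
  ext x
  obtain ⟨f, rfl⟩ := Ideal.Quotient.mkₐ_surjective (RT n) (idealY n) x
  exact DFunLike.congr_fun hpoly f

/-! ### The image of `ψ_i` as a leading minor -/

variable (n) in
/-- `betaSigmaLoc` as a homomorphism of `R(T)`-algebras. -/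
def betaSigmaLocAlg : OZo n →ₐ[RT n] Lam n :=
  IsLocalization.liftAlgHom (M := tauSet n) (f := betaSigma n) (isUnit_betaSigma n)

theorem betaSigmaLocAlg_toOZo (x : OZ n) : betaSigmaLocAlg n (toOZo n x) = betaSigma n x :=
  IsLocalization.lift_eq (isUnit_betaSigma n) x

theorem matZ_map_betaSigma_mul_matAS :
    (matZ n).map (betaSigma n) * matAS n (Lam n) = betaZ n := by
  have hcancel : (matZ n * (matAZ n)⁻¹) * matAZ n = matZ n := by
    rw [Matrix.mul_assoc, nonsing_inv_mul _ (isUnit_det_matAZ n), Matrix.mul_one]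
  calc (matZ n).map (betaSigma n) * matAS n (Lam n)
      = ((matZ n).map (sigmaHom n)).map (beta n) * (matAZ n).map (beta n) := by
        rw [Matrix.map_map, matAZ_eq, map_matAS]
        rfl
    _ = betaZ n := by rw [sigmaHom_matZ, ← Matrix.map_mul, hcancel, beta_matZ]

theorem beta_sig (i : ℕ) : beta n (sig n i) = sigAt (betaZ n) i := by
  rw [sig_eq_sigAt, map_sigAt, beta_matZ]

theorem PhiTilde_psi_mul_beta_sig [NeZero n] {Φ : OYo n →ₐ[RT n] OZo n} (hΦ : IsPhi Φ) {i : ℕ}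
    (hi : i < n) : PhiTilde Φ (clsY (psi n i)) * beta n (sig n i) =
      sigAt (betaZ n * (1 + algebraMap (RT n) (Lam n)
        (-expW (wt n ((i + 1 : ℕ) : ZMod n))) • matAS n (Lam n))) i := by
  have hpoint := (isTodaPoint_matZ (z := fun j => Φ (clsY (polyz n j)))
    (Q := fun j => Φ (clsY (polyQ n j))) hΦ.1 hΦ.2).map (betaSigmaLocAlg n)
  have hZ : ((matZ n).map (toOZo n)).map (betaSigmaLocAlg n) = (matZ n).map (betaSigma n) := by
    ext a b
    exact congrArg _ (betaSigmaLocAlg_toOZo (matZ n a b))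
  rw [hZ] at hpoint
  rw [beta_sig, ← matZ_map_betaSigma_mul_matAS, ← hpoint.todaGen_mul_sigAt _ hi]
  exact congrArg (· * _) (map_psi ((betaSigmaLocAlg n).comp (Φ.comp (clsHom n))) hi.le)

end Phi

/-! ### Bialternants -/

section Bialternant

theorem det_vandermonde_succ {R : Type*} [CommRing R] {N : ℕ} (x : Fin (N + 1) → R) :
    (vandermonde x).det = (∏ l, (x (Fin.succ l) - x 0)) * (vandermonde (x ∘ Fin.succ)).det := by
  rw [det_vandermonde, det_vandermonde, Fin.prod_univ_succ, Fin.prod_Ioi_zero]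
  simp_rw [Fin.prod_Ioi_succ]
  rfl

theorem det_vandermonde_succAbove {R : Type*} [CommRing R] {N : ℕ} (x : Fin (N + 1) → R)
    (k : Fin (N + 1)) :
    (vandermonde x).det = (-1) ^ (k : ℕ) * (∏ l, (x (k.succAbove l) - x k)) *
      (vandermonde (x ∘ k.succAbove)).det := by
  have hperm : (vandermonde (x ∘ k.cycleRange.symm)).det =
      (-1) ^ (k : ℕ) * (vandermonde x).det := by
    rw [show vandermonde (x ∘ k.cycleRange.symm) =
      (vandermonde x).submatrix k.cycleRange.symm id from rfl, det_permute, Equiv.Perm.sign_symm,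
      Fin.sign_cycleRange]
    push_cast
    rfl
  have hsucc : (x ∘ k.cycleRange.symm) ∘ Fin.succ = x ∘ k.succAbove := by
    funext l
    simp
  rw [det_vandermonde_succ, hsucc] at hperm
  simp only [Function.comp_apply, Fin.cycleRange_symm_succ, Fin.cycleRange_symm_zero] at hperm
  rw [mul_assoc, hperm, ← mul_assoc, ← mul_pow, neg_one_mul, neg_neg, one_pow, one_mul]

theorem det_eq_mul_det_of_geometric_first_column {R : Type*} [CommRing R] {N : ℕ}
    {M : Matrix (Fin (N + 1)) (Fin (N + 1)) R} {i : Fin (N + 1)} {c : R}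
    (hlt : ∀ j < i, M j 0 = 0)
    (hge : ∀ j : Fin N, i ≤ j.castSucc → M j.succ 0 = c * M j.castSucc 0) :
    M.det = (-1) ^ (i : ℕ) * M i 0 * (of fun j l : Fin N => if j.castSucc < i then
      M j.castSucc l.succ else M j.succ l.succ - c * M j.castSucc l.succ).det := by
  set B : Matrix (Fin (N + 1)) (Fin (N + 1)) R := of (Fin.cons (M 0) fun j k =>
    M j.succ k - (if i ≤ j.castSucc then c else 0) * M j.castSucc k) with hB
  have hdet : M.det = B.det :=
    det_eq_of_forall_row_eq_smul_add_pred (fun j => if i ≤ j.castSucc then c else 0)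
      (fun _ => rfl) (fun j k => by simp [hB])
  have hBle (j : Fin (N + 1)) (hj : j ≤ i) (k : Fin (N + 1)) : B j k = M j k := by
    cases j using Fin.cases with
    | zero => rfl
    | succ j => simp [hB, (Fin.castSucc_lt_iff_succ_le.2 hj).not_ge]
  have hBgt (j : Fin N) (hj : i ≤ j.castSucc) (k : Fin (N + 1)) :
      B j.succ k = M j.succ k - c * M j.castSucc k := by simp [hB, hj]
  have hminor : B.submatrix i.succAbove Fin.succ = of fun j l : Fin N => if j.castSucc < i then
      M j.castSucc l.succ else M j.succ l.succ - c * M j.castSucc l.succ := by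
    ext j l
    rw [submatrix_apply, of_apply]
    split_ifs with hj
    · rw [Fin.succAbove_of_castSucc_lt _ _ hj, hBle _ hj.le]
    · rw [Fin.succAbove_of_le_castSucc _ _ (not_lt.1 hj), hBgt _ (not_lt.1 hj)]
  rw [hdet, det_succ_column_zero, Finset.sum_eq_single i, hBle i le_rfl, hminor]
  · intro j _ hj
    rcases hj.lt_or_gt with hj | hj
    · rw [hBle j hj.le, hlt j hj, mul_zero, zero_mul]
    · obtain ⟨j, rfl⟩ := Fin.exists_succ_eq.2 (Fin.ne_zero_of_lt hj)
      have hij : i ≤ j.castSucc := Fin.le_castSucc_iff.2 hj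
      rw [hBgt j hij, hge j hij, sub_self, mul_zero, zero_mul]
  · exact fun hi => absurd (Finset.mem_univ i) hi

variable {K L : Type*} [Field K] [CommRing L] [Algebra K L] {N : ℕ}

/-- The generalized alternant matrix, with rows `ω_k x_k^j` for `j < r` and `x_k^j` for `j ≥ r`. -/
def altMat (r : ℕ) (x : Fin N → K) (ω : Fin N → L) : Matrix (Fin N) (Fin N) L :=
  of fun j k => x k ^ (j : ℕ) • (if j.val < r then ω k else 1)

/-- The bialternant: the quotient of `det (altMat r x ω)` by the Vandermonde determinant. -/
def bialt (r : ℕ) (x : Fin N → K) (ω : Fin N → L) : L :=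
  (vandermonde x).det⁻¹ • (altMat r x ω).det

theorem bialt_zero {x : Fin N → K} (hx : Function.Injective x) (ω : Fin N → L) :
    bialt 0 x ω = 1 := by
  have halt : altMat 0 x ω = ((vandermonde x).map (algebraMap K L))ᵀ := by
    ext j k
    simp [altMat, vandermonde_apply, Algebra.smul_def]
  rw [bialt, halt, det_transpose, ← RingHom.mapMatrix_apply, ← RingHom.map_det, Algebra.smul_def,
    ← map_mul, inv_mul_cancel₀ (det_vandermonde_ne_zero_iff.2 hx), map_one]

theorem bialt_comp_perm (r : ℕ) (x : Fin N → K) (ω : Fin N → L) (σ : Equiv.Perm (Fin N)) :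
    bialt r (x ∘ σ) (ω ∘ σ) = bialt r x ω := by
  rw [bialt, bialt, show altMat r (x ∘ σ) (ω ∘ σ) = (altMat r x ω).submatrix id σ from rfl,
    show vandermonde (x ∘ σ) = (vandermonde x).submatrix σ id from rfl, det_permute', det_permute]
  rcases Int.units_eq_one_or (Equiv.Perm.sign σ) with h | h <;> simp [h, inv_neg]

theorem altMat_succ_submatrix_succ (r : ℕ) (x : Fin (N + 1) → K) (ω : Fin (N + 1) → L)
    (f : Fin N → Fin (N + 1)) : ((altMat (r + 1) x ω).submatrix Fin.succ f).det =
      (∏ l, x (f l)) • (altMat r (x ∘ f) (ω ∘ f)).det := by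
  have hscale : (altMat (r + 1) x ω).submatrix Fin.succ f =
      of fun j l => algebraMap K L (x (f l)) * altMat r (x ∘ f) (ω ∘ f) j l := by
    ext j l
    simp only [submatrix_apply, altMat, of_apply, Fin.val_succ, add_lt_add_iff_right,
      Function.comp_apply, ← Algebra.smul_def, smul_smul, pow_succ']
  rw [hscale, det_mul_row, ← map_prod, ← Algebra.smul_def]

/-- Adding multiples of the other rows to row `0`, whose entries are `ω_k`, turns it into
`q(x_k) ω_k`; then expand along it. -/
theorem det_altMat_succ {r : ℕ} (hr : r ≤ N) (x : Fin (N + 1) → K) (ω : Fin (N + 1) → L)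
    {q : Polynomial K} (hq : q.natDegree ≤ r) (hq0 : q.coeff 0 = 1) :
    (altMat (r + 1) x ω).det = ∑ k : Fin (N + 1),
      ((-1) ^ (k : ℕ) * q.eval (x k) * ∏ l, x (k.succAbove l)) • (ω k *
        (altMat r (x ∘ k.succAbove) (ω ∘ k.succAbove)).det) := by
  set c : Fin (N + 1) → L := fun j => algebraMap K L (q.coeff j) with hc
  have hrow (k : Fin (N + 1)) :
      (∑ j, c j • (altMat (r + 1) x ω) j) k = q.eval (x k) • ω k := by
    rw [Finset.sum_apply, Polynomial.eval_eq_sum_range' (n := N + 1) (by omega), Finset.sum_smul,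
      Finset.sum_range]
    refine Finset.sum_congr rfl fun j _ => ?_
    simp only [Pi.smul_apply, hc, altMat, of_apply, smul_eq_mul]
    by_cases hj : j.val < r + 1
    · rw [if_pos hj, ← Algebra.smul_def, smul_smul]
    · rw [Polynomial.coeff_eq_zero_of_natDegree_lt (by omega), map_zero, zero_mul, zero_mul,
        zero_smul]
  have hdet : (altMat (r + 1) x ω).det =
      ((altMat (r + 1) x ω).updateRow 0 (∑ j, c j • (altMat (r + 1) x ω) j)).det := by
    rw [det_updateRow_sum]
    simp [hc, hq0]
  rw [hdet, det_succ_row_zero]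
  refine Finset.sum_congr rfl fun k _ => ?_
  have hminor (v : Fin (N + 1) → L) : ((altMat (r + 1) x ω).updateRow 0 v).submatrix Fin.succ
      k.succAbove = (altMat (r + 1) x ω).submatrix Fin.succ k.succAbove := by
    ext j l
    rw [submatrix_apply, updateRow_ne (Fin.succ_ne_zero j), submatrix_apply]
  rw [updateRow_self, hrow, hminor, altMat_succ_submatrix_succ]
  simp only [Algebra.smul_def, map_mul, map_pow, map_neg, map_one]
  ring

theorem bialt_succ {r : ℕ} (hr : r ≤ N) {x : Fin (N + 1) → K} (hx : Function.Injective x)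
    (ω : Fin (N + 1) → L) {q : Polynomial K} (hq : q.natDegree ≤ r) (hq0 : q.coeff 0 = 1) :
    bialt (r + 1) x ω = ∑ k, (q.eval (x k) *
      ∏ l, (x (k.succAbove l) / (x (k.succAbove l) - x k))) •
        (ω k * bialt r (x ∘ k.succAbove) (ω ∘ k.succAbove)) := by
  rw [bialt, det_altMat_succ hr x ω hq hq0, Finset.smul_sum]
  refine Finset.sum_congr rfl fun k _ => ?_
  have hne : ∏ l, (x (k.succAbove l) - x k) ≠ 0 :=
    Finset.prod_ne_zero_iff.2 fun l _ => sub_ne_zero.2 fun h => Fin.succAbove_ne k l (hx h)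
  have hV : (vandermonde (x ∘ k.succAbove)).det ≠ 0 :=
    det_vandermonde_ne_zero_iff.2 (hx.comp Fin.succAbove_right_injective)
  have hsign : (-1 : K) ^ (k : ℕ) ≠ 0 := pow_ne_zero _ (neg_ne_zero.2 one_ne_zero)
  rw [bialt, det_vandermonde_succAbove x k, Finset.prod_div_distrib, mul_smul_comm, smul_smul,
    smul_smul]
  congr 1
  field_simp

theorem altMat_one_sub_div_smul_reduced (i : ℕ) {x : Fin (N + 1) → K} (hx0 : x 0 ≠ 0)
    (ω : Fin (N + 1) → L) (j l : Fin N) :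
    (if j.val < i then altMat i x (fun k => (1 - x k / x 0) • ω k) j.castSucc l.succ else
      altMat i x (fun k => (1 - x k / x 0) • ω k) j.succ l.succ - algebraMap K L (x 0) *
        altMat i x (fun k => (1 - x k / x 0) • ω k) j.castSucc l.succ) =
      algebraMap K L (if j.val < i then -(x 0)⁻¹ else 1) * (algebraMap K L (x l.succ - x 0) *
        altMat i (x ∘ Fin.succ) (ω ∘ Fin.succ) j l) := by
  simp only [of_apply, altMat, Function.comp_apply, Fin.val_castSucc, Fin.val_succ]
  by_cases hj : j.val < i
  · simp only [if_pos hj, ← Algebra.smul_def, smul_smul]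
    congr 1
    field_simp
    ring
  · simp only [if_neg hj, if_neg (show ¬ j.val + 1 < i by omega), ← Algebra.smul_def, smul_smul,
      ← sub_smul]
    congr 1
    ring

/-- The factor `1 - x_k / x_0` makes the first column `(0, …, 0, x_0^i, …, x_0^N)`. -/
theorem det_altMat_one_sub_div_smul {i : ℕ} (hi : i ≤ N) {x : Fin (N + 1) → K}
    (hx : Function.Injective x) (hx0 : x 0 ≠ 0) (ω : Fin (N + 1) → L) :
    (altMat i x (fun k => (1 - x k / x 0) • ω k)).det =
      (vandermonde x).det • bialt i (x ∘ Fin.succ) (ω ∘ Fin.succ) := by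
  have hV : (vandermonde (x ∘ Fin.succ)).det ≠ 0 :=
    det_vandermonde_ne_zero_iff.2 (hx.comp (Fin.succ_injective N))
  have hrows : ∏ j : Fin N, (if j.val < i then -(x 0)⁻¹ else 1) = (-(x 0)⁻¹) ^ i := by
    rw [Finset.prod_ite, Finset.prod_const_one, mul_one, Finset.prod_const,
      Fin.card_filter_val_lt, min_eq_right hi]
  have hinner : (of fun j l : Fin N => if j.castSucc < ⟨i, by omega⟩ then
      altMat i x (fun k => (1 - x k / x 0) • ω k) j.castSucc l.succ else
        altMat i x (fun k => (1 - x k / x 0) • ω k) j.succ l.succ - algebraMap K L (x 0) *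
          altMat i x (fun k => (1 - x k / x 0) • ω k) j.castSucc l.succ) =
      of fun j l : Fin N => algebraMap K L (if j.val < i then -(x 0)⁻¹ else 1) *
        (of fun j l : Fin N => algebraMap K L (x l.succ - x 0) *
          altMat i (x ∘ Fin.succ) (ω ∘ Fin.succ) j l) j l := by
    ext j l
    exact altMat_one_sub_div_smul_reduced i hx0 ω j l
  rw [det_eq_mul_det_of_geometric_first_column (i := ⟨i, by omega⟩) (c := algebraMap K L (x 0)),
    hinner, det_mul_column, det_mul_row, ← map_prod, ← map_prod, hrows, det_vandermonde_succ,
    bialt, smul_smul, mul_assoc (∏ l, _), mul_inv_cancel₀ hV, mul_one]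
  · have hsign : (-1 : K) ^ i * x 0 ^ i * (-(x 0)⁻¹) ^ i = 1 := by
      rw [← mul_pow, ← mul_pow, neg_one_mul, neg_mul_neg, mul_inv_cancel₀ hx0, one_pow]
    simp only [altMat, of_apply, lt_irrefl, if_false, Algebra.smul_def, mul_one]
    rw [← mul_assoc, ← mul_assoc]
    congr 1
    rw [← map_one (algebraMap K L), ← map_neg, ← map_pow, ← map_mul, ← map_mul, hsign, map_one,
      one_mul]
  · intro j hj
    rw [altMat, of_apply, if_pos (show j.val < i from hj), div_self hx0, sub_self, zero_smul,
      smul_zero]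
  · intro j hj
    have hij : i ≤ j.val := hj
    simp only [altMat, of_apply, Fin.val_succ, Fin.val_castSucc, if_neg hij.not_gt,
      if_neg (show ¬ j.val + 1 < i by omega)]
    rw [pow_succ', mul_smul, Algebra.smul_def]

end Bialternant

/-! ### Diagonalization of the centralizer family -/

section PartialProduct

variable {n : ℕ} {R : Type*} [CommRing R]

theorem det_fill_one_eq_leadingMinor (M : Matrix (Fin n) (Fin n) R) (i : ℕ) :
    (of fun a b : Fin n => if a.val < i then M a b else (1 : Matrix (Fin n) (Fin n) R) a b).det =
      leadingMinor M i := by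
  rw [twoBlockTriangular_det _ (fun r => r.val < i)]
  · have hleading : toSquareBlockProp (of fun a b : Fin n => if a.val < i then M a b else
        (1 : Matrix (Fin n) (Fin n) R) a b) (fun r => r.val < i) =
        M.submatrix (Subtype.val : {r : Fin n // r.val < i} → Fin n) Subtype.val := by
      ext a b
      rw [toSquareBlockProp, toBlock_apply, of_apply, if_pos a.2, submatrix_apply]
    have htail : toSquareBlockProp (of fun a b : Fin n => if a.val < i then M a b else
        (1 : Matrix (Fin n) (Fin n) R) a b) (fun r => ¬ r.val < i) = 1 := by
      ext a b
      simp only [toSquareBlockProp, toBlock_apply, of_apply, if_neg a.2, one_apply,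
        Subtype.ext_iff]
    rw [hleading, htail, det_one, mul_one, leadingMinor]
  · intro a ha b hb
    rw [of_apply, if_neg ha, one_apply_ne (ne_of_apply_ne Fin.val (by omega))]

theorem leadingMinor_mul_det (M V : Matrix (Fin n) (Fin n) R) (i : ℕ) :
    leadingMinor M i * V.det =
      (of fun a k : Fin n => if a.val < i then (M * V) a k else V a k).det := by
  rw [← det_fill_one_eq_leadingMinor, ← det_mul]
  congr 1
  ext a k
  rw [mul_apply, of_apply]
  split_ifs with ha
  · simp only [of_apply, if_pos ha, mul_apply]
  · simp [ha, one_apply]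

end PartialProduct

section Diagonalization

variable {n : ℕ}

/-- The eigenvalues `-e^{-a_i}` of `-A`. -/
def xi (i : ZMod n) : KT n := -expK (-wt n i)

theorem xi_injective : Function.Injective (xi : ZMod n → KT n) := fun _ _ h =>
  expK_neg_wt_injective (neg_injective h)

theorem expK_mul_expK_neg (μ : Weight n) : expK μ * expK (-μ) = 1 := by
  rw [← expK_add, add_neg_cancel, expK_zero]

theorem xi_ne_zero (i : ZMod n) : xi i ≠ 0 :=
  neg_ne_zero.2 (right_ne_zero_of_mul_eq_one (expK_mul_expK_neg _))

theorem ix_injective : Function.Injective (ix : Fin n → ZMod n) := by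
  intro a b h
  simp only [ix, Nat.cast_add, Nat.cast_one] at h
  have hcast := add_right_cancel h
  rw [ZMod.natCast_eq_natCast_iff', Nat.mod_eq_of_lt a.2, Nat.mod_eq_of_lt b.2] at hcast
  exact Fin.ext hcast

theorem algebraMap_expW_neg_wt (i : ZMod n) :
    algebraMap (RT n) (Lam n) (expW (-wt n i)) = -algebraMap (KT n) (Lam n) (xi i) := by
  rw [IsScalarTower.algebraMap_apply (RT n) (KT n) (Lam n), xi, map_neg, neg_neg]
  rfl

variable (n) in
/-- The matrix whose columns are the eigenvectors of `A`, normalized to have first entry `1`. -/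
def eigMat : Matrix (Fin n) (Fin n) (Lam n) := of fun j k =>
  algebraMap (KT n) (Lam n) (∏ l ∈ Finset.range j.val, (xi (ix k) - xi ((l + 1 : ℕ) : ZMod n)))

theorem eigMat_isUpperTriangular : (eigMat n).IsUpperTriangular := fun j k (hkj : k < j) => by
  rw [eigMat, of_apply, Finset.prod_eq_zero (Finset.mem_range.2 hkj) (sub_self _), map_zero]

theorem isUnit_eigMat_self (k : Fin n) : IsUnit (eigMat n k k) := by
  refine (isUnit_iff_ne_zero.2 (Finset.prod_ne_zero_iff.2 fun l hl => ?_)).map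
    (algebraMap (KT n) (Lam n))
  have hlk := Finset.mem_range.1 hl
  exact sub_ne_zero.2 fun h =>
    hlk.ne' (congrArg Fin.val (@ix_injective n k ⟨l, by omega⟩ (xi_injective h)))

theorem eigMat_succ {j : ℕ} (hj : j + 1 < n) (k : Fin n) :
    eigMat n ⟨j + 1, hj⟩ k = eigMat n ⟨j, by omega⟩ k *
      (algebraMap (KT n) (Lam n) (xi (ix k)) -
        algebraMap (KT n) (Lam n) (xi (ix (⟨j, by omega⟩ : Fin n)))) := by
  rw [eigMat, of_apply, Finset.prod_range_succ, map_mul, map_sub]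
  rfl

theorem matAS_mul_eigMat : matAS n (Lam n) * eigMat n =
    eigMat n * diagonal fun k => -algebraMap (KT n) (Lam n) (xi (ix k)) := by
  ext1 j k
  rw [mul_diagonal, matAS_mul_apply, algebraMap_expW_neg_wt]
  split_ifs with h
  · rw [eigMat_succ h]
    ring
  · have hlast : eigMat n j k * (algebraMap (KT n) (Lam n) (xi (ix k)) -
        algebraMap (KT n) (Lam n) (xi (ix j))) = 0 := by
      rcases eq_or_ne k j with rfl | hkj
      · rw [sub_self, mul_zero]
      · rw [eigMat_isUpperTriangular (show k < j by omega), zero_mul]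
    linear_combination hlast

theorem apply_eq_apply_zero_mul_eigMat [NeZero n] {M : Matrix (Fin n) (Fin n) (Lam n)}
    (hM : matAS n (Lam n) * M = M * diagonal fun k => -algebraMap (KT n) (Lam n) (xi (ix k)))
    (j k : Fin n) : M j k = M 0 k * eigMat n j k := by
  obtain ⟨j, hj⟩ := j
  induction j with
  | zero => rw [show (⟨0, hj⟩ : Fin n) = 0 from rfl]; simp [eigMat]
  | succ j ih =>
    have hentry := congrFun (congrFun hM ⟨j, by omega⟩) k
    rw [mul_diagonal, matAS_mul_apply, algebraMap_expW_neg_wt, dif_pos hj, ih (by omega)] at hentry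
    rw [eigMat_succ hj]
    linear_combination -hentry

theorem betaZ_mul_eigMat [NeZero n] :
    betaZ n * eigMat n = eigMat n * diagonal fun k => Om (ix k) := by
  have heig (j k : Fin n) :
      (betaZ n * eigMat n) j k = (betaZ n * eigMat n) 0 k * eigMat n j k := by
    refine apply_eq_apply_zero_mul_eigMat ?_ j k
    rw [← Matrix.mul_assoc, matAS, betaZ_comm, Matrix.mul_assoc, ← matAS, matAS_mul_eigMat,
      Matrix.mul_assoc]
  have hdiag (k : Fin n) : (betaZ n * eigMat n) k k = Om (ix k) * eigMat n k k := by
    rw [mul_apply, Finset.sum_eq_single k, betaZ_diag]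
    · intro b _ hb
      rcases lt_or_gt_of_ne hb with hbk | hkb
      · rw [betaZ_lower hbk, zero_mul]
      · rw [eigMat_isUpperTriangular hkb, mul_zero]
    · exact fun hk => absurd (Finset.mem_univ k) hk
  ext1 j k
  rw [mul_diagonal, heig, (isUnit_eigMat_self k).mul_right_cancel ((heig k k).symm.trans (hdiag k)),
    mul_comm]

theorem krylovRows_mul_eigMat [NeZero n] : krylovRows n (Lam n) * eigMat n =
    ((vandermonde fun k : Fin n => xi (ix k)).map (algebraMap (KT n) (Lam n)))ᵀ := by
  have hpow (a : ℕ) : (-matAS n (Lam n)) ^ a * eigMat n =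
      eigMat n * diagonal fun k => algebraMap (KT n) (Lam n) (xi (ix k)) ^ a := by
    induction a with
    | zero => simp
    | succ a ih =>
      rw [pow_succ, Matrix.mul_assoc, Matrix.neg_mul, matAS_mul_eigMat, ← Matrix.mul_neg,
        ← Matrix.mul_assoc, ih, Matrix.mul_assoc, diagonal_neg, diagonal_mul_diagonal]
      simp only [neg_neg, pow_succ]
  ext1 a k
  calc (krylovRows n (Lam n) * eigMat n) a k
      = ((-matAS n (Lam n)) ^ a.val * eigMat n) 0 k := by rw [mul_apply, mul_apply]; rfl
    _ = algebraMap (KT n) (Lam n) (xi (ix k)) ^ a.val := by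
        rw [hpow, mul_diagonal]
        simp [eigMat]
    _ = _ := by rw [transpose_apply, map_apply, vandermonde_apply, map_pow]

/-- In the basis of eigenvectors of `A` the matrix `P⁻¹ W P` becomes `V diag(ω) V⁻¹`, where `V` is
the transposed Vandermonde matrix. -/
theorem sigAt_eq_bialt [NeZero n] {W : Matrix (Fin n) (Fin n) (Lam n)} {ω : Fin n → Lam n}
    (hW : W * eigMat n = eigMat n * diagonal ω) (i : ℕ) :
    sigAt W i = bialt i (fun k => xi (ix k)) ω := by
  set V := krylovRows n (Lam n) * eigMat n with hV
  have hdiag : krylovRows n (Lam n) * (W * matPS n (Lam n)) * V = V * diagonal ω := by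
    rw [hV, Matrix.mul_assoc, Matrix.mul_assoc, ← Matrix.mul_assoc (matPS n (Lam n)),
      matPS_mul_krylovRows, Matrix.one_mul, hW, Matrix.mul_assoc]
  have halt : (of fun a k : Fin n => if a.val < i then (V * diagonal ω) a k else V a k) =
      altMat i (fun k : Fin n => xi (ix k)) ω := by
    ext1 a k
    simp only [altMat, of_apply, mul_diagonal, hV, krylovRows_mul_eigMat, transpose_apply,
      map_apply, vandermonde_apply, Algebra.smul_def]
    split_ifs <;> simp
  have hdetV : V.det = algebraMap (KT n) (Lam n) (vandermonde fun k : Fin n => xi (ix k)).det := by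
    rw [hV, krylovRows_mul_eigMat, det_transpose, RingHom.map_det]
    rfl
  have hminor := leadingMinor_mul_det (krylovRows n (Lam n) * (W * matPS n (Lam n))) V i
  rw [leadingMinor_krylovRows_mul, hdiag, halt, hdetV, mul_comm, ← Algebra.smul_def] at hminor
  rw [bialt, ← hminor, smul_smul, inv_mul_cancel₀, one_smul, sigAt]
  exact det_vandermonde_ne_zero_iff.2 (xi_injective.comp ix_injective)

theorem sigAt_betaZ_mul_one_add_smul_matAS [NeZero n] (i : ℕ) (c : RT n) :
    sigAt (betaZ n * (1 + algebraMap (RT n) (Lam n) c • matAS n (Lam n))) i =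
      bialt i (fun k : Fin n => xi (ix k))
        (fun k => (1 - algebraMap (RT n) (KT n) c * xi (ix k)) • Om (ix k)) := by
  refine sigAt_eq_bialt ?_ i
  rw [Matrix.mul_assoc, Matrix.add_mul, Matrix.one_mul, smul_mul_assoc, matAS_mul_eigMat,
    Matrix.mul_add, Matrix.mul_smul, ← Matrix.mul_assoc, betaZ_mul_eigMat]
  ext1 j k
  simp only [Matrix.add_apply, Matrix.smul_apply, mul_diagonal, smul_eq_mul]
  rw [Algebra.smul_def, map_sub, map_one, map_mul,
    ← IsScalarTower.algebraMap_apply (RT n) (KT n) (Lam n)]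
  ring

/-- The bialternant in the eigenvalues `xi (e l)` and the series `Om (e l)`, for a family `e` of
indices. -/
def omBialt {N : ℕ} (r : ℕ) (e : Fin N → ZMod n) : Lam n :=
  bialt r (fun l => xi (e l)) fun l => Om (e l)

/-- The residues `i + 2, i + 3, …` that follow `i + 1`. -/
def tailIx (n i l : ℕ) : ZMod n := ((i + 2 + l : ℕ) : ZMod n)

theorem algebraMap_neg_expW_wt (i : ZMod n) :
    algebraMap (RT n) (KT n) (-expW (wt n i)) = (xi i)⁻¹ := by
  refine eq_inv_of_mul_eq_one_left ?_
  rw [xi, map_neg, neg_mul_neg]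
  exact expK_mul_expK_neg _

/-- Rotating the indices, `i + 1` comes first and the factors `1 - x_k / x_0` remove it. -/
theorem sigAt_betaZ_eq_omBialt {N i : ℕ} (hi : i ≤ N) :
    sigAt (betaZ (N + 1) * (1 + algebraMap (RT (N + 1)) (Lam (N + 1))
      (-expW (wt (N + 1) ((i + 1 : ℕ) : ZMod (N + 1)))) • matAS (N + 1) (Lam (N + 1)))) i =
      omBialt i fun l : Fin N => tailIx (N + 1) i l := by
  set e : Fin (N + 1) → ZMod (N + 1) := fun l => ((i + 1 + l.val : ℕ) : ZMod (N + 1)) with he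
  set rot : Equiv.Perm (Fin (N + 1)) := Equiv.addRight (Fin.ofNat (N + 1) i)
  have hrot : ix ∘ rot = e := by
    funext l
    simp only [rot, Function.comp_apply, Equiv.coe_addRight, ix, Fin.val_add, Fin.val_ofNat,
      Nat.cast_add, ZMod.natCast_mod, he]
    ring
  have hxe : Function.Injective (xi ∘ e) :=
    hrot ▸ xi_injective.comp (ix_injective.comp rot.injective)
  have hesucc : e ∘ Fin.succ = fun l : Fin N => tailIx (N + 1) i l := by
    funext l
    simp only [he, Function.comp_apply, Fin.val_succ, tailIx]
    congr 1
    omega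
  calc _ = bialt i ((xi ∘ ix) ∘ rot)
        ((fun k => (1 - xi (ix k) / xi (e 0)) • Om (ix k) : Fin (N + 1) → Lam (N + 1)) ∘ rot) := by
        rw [sigAt_betaZ_mul_one_add_smul_matAS, algebraMap_neg_expW_wt, bialt_comp_perm]
        simp only [inv_mul_eq_div]
        rfl
    _ = bialt i (xi ∘ e) fun l => (1 - (xi ∘ e) l / (xi ∘ e) 0) • (Om ∘ e) l := by
        rw [← hrot]
        rfl
    _ = bialt i ((xi ∘ e) ∘ Fin.succ) ((Om ∘ e) ∘ Fin.succ) := by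
        rw [bialt, det_altMat_one_sub_div_smul hi hxe (xi_ne_zero _), smul_smul,
          inv_mul_cancel₀ (det_vandermonde_ne_zero_iff.2 hxe), one_smul]
    _ = _ := by rw [Function.comp_assoc, Function.comp_assoc, hesucc]; rfl

end Diagonalization

/-! ### Permutation actions -/

section Permutations

variable {n : ℕ}

theorem permW_mul (σ τ : Equiv.Perm (ZMod n)) (μ : Weight n) :
    permW (σ * τ) μ = permW σ (permW τ μ) := by
  induction μ using QuotientAddGroup.induction_on with
  | H v => rfl

theorem permR_mul (σ τ : Equiv.Perm (ZMod n)) (f : RT n) :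
    permR (σ * τ) f = permR σ (permR τ f) := by
  suffices h : (permR (σ * τ) : RT n →+* RT n) = (permR σ : RT n →+* RT n).comp (permR τ) from
    RingHom.congr_fun h f
  refine AddMonoidAlgebra.ringHom_ext (fun r => ?_) fun μ => ?_
  · let const : ℤ →+* RT n := AddMonoidAlgebra.singleZeroRingHom
    exact RingHom.congr_fun (Subsingleton.elim ((permR (σ * τ) : RT n →+* RT n).comp const)
      (((permR σ : RT n →+* RT n).comp (permR τ)).comp const)) r
  · change permR (σ * τ) (expW μ) = permR σ (permR τ (expW μ))
    rw [permR_expW, permR_expW, permR_expW, permW_mul]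

theorem permK_mul (σ τ : Equiv.Perm (ZMod n)) (f : KT n) :
    permK (σ * τ) f = permK σ (permK τ f) := by
  suffices h : (permK (σ * τ) : KT n →+* KT n) = (permK σ : KT n →+* KT n).comp (permK τ) from
    RingHom.congr_fun h f
  refine IsLocalization.ringHom_ext (nonZeroDivisors (RT n)) ?_
  ext r
  simp [permK, permR_mul]

theorem permL_mul (σ τ : Equiv.Perm (ZMod n)) (f : Lam n) :
    permL (σ * τ) f = permL σ (permL τ f) := by
  ext d
  simp [permL, permK_mul]

theorem permK_xi (σ : Equiv.Perm (ZMod n)) (i : ZMod n) : permK σ (xi i) = xi (σ i) := by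
  rw [xi, map_neg, permK_expK, map_neg, permW_wt, xi]

theorem permL_omBialt {N : ℕ} (σ : Equiv.Perm (ZMod n)) (r : ℕ) (e : Fin N → ZMod n) :
    permL σ (omBialt r e) = omBialt r (σ ∘ e) := by
  have hvandermonde : permK σ (vandermonde fun l => xi (e l)).det =
      (vandermonde fun l => xi (σ (e l))).det := by
    refine (RingHom.map_det (permK σ : KT n →+* KT n) _).trans (congrArg det ?_)
    ext a b
    simp [vandermonde_apply, permK_xi]
  have halt : permL σ (altMat r (fun l => xi (e l)) fun l => (Om (e l) : Lam n)).det =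
      (altMat r (fun l => xi (σ (e l))) fun l => (Om (σ (e l)) : Lam n)).det := by
    rw [RingHom.map_det]
    congr 1
    ext1 a b
    simp only [RingHom.mapMatrix_apply, map_apply, altMat, of_apply, permL_smul, map_pow, permK_xi]
    split_ifs <;> simp [permL_Om]
  simp only [omBialt, bialt, permL_smul, map_inv₀, hvandermonde, halt, Function.comp_apply]

end Permutations

/-! ### Bialternants of finite sets of residues -/

section OmSet

variable {n : ℕ}

theorem omBialt_eq_of_range_eq (r : ℕ) {N M : ℕ} {e : Fin N → ZMod n} {e' : Fin M → ZMod n}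
    (he : Function.Injective e) (he' : Function.Injective e')
    (hrange : Set.range e = Set.range e') : omBialt r e = omBialt r e' := by
  let σ : Fin N ≃ Fin M := (Equiv.ofInjective e he).trans
    ((Equiv.setCongr hrange).trans (Equiv.ofInjective e' he').symm)
  have hσ : e = e' ∘ σ := by
    funext l
    exact (Equiv.apply_ofInjective_symm he' ⟨e l, hrange ▸ Set.mem_range_self l⟩).symm
  obtain rfl : N = M := by simpa using Fintype.card_congr σ
  rw [hσ]
  exact bialt_comp_perm r (xi ∘ e') (Om ∘ e') σ

/-- The bialternant `omBialt` of an enumeration of the finite set `S`; it does not depend on the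
enumeration. -/
def omSet (r : ℕ) (S : Finset (ZMod n)) : Lam n :=
  omBialt r fun l => (S.equivFin.symm l : ZMod n)

theorem omSet_eq_omBialt (r : ℕ) {N : ℕ} {S : Finset (ZMod n)} {e : Fin N → ZMod n}
    (he : Function.Injective e) (hS : Set.range e = S) : omSet r S = omBialt r e := by
  refine omBialt_eq_of_range_eq r (Subtype.val_injective.comp S.equivFin.symm.injective) he ?_
  rw [hS]
  exact (S.equivFin.symm.surjective.range_comp _).trans Subtype.range_coe

theorem omSet_zero (S : Finset (ZMod n)) : omSet 0 S = 1 :=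
  bialt_zero (xi_injective.comp (Subtype.val_injective.comp S.equivFin.symm.injective)) _

theorem permL_omSet (σ : Equiv.Perm (ZMod n)) (r : ℕ) (S : Finset (ZMod n)) :
    permL σ (omSet r S) = omSet r (S.map σ.toEmbedding) := by
  rw [omSet, permL_omBialt]
  refine (omSet_eq_omBialt r (σ.injective.comp
    (Subtype.val_injective.comp S.equivFin.symm.injective)) ?_).symm
  rw [Set.range_comp, Finset.coe_map]
  exact congrArg (σ '' ·) ((S.equivFin.symm.surjective.range_comp _).trans Subtype.range_coe)

theorem omSet_succ {r : ℕ} {S : Finset (ZMod n)} (hr : r < S.card) {q : Polynomial (KT n)}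
    (hq : q.natDegree ≤ r) (hq0 : q.coeff 0 = 1) :
    omSet (r + 1) S = ∑ k ∈ S, (q.eval (xi k) * ∏ l ∈ S.erase k, xi l / (xi l - xi k)) •
      (Om k * omSet r (S.erase k)) := by
  obtain ⟨N, hN⟩ : ∃ N, S.card = N + 1 := ⟨S.card - 1, by omega⟩
  obtain ⟨e, hS⟩ : ∃ e : Fin (N + 1) ↪ ZMod n, S = Finset.univ.map e := by
    refine ⟨(S.equivFinOfCardEq hN).symm.toEmbedding.trans (.subtype _),
      (Finset.eq_of_subset_of_card_le (fun z hz => ?_) (by simp [hN])).symm⟩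
    obtain ⟨l, -, rfl⟩ := Finset.mem_map.1 hz
    exact ((S.equivFinOfCardEq hN).symm l).2
  have herase (k : Fin (N + 1)) : S.erase (e k) = Finset.univ.map (k.succAboveEmb.trans e) := by
    rw [hS, ← Finset.map_erase, ← Finset.map_map]
    refine congrArg (Finset.map e) (Finset.ext fun l => ?_)
    simp [Fin.exists_succAbove_eq_iff]
  rw [omSet_eq_omBialt (e := e) _ e.injective (by rw [hS]; simp)]
  refine (bialt_succ (by omega) (xi_injective.comp e.injective) (Om ∘ e) hq hq0).trans ?_
  conv_rhs => rw [hS, Finset.sum_map, ← hS]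
  refine Finset.sum_congr rfl fun k _ => ?_
  rw [omSet_eq_omBialt (e := e ∘ k.succAbove) r (e.injective.comp k.succAbove_right_injective)
    (by rw [herase]; simp [Function.comp_def]), herase, Finset.prod_map]
  rfl

/-- The weights `∏_{l ≠ k} x_l / (x_l - x_k)` of Lagrange interpolation at `0` in the nodes
`x_l = xi l`, `l ∈ E`. -/
def lagrangeWeight (E : Finset (ZMod n)) (k : ZMod n) : KT n :=
  ∏ l ∈ E.erase k, xi l / (xi l - xi k)

theorem xi_sub_xi_ne_zero {a b : ZMod n} (hab : a ≠ b) : xi a - xi b ≠ 0 :=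
  sub_ne_zero.2 (xi_injective.ne hab)

theorem lagrangeWeight_insert_of_ne {E : Finset (ZMod n)} {b k : ZMod n} (hb : b ∉ E)
    (hkb : k ≠ b) :
    lagrangeWeight (insert b E) k = xi b / (xi b - xi k) * lagrangeWeight E k := by
  rw [lagrangeWeight, Finset.erase_insert_of_ne hkb.symm,
    Finset.prod_insert fun h => hb (Finset.mem_of_mem_erase h), lagrangeWeight]

theorem lagrangeWeight_eq_mul {E S : Finset (ZMod n)} (hES : E ⊆ S) {k : ZMod n} (hk : k ∈ E) :
    lagrangeWeight S k = (∏ t ∈ S \ E, xi t / (xi t - xi k)) * lagrangeWeight E k := by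
  have hsdiff : S.erase k \ E.erase k = S \ E := by
    ext t
    simp only [Finset.mem_sdiff, Finset.mem_erase]
    grind
  rw [lagrangeWeight, ← Finset.prod_sdiff (Finset.erase_subset_erase k hES), hsdiff, lagrangeWeight]

/-- The interpolating polynomial is chosen to vanish on `S \ E`. -/
theorem omSet_card_sdiff_succ {E S : Finset (ZMod n)} (hES : E ⊆ S) (hE : E.Nonempty) :
    omSet ((S \ E).card + 1) S =
      ∑ k ∈ E, lagrangeWeight E k • (Om k * omSet (S \ E).card (S.erase k)) := by
  let q : Polynomial (KT n) := ∏ t ∈ S \ E, (1 - Polynomial.C (xi t)⁻¹ * Polynomial.X)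
  have hdeg : q.natDegree ≤ (S \ E).card := by
    refine (Polynomial.natDegree_prod_le _ _).trans
      ((Finset.sum_le_card_nsmul _ _ 1 fun t _ => ?_).trans_eq (by simp))
    compute_degree
  have hq0 : q.coeff 0 = 1 := by
    simp [q, Polynomial.coeff_zero_eq_eval_zero, Polynomial.eval_prod]
  have hqx (k : ZMod n) : q.eval (xi k) = ∏ t ∈ S \ E, ((xi t - xi k) / xi t) := by
    rw [Polynomial.eval_prod]
    refine Finset.prod_congr rfl fun t _ => ?_
    have := xi_ne_zero t
    simp only [Polynomial.eval_sub, Polynomial.eval_one, Polynomial.eval_mul, Polynomial.eval_C,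
      Polynomial.eval_X]
    field_simp
  have hcard : (S \ E).card < S.card :=
    Finset.card_lt_card (Finset.sdiff_ssubset hES hE)
  rw [omSet_succ hcard hdeg hq0]
  refine (Finset.sum_subset_zero_on_sdiff hES (fun k hk => ?_) fun k hk => ?_).symm
  · rw [hqx, Finset.prod_eq_zero hk (by rw [sub_self, zero_div]), zero_mul, zero_smul]
  · rw [← lagrangeWeight, lagrangeWeight_eq_mul hES hk, hqx, ← mul_assoc, ← Finset.prod_mul_distrib,
      Finset.prod_eq_one fun t ht => ?_, one_mul]
    have htk : t ≠ k := fun h => (Finset.mem_sdiff.1 ht).2 (h ▸ hk)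
    rw [div_mul_div_cancel₀ (xi_ne_zero t), div_self (xi_sub_xi_ne_zero htk)]

end OmSet

/-! ### Demazure operators -/

section Demazure

variable {n : ℕ}

/-- The isobaric divided difference operator exchanging the indices `u` and `v`; for `u = v` it is
`0` by the convention for division by zero. -/
def dem (u v : ZMod n) : Lam n →+ Lam n where
  toFun f := (xi u / (xi u - xi v)) • permL (Equiv.swap u v) f + (xi v / (xi v - xi u)) • f
  map_zero' := by simp
  map_add' f g := by
    simp only [map_add, smul_add]
    abel

theorem dem_apply (u v : ZMod n) (f : Lam n) : dem u v f =
    (xi u / (xi u - xi v)) • permL (Equiv.swap u v) f + (xi v / (xi v - xi u)) • f := rfl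

theorem dem_eq {u v : ZMod n} (huv : u ≠ v) (f : Lam n) :
    dem u v f = (1 - expK (wt n u - wt n v))⁻¹ • (permL (Equiv.swap u v) f - f) + f := by
  have hxi : xi u * expK (wt n u - wt n v) = xi v := by
    rw [xi, neg_mul, ← expK_add, xi]
    congr 2
    abel
  have hinv : (1 - expK (wt n u - wt n v))⁻¹ = xi u / (xi u - xi v) := by
    rw [← hxi, ← mul_one_sub, div_mul_cancel_left₀ (xi_ne_zero u)]
  have hcompl : xi v / (xi v - xi u) = 1 - xi u / (xi u - xi v) := by
    have := xi_sub_xi_ne_zero huv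
    have := xi_sub_xi_ne_zero huv.symm
    field_simp
    ring
  rw [hinv, dem_apply, hcompl, sub_smul, smul_sub, one_smul]
  abel

theorem dem_mul_of_permL_eq {u v : ZMod n} {M : Lam n} (hM : permL (Equiv.swap u v) M = M)
    (f : Lam n) : dem u v (M * f) = M * dem u v f := by
  rw [dem_apply, map_mul, hM, dem_apply, mul_add, mul_smul_comm, mul_smul_comm]

theorem permK_lagrangeWeight (σ : Equiv.Perm (ZMod n)) (E : Finset (ZMod n)) (k : ZMod n) :
    permK σ (lagrangeWeight E k) = lagrangeWeight (E.map σ.toEmbedding) (σ k) := by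
  rw [lagrangeWeight, lagrangeWeight, ← Equiv.coe_toEmbedding, ← Finset.map_erase, Finset.prod_map,
    map_prod]
  simp only [map_div₀, map_sub, permK_xi, Equiv.coe_toEmbedding]

theorem map_swap_eq_self {F : Finset (ZMod n)} {a b : ZMod n} (ha : a ∉ F) (hb : b ∉ F) :
    F.map (Equiv.swap a b).toEmbedding = F := by
  refine Finset.eq_of_subset_of_card_le (fun z hz => ?_) (by rw [Finset.card_map])
  obtain ⟨l, hl, rfl⟩ := Finset.mem_map.1 hz
  rwa [Equiv.coe_toEmbedding, Equiv.swap_apply_of_ne_of_ne (ne_of_mem_of_not_mem hl ha)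
    (ne_of_mem_of_not_mem hl hb)]

section Step

variable {F : Finset (ZMod n)} {a b : ZMod n}

theorem dem_lagrangeWeight_smul_of_mem (hab : a ≠ b) (ha : a ∉ F) (hb : b ∉ F) {k : ZMod n}
    (hk : k ∈ F) {f : Lam n} (hf : permL (Equiv.swap a b) f = f) :
    dem a b (lagrangeWeight (insert a F) k • f) =
      lagrangeWeight (insert b (insert a F)) k • f := by
  have hka : k ≠ a := ne_of_mem_of_not_mem hk ha
  have hkb : k ≠ b := ne_of_mem_of_not_mem hk hb
  rw [dem_apply, permL_smul, hf, permK_lagrangeWeight, Finset.map_insert, map_swap_eq_self ha hb,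
    Equiv.coe_toEmbedding, Equiv.swap_apply_left, Equiv.swap_apply_of_ne_of_ne hka hkb, smul_smul,
    smul_smul, ← add_smul, lagrangeWeight_insert_of_ne hb hkb,
    lagrangeWeight_insert_of_ne (E := insert a F) (by simp [hb, hab.symm]) hkb,
    lagrangeWeight_insert_of_ne ha hka]
  congr 1
  have := xi_sub_xi_ne_zero hab
  have := xi_sub_xi_ne_zero hka.symm
  have := xi_sub_xi_ne_zero hkb.symm
  rw [← neg_sub (xi a) (xi b)]
  field_simp
  ring

theorem dem_lagrangeWeight_smul_self (hab : a ≠ b) (ha : a ∉ F) (hb : b ∉ F) (f : Lam n) :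
    dem a b (lagrangeWeight (insert a F) a • f) =
      lagrangeWeight (insert b (insert a F)) b • permL (Equiv.swap a b) f +
        lagrangeWeight (insert b (insert a F)) a • f := by
  rw [dem_apply, permL_smul, permK_lagrangeWeight, Finset.map_insert, map_swap_eq_self ha hb,
    Equiv.coe_toEmbedding, Equiv.swap_apply_left, smul_smul, smul_smul,
    lagrangeWeight_insert_of_ne (by simp [hb, hab.symm]) hab, Finset.insert_comm b a,
    lagrangeWeight_insert_of_ne (by simp [ha, hab]) hab.symm]

theorem dem_sum_lagrangeWeight (hab : a ≠ b) (ha : a ∉ F) (hb : b ∉ F) {u : ZMod n → Lam n}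
    (hu : ∀ k, permL (Equiv.swap a b) (u k) = u (Equiv.swap a b k)) :
    dem a b (∑ k ∈ insert a F, lagrangeWeight (insert a F) k • u k) =
      ∑ k ∈ insert b (insert a F), lagrangeWeight (insert b (insert a F)) k • u k := by
  rw [map_sum, Finset.sum_insert ha, Finset.sum_insert (by simp [hb, hab.symm]),
    Finset.sum_insert ha, dem_lagrangeWeight_smul_self hab ha hb, hu, Equiv.swap_apply_left,
    add_assoc]
  refine congrArg _ (congrArg _ (Finset.sum_congr rfl fun k hk => ?_))
  refine dem_lagrangeWeight_smul_of_mem hab ha hb hk ?_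
  rw [hu, Equiv.swap_apply_of_ne_of_ne (ne_of_mem_of_not_mem hk ha) (ne_of_mem_of_not_mem hk hb)]

end Step

/-- The composite `dem (e (N-1)) (e N) ∘ ⋯ ∘ dem (e 0) (e 1)`, for a sequence `e` of indices. -/
def rowOp (e : ℕ → ZMod n) : ℕ → Lam n → Lam n
  | 0, f => f
  | N + 1, f => dem (e N) (e (N + 1)) (rowOp e N f)

theorem rowOp_mul_of_permL_eq {e : ℕ → ZMod n} {N : ℕ} {M : Lam n}
    (hM : ∀ l < N, permL (Equiv.swap (e l) (e (l + 1))) M = M) (f : Lam n) :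
    rowOp e N (M * f) = M * rowOp e N f := by
  induction N with
  | zero => rfl
  | succ N ih =>
    rw [rowOp, ih fun l hl => hM l (hl.trans N.lt_succ_self),
      dem_mul_of_permL_eq (hM N N.lt_succ_self), rowOp]

theorem rowOp_eq_sum {e : ℕ → ZMod n} {N : ℕ} (he : Set.InjOn e (Set.Iic N)) {u : ZMod n → Lam n}
    (hu : ∀ l < N, ∀ k, permL (Equiv.swap (e l) (e (l + 1))) (u k) =
      u (Equiv.swap (e l) (e (l + 1)) k)) :
    rowOp e N (u (e 0)) = ∑ k ∈ (Finset.range (N + 1)).image e,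
      lagrangeWeight ((Finset.range (N + 1)).image e) k • u k := by
  induction N with
  | zero => simp [rowOp, lagrangeWeight]
  | succ N ih =>
    have hnotMem {l m : ℕ} (hlm : l ≤ m) (hm : m ≤ N + 1) : e m ∉ (Finset.range l).image e := by
      intro h
      obtain ⟨p, hp, hpm⟩ := Finset.mem_image.1 h
      have hp := Finset.mem_range.1 hp
      have := he (Set.mem_Iic.2 (by omega)) (Set.mem_Iic.2 hm) hpm
      omega
    have hne : e N ≠ e (N + 1) := fun h => by
      have := he (Set.mem_Iic.2 (by omega)) (Set.mem_Iic.2 le_rfl) h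
      omega
    rw [rowOp, ih (he.mono (Set.Iic_subset_Iic.2 N.le_succ)) fun l hl =>
        hu l (hl.trans N.lt_succ_self),
      Finset.range_add_one (n := N + 1), Finset.image_insert, Finset.range_add_one,
      Finset.image_insert]
    exact dem_sum_lagrangeWeight hne (hnotMem le_rfl N.le_succ) (hnotMem N.le_succ le_rfl)
      (hu N N.lt_succ_self)

theorem map_swap_eq_self_of_mem {S : Finset (ZMod n)} {a b : ZMod n} (ha : a ∈ S) (hb : b ∈ S) :
    S.map (Equiv.swap a b).toEmbedding = S := by
  refine Finset.map_perm fun z hz => ?_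
  by_contra hzS
  exact hz (Equiv.swap_apply_of_ne_of_ne (fun h => hzS (h ▸ ha)) fun h => hzS (h ▸ hb))

theorem rowOp_Om_mul_omSet {e : ℕ → ZMod n} {N r : ℕ} (he : Set.InjOn e (Set.Iic N))
    {S : Finset (ZMod n)} (heS : (Finset.range (N + 1)).image e ⊆ S) (hS : S.card = N + 1 + r) :
    rowOp e N (Om (e 0) * omSet r (S.erase (e 0))) = omSet (r + 1) S := by
  have hmem {l : ℕ} (hl : l ≤ N) : e l ∈ S :=
    heS (Finset.mem_image_of_mem e (Finset.mem_range.2 (by omega)))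
  have hcard : (S \ (Finset.range (N + 1)).image e).card = r := by
    rw [Finset.card_sdiff_of_subset heS, Finset.card_image_of_injOn, Finset.card_range, hS]
    · omega
    · exact he.mono fun l hl => Set.mem_Iic.2 (Nat.lt_succ_iff.1 (Finset.mem_range.1 hl))
  have hu (l : ℕ) (hl : l < N) (k : ZMod n) :
      permL (Equiv.swap (e l) (e (l + 1))) (Om k * omSet r (S.erase k)) =
        Om (Equiv.swap (e l) (e (l + 1)) k) *
          omSet r (S.erase (Equiv.swap (e l) (e (l + 1)) k)) := by
    rw [map_mul, permL_Om, permL_omSet, Finset.map_erase,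
      map_swap_eq_self_of_mem (hmem hl.le) (hmem hl), Equiv.coe_toEmbedding]
  rw [rowOp_eq_sum he (u := fun k => Om k * omSet r (S.erase k)) hu]
  have hsum := omSet_card_sdiff_succ heS (Finset.nonempty_range_add_one.image e)
  rw [hcard] at hsum
  exact hsum.symm

end Demazure

/-! ### The word of a rectangle -/

section Rectangle

variable {n : ℕ}

theorem permL_prod_Om (σ : Equiv.Perm (ZMod n)) (S : Finset (ZMod n)) :
    permL σ (∏ z ∈ S, Om z) = ∏ z ∈ S.map σ.toEmbedding, Om z := by
  rw [map_prod, Finset.prod_map]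
  simp only [permL_Om, Equiv.coe_toEmbedding]

theorem permL_swap_prod_Om_range {e : ℕ → ZMod n} {m : ℕ} (he : Set.InjOn e (Set.Iio m)) {c p : ℕ}
    (hc : c ≤ m) (hp : p + 1 < m) (hpc : p + 1 ≠ c) :
    permL (Equiv.swap (e p) (e (p + 1))) (∏ l ∈ Finset.range c, Om (e l)) =
      ∏ l ∈ Finset.range c, Om (e l) := by
  have hmem {q : ℕ} (hq : q < m) : e q ∈ (Finset.range c).image e ↔ q < c := by
    rw [← Finset.mem_coe, Finset.coe_image, Finset.coe_range,
      he.mem_image_iff (Set.Iio_subset_Iio hc) (Set.mem_Iio.2 hq), Set.mem_Iio]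
  rw [← Finset.prod_image (f := Om) ((he.mono (Set.Iio_subset_Iio hc)).mono (by simp)),
    permL_prod_Om]
  congr 1
  rcases Nat.lt_or_gt_of_ne hpc with hlt | hgt
  · exact map_swap_eq_self_of_mem ((hmem (by omega)).2 (by omega)) ((hmem hp).2 hlt)
  · refine map_swap_eq_self ?_ ?_ <;> rw [hmem (by omega)] <;> omega

theorem shift_permL_swap (m : ℕ) (a b : ZMod n) (f : Lam n) :
    shift m (permL (Equiv.swap a b) f) =
      permL (Equiv.swap (a + (m : ZMod n)) (b + (m : ZMod n))) (shift m f) := by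
  rw [shift, ← permL_mul, ← permL_mul, Equiv.mul_swap_eq_swap_mul]
  rfl

theorem tailIx_injOn (n i : ℕ) : Set.InjOn (tailIx n i) (Set.Iio n) := by
  intro a ha b hb h
  simp only [tailIx, Nat.cast_add] at h
  have hab := add_left_cancel h
  rwa [ZMod.natCast_eq_natCast_iff', Nat.mod_eq_of_lt ha, Nat.mod_eq_of_lt hb] at hab

theorem tailIx_succ (n i p : ℕ) : tailIx n i (p + 1) = tailIx n i p + 1 := by
  rw [tailIx, tailIx, ← Nat.cast_add_one]
  rfl

theorem sub_add_eq_tailIx {i r : ℕ} (hr : r < i) (c : ℕ) :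
    (c : ZMod n) - r + ((2 * i + 1 : ℕ) : ZMod n) = tailIx n i (i - 1 - r + c) := by
  rw [tailIx, sub_add_eq_add_sub, sub_eq_iff_eq_add, ← Nat.cast_add, ← Nat.cast_add]
  congr 1
  omega

theorem zero_add_eq_tailIx (n p : ℕ) :
    (0 : ZMod n) + ((2 * (p + 1) + 1 : ℕ) : ZMod n) = tailIx n (p + 1) p := by
  rw [zero_add, tailIx]
  congr 1
  omega

theorem mul_shift_sAct_zero {p : ℕ} (hp : p + 1 < n) (f : Lam n) :
    (∏ l ∈ Finset.range (p + 1), Om (tailIx n (p + 1) l)) * shift (2 * (p + 1) + 1) (sAct 0 f) =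
      permL (Equiv.swap (tailIx n (p + 1) p) (tailIx n (p + 1) (p + 1)))
        ((∏ l ∈ Finset.range (p + 1), Om (tailIx n (p + 1) l)) * shift (2 * (p + 1) + 1) f) := by
  have hone : (1 : ZMod n) + ((2 * (p + 1) + 1 : ℕ) : ZMod n) = tailIx n (p + 1) (p + 1) := by
    rw [tailIx_succ, ← zero_add_eq_tailIx, zero_add, add_comm]
  rw [sAct, if_pos rfl, map_mul, map_mul, shift_permL_swap, zero_add_eq_tailIx, hone,
    Finset.prod_range_succ, map_mul, map_mul,
    permL_swap_prod_Om_range (tailIx_injOn n (p + 1)) (by omega) hp (by omega), permL_Om,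
    Equiv.swap_apply_left]
  simp only [shift, permL_Om, permL_Om_inv, Equiv.coe_addRight, zero_add_eq_tailIx, hone]
  linear_combination (∏ l ∈ Finset.range p, Om (tailIx n (p + 1) l)) *
    Om (tailIx n (p + 1) (p + 1)) * permL (Equiv.swap (tailIx n (p + 1) p)
      (tailIx n (p + 1) (p + 1))) (permL (Equiv.addRight ((2 * (p + 1) + 1 : ℕ) : ZMod n)) f) *
    Om_mul_inv (tailIx n (p + 1) p)

/-- The factor `Om 1 * (Om 0)⁻¹` in the action of `s_0` is absorbed by the product of the `Om`. -/
theorem mul_shift_sAct {i p : ℕ} (hi : i ≤ n) (hi0 : 0 < i) (hp : p + 1 < n) {a : ZMod n}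
    (ha : a + ((2 * i + 1 : ℕ) : ZMod n) = tailIx n i p) (f : Lam n) :
    (∏ l ∈ Finset.range i, Om (tailIx n i l)) * shift (2 * i + 1) (sAct a f) =
      permL (Equiv.swap (tailIx n i p) (tailIx n i (p + 1)))
        ((∏ l ∈ Finset.range i, Om (tailIx n i l)) * shift (2 * i + 1) f) := by
  obtain ⟨i, rfl⟩ : ∃ j, i = j + 1 := ⟨i - 1, by omega⟩
  by_cases hpi : p = i
  · subst hpi
    obtain rfl : a = 0 := add_right_cancel (ha.trans (zero_add_eq_tailIx n p).symm)
    exact mul_shift_sAct_zero hp f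
  · have ha0 : a ≠ 0 := by
      rintro rfl
      rw [zero_add_eq_tailIx] at ha
      exact hpi
        (tailIx_injOn n (i + 1) (Set.mem_Iio.2 (by omega)) (Set.mem_Iio.2 (by omega)) ha).symm
    rw [sAct, if_neg ha0, shift_permL_swap, add_right_comm, ha, ← tailIx_succ, map_mul,
      permL_swap_prod_Om_range (tailIx_injOn n (i + 1)) hi hp (by omega)]

theorem mul_shift_opD {i p : ℕ} (hi : i ≤ n) (hi0 : 0 < i) (hp : p + 1 < n) {a : ZMod n}
    (ha : a + ((2 * i + 1 : ℕ) : ZMod n) = tailIx n i p) (f : Lam n) :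
    (∏ l ∈ Finset.range i, Om (tailIx n i l)) * shift (2 * i + 1) (opD a f) =
      dem (tailIx n i p) (tailIx n i (p + 1))
        ((∏ l ∈ Finset.range i, Om (tailIx n i l)) * shift (2 * i + 1) f) := by
  have hne : tailIx n i p ≠ tailIx n i (p + 1) := fun h => by
    have := tailIx_injOn n i (Set.mem_Iio.2 (by omega)) (Set.mem_Iio.2 hp) h
    omega
  have hcoeff : permK (Equiv.addRight ((2 * i + 1 : ℕ) : ZMod n))
      (1 - expK (wt n a - wt n (a + 1)))⁻¹ =
      (1 - expK (wt n (tailIx n i p) - wt n (tailIx n i (p + 1))))⁻¹ := by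
    rw [map_inv₀, map_sub, map_one, permK_expK, map_sub, permW_wt, permW_wt]
    simp only [Equiv.coe_addRight, ha, add_right_comm a 1, tailIx_succ]
  rw [dem_eq hne, ← mul_shift_sAct hi hi0 hp ha, opD, opT, map_add, mul_add, shift, permL_smul,
    hcoeff, mul_smul_comm, map_sub, mul_sub]

theorem mul_shift_foldr_opD {i r N : ℕ} (hi : i ≤ n) (hr : r < i) (hN : i - 1 - r + N < n)
    (f : Lam n) :
    (∏ l ∈ Finset.range i, Om (tailIx n i l)) * shift (2 * i + 1)
        (((List.range N).map fun c : ℕ => (c : ZMod n) - (r : ZMod n)).reverse.foldr opD f) =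
      rowOp (fun l => tailIx n i (i - 1 - r + l)) N
        ((∏ l ∈ Finset.range i, Om (tailIx n i l)) * shift (2 * i + 1) f) := by
  induction N with
  | zero => simp [rowOp]
  | succ N ih =>
    rw [List.range_succ, List.map_append, List.reverse_append, List.map_singleton,
      List.reverse_singleton, List.singleton_append, List.foldr_cons,
      mul_shift_opD hi (by omega) hN (sub_add_eq_tailIx hr N), ih (by omega), rowOp]
    rfl

theorem residueWord_replicate_succ (n r N : ℕ) : residueWord n (List.replicate (r + 1) N) =
    ((List.range N).map fun c : ℕ => (c : ZMod n) - (r : ZMod n)).reverse ++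
      residueWord n (List.replicate r N) := by
  simp only [residueWord, List.replicate_succ', List.zipIdx_append, List.flatMap_append,
    List.reverse_append, List.length_replicate, List.zipIdx_cons, List.zipIdx_nil,
    List.flatMap_singleton, zero_add]
  simp [← List.map_eq_flatMap, Function.comp_def]

theorem rowOp_prod_Om_mul_omSet {e : ℕ → ZMod n} {m : ℕ} (he : Set.InjOn e (Set.Iio m)) {c N r : ℕ}
    (hm : c + N + r < m) :
    rowOp (fun l => e (c + l)) N ((∏ l ∈ Finset.range (c + 1), Om (e l)) *
        omSet r ((Finset.Ico (c + 1) (c + 1 + N + r)).image e)) =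
      (∏ l ∈ Finset.range c, Om (e l)) *
        omSet (r + 1) ((Finset.Ico c (c + 1 + N + r)).image e) := by
  set S := (Finset.Ico c (c + 1 + N + r)).image e with hS
  have hIco : Set.InjOn e (Finset.Ico c (c + 1 + N + r)) :=
    he.mono fun l hl => by
      have := (Finset.mem_Ico.1 (Finset.mem_coe.1 hl)).2
      exact Set.mem_Iio.2 (by omega)
  have herase : (Finset.Ico (c + 1) (c + 1 + N + r)).image e = S.erase (e c) := by
    rw [hS, ← Finset.insert_Ico_add_one_left_eq_Ico (by omega : c < c + 1 + N + r),
      Finset.image_insert, Finset.erase_insert]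
    intro h
    obtain ⟨l, hl, hle⟩ := Finset.mem_image.1 h
    have hl := Finset.mem_Ico.1 hl
    have := he (Set.mem_Iio.2 (by omega)) (Set.mem_Iio.2 (by omega)) hle
    omega
  have hprefix (l : ℕ) (hl : l < N) := permL_swap_prod_Om_range he (c := c) (p := c + l)
    (by omega) (by omega) (by omega)
  rw [Finset.prod_range_succ, mul_assoc, rowOp_mul_of_permL_eq hprefix, herase]
  congr 1
  refine rowOp_Om_mul_omSet (e := fun l => e (c + l)) (fun a ha b hb hab => ?_) ?_ ?_
  · have ha := Set.mem_Iic.1 ha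
    have hb := Set.mem_Iic.1 hb
    have := he (Set.mem_Iio.2 (by omega)) (Set.mem_Iio.2 (by omega)) hab
    omega
  · refine Finset.image_subset_iff.2 fun l hl => Finset.mem_image_of_mem e (Finset.mem_Ico.2 ?_)
    have := Finset.mem_range.1 hl
    omega
  · rw [hS, Finset.card_image_of_injOn hIco, Nat.card_Ico]
    omega

theorem mul_shift_gClosed_replicate {i N r : ℕ} (hn : N + i < n) (hr : r ≤ i) :
    (∏ l ∈ Finset.range i, Om (tailIx n i l)) *
        shift (2 * i + 1) (gClosed n (List.replicate r N)) =
      (∏ l ∈ Finset.range (i - r), Om (tailIx n i l)) *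
        omSet r ((Finset.Ico (i - r) (N + i)).image (tailIx n i)) := by
  induction r with
  | zero => simp [gClosed, residueWord, omSet_zero]
  | succ r ih =>
    obtain ⟨c, hc⟩ : ∃ c, i = c + 1 + r := ⟨i - 1 - r, by omega⟩
    have hrow := rowOp_prod_Om_mul_omSet (tailIx_injOn n i) (c := c) (N := N) (r := r) (by omega)
    rw [gClosed, residueWord_replicate_succ, List.foldr_append,
      mul_shift_foldr_opD (by omega) (by omega) (by omega), ← gClosed, ih (by omega),
      show i - 1 - r = c by omega, show i - r = c + 1 by omega, show i - (r + 1) = c by omega,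
      show N + i = c + 1 + N + r by omega, hrow]

end Rectangle

/-! ### The image of the quantum Grothendieck polynomial -/

theorem prod_Icc_Om_eq (n i : ℕ) :
    (∏ l ∈ Finset.Icc 1 i, (Om ((i + l + 1 : ℕ) : ZMod n) : Lam n)) =
      ∏ l ∈ Finset.range i, Om (tailIx n i l) := by
  rw [← Finset.Ico_add_one_right_eq_Icc, Finset.prod_Ico_eq_prod_range, Nat.add_sub_cancel]
  refine Finset.prod_congr rfl fun l _ => ?_
  rw [tailIx, show i + 2 + l = i + (1 + l) + 1 by omega]

theorem sigAt_betaZ_eq_mul_shift_gClosed {n i : ℕ} (hi : i < n) :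
    sigAt (betaZ n * (1 + algebraMap (RT n) (Lam n)
      (-expW (wt n ((i + 1 : ℕ) : ZMod n))) • matAS n (Lam n))) i =
      (∏ l ∈ Finset.Icc 1 i, Om ((i + l + 1 : ℕ) : ZMod n)) *
        shift (2 * i + 1) (gClosed n (List.replicate i (n - i - 1))) := by
  obtain ⟨N, rfl⟩ : ∃ N, n = N + i + 1 := ⟨n - i - 1, by omega⟩
  have hinj : Function.Injective fun l : Fin (N + i) => tailIx (N + i + 1) i l := fun a b hab =>
    Fin.ext (tailIx_injOn _ i (Set.mem_Iio.2 (by omega)) (Set.mem_Iio.2 (by omega)) hab)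
  have hrange : Set.range (fun l : Fin (N + i) => tailIx (N + i + 1) i l) =
      ((Finset.Ico 0 (N + i)).image (tailIx (N + i + 1) i) : Set (ZMod (N + i + 1))) := by
    ext z
    simp [Fin.exists_iff]
  rw [show N + i + 1 - i - 1 = N by omega, prod_Icc_Om_eq,
    mul_shift_gClosed_replicate (by omega) le_rfl, Nat.sub_self, Finset.range_zero,
    Finset.prod_empty, one_mul, omSet_eq_omBialt i hinj hrange,
    sigAt_betaZ_eq_omBialt (by omega)]

theorem constantCoeff_beta_sig_ne_zero (n i : ℕ) :
    MvPowerSeries.constantCoeff (beta n (sig n i)) ≠ 0 :=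
  ((isUnit_beta_sig n i).map MvPowerSeries.constantCoeff).ne_zero

theorem PhiTilde_psi {n : ℕ} {Φ : OYo n →ₐ[RT n] OZo n} (hΦ : IsPhi Φ) {i : ℕ} (hi : i < n) :
    PhiTilde Φ (clsY (psi n i)) =
      (beta n (sig n i))⁻¹ * (∏ l ∈ Finset.Icc 1 i, Om ((i + l + 1 : ℕ) : ZMod n)) *
        shift (2 * i + 1) (gClosed n (List.replicate i (n - i - 1))) := by
  have : NeZero n := ⟨by omega⟩
  rw [mul_assoc, ← sigAt_betaZ_eq_mul_shift_gClosed hi, ← PhiTilde_psi_mul_beta_sig hΦ hi,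
    mul_left_comm, MvPowerSeries.inv_mul_cancel _ (constantCoeff_beta_sig_ne_zero n i), mul_one]

theorem prod_inv_of_constantCoeff_ne_zero {σ K ι : Type*} [Field K] {s : Finset ι}
    {f : ι → MvPowerSeries σ K} (hf : ∀ i ∈ s, MvPowerSeries.constantCoeff (f i) ≠ 0) :
    ∏ i ∈ s, (f i)⁻¹ = (∏ i ∈ s, f i)⁻¹ := by
  rw [MvPowerSeries.eq_inv_iff_mul_eq_one, ← Finset.prod_mul_distrib]
  · exact Finset.prod_eq_one fun i hi => MvPowerSeries.inv_mul_cancel _ (hf i hi)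
  · rw [map_prod]
    exact Finset.prod_ne_zero_iff.2 hf

theorem gClosed_replicate_zero (n i : ℕ) : gClosed n (List.replicate i 0) = 1 := by
  induction i with
  | zero => simp [gClosed, residueWord]
  | succ i ih => simpa [gClosed, residueWord_replicate_succ] using ih

/-- The factor `i = n - 1` is `1`, its rectangle being empty. -/
theorem prod_shift_gClosed_rectangle (n : ℕ) (hn : 2 ≤ n) :
    ∏ i ∈ Finset.Icc 1 (n - 1), shift (2 * i + 1) (gClosed n (List.replicate i (n - i - 1))) =
      ∏ i ∈ Finset.Icc 1 (n - 2),
        shift (2 * i + 1) (gClosed n (List.replicate i (n - i - 1))) := by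
  obtain ⟨m, rfl⟩ : ∃ m, n = m + 2 := ⟨n - 2, by omega⟩
  rw [show m + 2 - 1 = m + 1 by omega, Finset.prod_Icc_succ_top (by omega),
    show m + 2 - (m + 1) - 1 = 0 by omega, gClosed_replicate_zero, map_one, mul_one]
  rfl

theorem PhiTilde_grothLongest {n : ℕ} (hn : 2 ≤ n) {Φ : OYo n →ₐ[RT n] OZo n} (hΦ : IsPhi Φ) :
    PhiTilde Φ (clsY (grothLongest n)) =
      (∏ i ∈ Finset.Icc 1 (n - 1), beta n (sig n i))⁻¹ *
        (∏ i ∈ Finset.Icc 1 (n - 1), ∏ l ∈ Finset.Icc 1 i, Om ((i + l + 1 : ℕ) : ZMod n)) *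
        ∏ i ∈ Finset.Icc 1 (n - 2),
          shift (2 * i + 1) (gClosed n (List.replicate i (n - i - 1))) := by
  have hprod : PhiTilde Φ (clsY (grothLongest n)) =
      ∏ i ∈ Finset.Icc 1 (n - 1), PhiTilde Φ (clsY (psi n i)) := by
    change (betaSigmaLocAlg n).comp (Φ.comp (clsHom n)) (grothLongest n) = _
    rw [grothLongest, map_prod]
    rfl
  have hfactor (i : ℕ) (hi : i ∈ Finset.Icc 1 (n - 1)) : i < n := by
    have := Finset.mem_Icc.1 hi
    omega
  rw [hprod, Finset.prod_congr rfl fun i hi => PhiTilde_psi hΦ (hfactor i hi),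
    Finset.prod_mul_distrib, Finset.prod_mul_distrib, prod_shift_gClosed_rectangle n hn,
    prod_inv_of_constantCoeff_ne_zero fun i _ => constantCoeff_beta_sig_ne_zero n i]

end KPeterson

end

theorem mainTheorem9 (n : ℕ) (hn : 2 ≤ n) :
    ∃ Φ : OYo n →ₐ[RT n] OZo n,
      IsPhi Φ ∧ (∀ Φ' : OYo n →ₐ[RT n] OZo n, IsPhi Φ' → Φ' = Φ) ∧
      (∀ i : ℕ, 1 ≤ i → i ≤ n - 1 →
        PhiTilde Φ (clsY (psi n i)) =
          (beta n (sig n i))⁻¹ * (∏ l ∈ Finset.Icc 1 i, Om ((i + l + 1 : ℕ) : ZMod n)) *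
            shift (2 * i + 1) (gClosed n (List.replicate i (n - i - 1)))) ∧
      PhiTilde Φ (clsY (grothLongest n)) =
        (∏ i ∈ Finset.Icc 1 (n - 1), beta n (sig n i))⁻¹ *
          (∏ i ∈ Finset.Icc 1 (n - 1), ∏ l ∈ Finset.Icc 1 i, Om ((i + l + 1 : ℕ) : ZMod n)) *
          ∏ i ∈ Finset.Icc 1 (n - 2),
            shift (2 * i + 1) (gClosed n (List.replicate i (n - i - 1))) := by
  have : NeZero n := ⟨by omega⟩
  obtain ⟨Φ, hΦ⟩ := exists_isPhi n
  exact ⟨Φ, hΦ, fun Φ' hΦ' => hΦ.unique hΦ', fun i _ hi => PhiTilde_psi hΦ (by omega),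
    PhiTilde_grothLongest hn hΦ⟩
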